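/- Let $G$ be a Lie group acting smoothly and transitively on a connected manifold $M=G/K$ of dimension $n$, where $K$ is the isotropy group of $o\in M$; assume that $G$ is unimodular, and let $\mathfrak g=\mathfrak k\oplus\mathfrak p$ be a reductive decomposition ($\mathrm{Ad}(K)\mathfrak p\subset\mathfrak p$), so that $T_oM\equiv\mathfrak p$. Let $\mathcal S^2(M)^G$ be the space of $G$-invariant symmetric $2$-tensors on $M$, $\mathcal M^G\subset\mathcal S^2(M)^G$ the cone of $G$-invariant Riemannian metrics, and let $g\in\mathcal M^G$ be Einstein, $\mathrm{Ric}(g)=\rho g$, with $\langle\cdot,\cdot\rangle=g_o$ on $\mathfrak p$. A tensor $T\in\mathcal S^2(M)^G$ is identified with the $\langle\cdot,\cdot\rangle$-symmetric operator $A$ of $\mathfrak p$ such that $T_o=\langle A\cdot,\cdot\rangle$, and $\langle T,S\rangle_g:=\mathrm{tr}(A_TA_S)$. Let $\mathrm{Aut}(G/K)$ be the group of automorphisms of the Lie group $G$ taking $K$ onto $K$, acting on $M$ by $aK\mapsto\varphi(a)K$ and on $\mathcal M^G$ by pullback. Let $W\subset\mathcal S^2(M)^G$ be the $\langle\cdot,\cdot\rangle_g$-orthogonal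 complement of $\mathbb R g+T_g(\mathrm{Aut}(G/K)\cdot g)$. Let $\mathcal M_1^G\subset\mathcal M^G$ be the submanifold of the metrics $g'$ with $\det_g g'=1$; $g$ is a critical point of the scalar curvature $\mathrm{Sc}:\mathcal M^G_1\to\mathbb R$, and $\mathrm{Sc}''_g$ denotes its Hessian at $g$, restricted to $W\subset T_g\mathcal M_1^G$. Let $E(g')=\mathrm{Ric}(g')-\frac{\mathrm{Sc}(g')}{n}g'$ for $g'\in\mathcal M^G$. The metric $g$ is called $G$-stable if $\mathrm{Sc}''_g<0$ on $W$ (negative definite), $G$-unstable if $\mathrm{Sc}''_g(T,T)>0$ for some $T\in W$, $G$-non-degenerate if $\mathrm{Sc}''_g$ is non-degenerate on $W$, $G$-neutrally stable if $\mathrm{Sc}''_g\le 0$ on $W$ and it is degenerate, $G$-strongly unstable if $\mathrm{Sc}''_g>0$ on $W$ (positive definite), and $G$-infinitesimally non-deformable if $\ker(dE|_g)\cap W=0$. Let $\mu_{\mathfrak p}:\mathfrak p\times\mathfrak p\to\mathfrak p$ be the Lie bracket of $\mathfrak g$ composed with the projection on $\mathfrak p$ along $\mathfrak k$. For $A\in\mathfrak{gl}(\mathfrak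 p)$ put $\theta(A)\mu_{\mathfrak p}=A\mu_{\mathfrak p}(\cdot,\cdot)-\mu_{\mathfrak p}(A\cdot,\cdot)-\mu_{\mathfrak p}(\cdot,A\cdot)$ and $\delta(A)=-\theta(A)\mu_{\mathfrak p}$. Let $\delta^t$ be the transpose of $\delta$ for the inner products $\mathrm{tr}(AB^t)$ and $\langle\lambda,\lambda'\rangle=\sum_{i,j}\langle\lambda(X_i,X_j),\lambda'(X_i,X_j)\rangle$ ($\{X_i\}$ an orthonormal basis of $\mathfrak p$), let $\mathsf M$ be defined by $\mathrm{tr}(\mathsf M A^t)=\frac14\langle\theta(A)\mu_{\mathfrak p},\mu_{\mathfrak p}\rangle$ for all $A\in\mathfrak{gl}(\mathfrak p)$, and $$L_{\mathfrak p}A=\tfrac12\,S(\delta^t\delta A)+A\mathsf M+\mathsf MA,\qquad S(B)=\tfrac12(B+B^t).$$ Then $L_{\mathfrak p}$ preserves $W$, and if $W\neq0$ its restriction has a least eigenvalue $\lambda_{\mathfrak p}$ and a greatest eigenvalue $\lambda_{\mathfrak p}^{\max}$. With the convention $\lambda_{\mathfrak p}=+\infty$, $\lambda_{\mathfrak p}^{\max}=-\infty$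 if $W=0$, the following holds: (i) $g$ is $G$-stable if and only if $2\rho<\lambda_{\mathfrak p}$. (ii) $g$ is $G$-unstable if and only if $\lambda_{\mathfrak p}<2\rho$. (iii) $g$ is $G$-non-degenerate if and only if it is $G$-infinitesimally non-deformable, if and only if $2\rho\notin\mathrm{Spec}(L_{\mathfrak p}|_W)$. (iv) $g$ is $G$-neutrally stable if and only if $\lambda_{\mathfrak p}=2\rho$. (v) $g$ is $G$-strongly unstable if and only if $\lambda_{\mathfrak p}^{\max}<2\rho$. -/

import Mathlib

set_option maxSynthPendingDepth 3

open scoped Manifold ContDiff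
open Bundle

noncomputable section

namespace HomEinstein

/-! ### Curvature of a metric in local coordinates -/

section Coordinates

variable {F : Type*} [NormedAddCommGroup F] [NormedSpace ℝ F]

/-- The Christoffel symbols of the first kind of a field `γ` of symmetric bilinear forms on the
vector space `F`:
`(u, v, w) ↦ ((∂_u γ)(v, w) + (∂_v γ)(u, w) - (∂_w γ)(u, v)) / 2`. -/
def christoffelLower (γ : F → F →L[ℝ] F →L[ℝ] ℝ) (y : F) :
    F →L[ℝ] F →L[ℝ] F →L[ℝ] ℝ :=
  let D : F →L[ℝ] F →L[ℝ] F →L[ℝ] ℝ := fderiv ℝ γ y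
  let D₂ : F →L[ℝ] F →L[ℝ] F →L[ℝ] ℝ := D.flip
  let flip : (F →L[ℝ] F →L[ℝ] ℝ) →L[ℝ] (F →L[ℝ] F →L[ℝ] ℝ) :=
    (ContinuousLinearMap.flipₗᵢ ℝ F F ℝ).toContinuousLinearEquiv.toContinuousLinearMap
  let D₃ : F →L[ℝ] F →L[ℝ] F →L[ℝ] ℝ := flip.comp D₂
  (1 / 2 : ℝ) • (D + D₂ - D₃)

/-- The Christoffel symbols of the second kind: `Γ_y(u, v)` is the vector such that
`γ_y(Γ_y(u, v), w) = christoffelLower γ y u v w` for all `w` (when `γ_y` is non-degenerate). -/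
def christoffel (γ : F → F →L[ℝ] F →L[ℝ] ℝ) (y : F) : F →L[ℝ] F →L[ℝ] F :=
  (ContinuousLinearMap.compL ℝ F (F →L[ℝ] ℝ) F (γ y).inverse).comp (christoffelLower γ y)

/-- For fixed `v, w`, the endomorphism `u ↦ R(u, v) w`, where
`R(u, v) w = (∂_u Γ)(v, w) - (∂_v Γ)(u, w) + Γ(u, Γ(v, w)) - Γ(v, Γ(u, w))` is the curvature
tensor `R(u, v) = [∇_u, ∇_v] - ∇_[u, v]` of the Levi-Civita connection of `γ`. -/
def curvatureEndo (γ : F → F →L[ℝ] F →L[ℝ] ℝ) (y v w : F) : F →L[ℝ] F :=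
  ((fderiv ℝ (christoffel γ) y).flip v).flip w
    - (fderiv ℝ (christoffel γ) y v).flip w
    + (christoffel γ y).flip (christoffel γ y v w)
    - (christoffel γ y v).comp ((christoffel γ y).flip w)

/-- The Ricci tensor of `γ` in coordinates: `Ric(v, w) = tr (u ↦ R(u, v) w)`. -/
def ricciCoord (γ : F → F →L[ℝ] F →L[ℝ] ℝ) (y v w : F) : ℝ :=
  LinearMap.trace ℝ F (curvatureEndo γ y v w : F →ₗ[ℝ] F)

end Coordinates

/-! ### Symmetric two-tensors on a manifold and the Ricci tensor -/

section Manifold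

variable {F : Type*} [NormedAddCommGroup F] [NormedSpace ℝ F]
  {M : Type*} [TopologicalSpace M] [ChartedSpace F M]

variable (F M) in
/-- Fields of bilinear forms on the tangent spaces of `M`. -/
abbrev Tensor2 : Type _ :=
  (x : M) → TangentSpace 𝓘(ℝ, F) x →L[ℝ] TangentSpace 𝓘(ℝ, F) x →L[ℝ] ℝ

/-- The expression of the tensor field `T` in the preferred chart at `x₀`: its pullback by the
inverse of the chart. -/
def inChart (T : Tensor2 F M) (x₀ : M) (y : F) : F →L[ℝ] F →L[ℝ] ℝ :=
  let D : F →L[ℝ] F := mfderiv 𝓘(ℝ, F) 𝓘(ℝ, F) (extChartAt 𝓘(ℝ, F) x₀).symm y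
  let B : F →L[ℝ] F →L[ℝ] ℝ := T ((extChartAt 𝓘(ℝ, F) x₀).symm y)
  B.bilinearComp D D

/-- The Ricci tensor at `x` of the (pseudo-)Riemannian metric `g` on `M`. -/
def ricci (g : Tensor2 F M) (x : M) (u v : TangentSpace 𝓘(ℝ, F) x) : ℝ :=
  let D : TangentSpace 𝓘(ℝ, F) x →L[ℝ] F :=
    mfderiv 𝓘(ℝ, F) 𝓘(ℝ, F) (extChartAt 𝓘(ℝ, F) x) x
  ricciCoord (inChart g x) (extChartAt 𝓘(ℝ, F) x x) (D u) (D v)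

/-- `g` is Einstein with constant `ρ`: `Ric(g) = ρ g`. -/
def IsEinstein (g : Tensor2 F M) (ρ : ℝ) : Prop :=
  ∀ (x : M) (u v : TangentSpace 𝓘(ℝ, F) x), ricci g x u v = ρ * g x u v

variable [IsManifold 𝓘(ℝ, F) ∞ M] (G : Type*) [Group G] [MulAction G M]

/-- The space `S²(M)^G` of smooth `G`-invariant symmetric `2`-tensors on `M`. -/
structure IsInvSym (T : Tensor2 F M) : Prop where
  smooth : ContMDiff 𝓘(ℝ, F) (𝓘(ℝ, F).prod 𝓘(ℝ, F →L[ℝ] F →L[ℝ] ℝ)) ∞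
    (fun x : M ↦ TotalSpace.mk' (F →L[ℝ] F →L[ℝ] ℝ)
      (E := fun x : M ↦ TangentSpace 𝓘(ℝ, F) x →L[ℝ] TangentSpace 𝓘(ℝ, F) x →L[ℝ] ℝ) x (T x))
  symm : ∀ (x : M) (u v : TangentSpace 𝓘(ℝ, F) x), T x u v = T x v u
  invariant : ∀ (a : G) (x : M) (u v : TangentSpace 𝓘(ℝ, F) x),
    T (a • x) (mfderiv 𝓘(ℝ, F) 𝓘(ℝ, F) (fun y : M ↦ a • y) x u)
      (mfderiv 𝓘(ℝ, F) 𝓘(ℝ, F) (fun y : M ↦ a • y) x v) = T x u v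

/-- The cone `M^G` of `G`-invariant Riemannian metrics on `M`. -/
structure IsInvMetric (g : Tensor2 F M) : Prop extends IsInvSym G g where
  pos : ∀ (x : M) (u : TangentSpace 𝓘(ℝ, F) x), u ≠ 0 → 0 < g x u u

end Manifold

/-! ### The homogeneous space `M = G / K`, with `K` the stabilizer of `o` -/

section Homogeneous

variable (E : Type*) [NormedAddCommGroup E] [NormedSpace ℝ E]
  {F : Type*} [NormedAddCommGroup F] [NormedSpace ℝ F]
  (G : Type*) [TopologicalSpace G] [ChartedSpace E G] [Group G]
  {M : Type*} [TopologicalSpace M] [ChartedSpace F M] [MulAction G M]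

/-- The derivative at the identity of the orbit map `G → M`, `a ↦ a • o`. -/
def orbitDeriv (o : M) : GroupLieAlgebra 𝓘(ℝ, E) G →L[ℝ] TangentSpace 𝓘(ℝ, F) o :=
  mfderiv 𝓘(ℝ, E) 𝓘(ℝ, F) (fun a : G ↦ a • o) 1

/-- The Lie algebra of the isotropy group `K` of `o`, as a subspace of the Lie algebra of `G`:
the kernel of the derivative of the orbit map. -/
def isotropyAlgebra (o : M) : Submodule ℝ (GroupLieAlgebra 𝓘(ℝ, E) G) :=
  LinearMap.ker (orbitDeriv (F := F) E G o : GroupLieAlgebra 𝓘(ℝ, E) G →ₗ[ℝ] TangentSpace 𝓘(ℝ, F) o)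

variable {G} in
/-- The adjoint representation of `G` on its Lie algebra. -/
def Ad (z : G) : GroupLieAlgebra 𝓘(ℝ, E) G →L[ℝ] GroupLieAlgebra 𝓘(ℝ, E) G :=
  mfderiv 𝓘(ℝ, E) 𝓘(ℝ, E) (fun a : G ↦ z * a * z⁻¹) 1

/-- `G` is unimodular: `tr (ad X) = 0` for all `X` in the Lie algebra of `G`. (For connected `G`
this is equivalent to the modular function `|det Ad|` being trivial; in general it is weaker.) -/
def IsUnimodular [FiniteDimensional ℝ E] [LieGroup 𝓘(ℝ, E) ∞ G] : Prop :=
  haveI : CompleteSpace E := FiniteDimensional.complete ℝ E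
  haveI : LieGroup 𝓘(ℝ, E) (minSmoothness ℝ 3) G :=
    LieGroup.of_le (n := ∞) (by rw [minSmoothness_of_isRCLikeNormedField]; exact ENat.LEInfty.out)
  ∀ X : GroupLieAlgebra 𝓘(ℝ, E) G,
    LinearMap.trace ℝ (GroupLieAlgebra 𝓘(ℝ, E) G) (LieAlgebra.ad ℝ _ X) = 0

variable {E G}

/-- `𝔤 = 𝔨 ⊕ 𝔭` is a reductive decomposition: `Ad(K) 𝔭 ⊆ 𝔭`. -/
structure IsReductive (o : M) (p : Submodule ℝ (GroupLieAlgebra 𝓘(ℝ, E) G)) : Prop where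
  isCompl : IsCompl p (isotropyAlgebra (F := F) E G o)
  ad_mem : ∀ z ∈ MulAction.stabilizer G o, ∀ X ∈ p, Ad E z X ∈ p

variable (o : M) {p : Submodule ℝ (GroupLieAlgebra 𝓘(ℝ, E) G)} {n : ℕ}
  (b : Module.Basis (Fin n) ℝ p)

/-- The matrix of a bilinear form on `T_oM` in the basis `b` of `𝔭 ≃ T_oM`. If `b` is orthonormal
for the metric `g` and `T_o = g_o(A ·, ·)`, this is the matrix of the self-adjoint operator `A`. -/
def gram (B : TangentSpace 𝓘(ℝ, F) o → TangentSpace 𝓘(ℝ, F) o → ℝ) :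
    Matrix (Fin n) (Fin n) ℝ :=
  Matrix.of fun i j ↦ B (orbitDeriv E G o (b i)) (orbitDeriv E G o (b j))

/-- The matrix at `o` of a tensor field. -/
def mat (T : Tensor2 F M) : Matrix (Fin n) (Fin n) ℝ := gram o b fun u v ↦ T o u v

/-- `b` is an orthonormal basis of `(𝔭, g_o)`. -/
def IsOrthonormal (g : Tensor2 F M) : Prop := mat o b g = 1

/-- The scalar curvature `tr_g Ric(g)`, computed at `o` (it is constant on `M` if `g` is
`G`-invariant). -/
def scal (g : Tensor2 F M) : ℝ :=
  ((mat o b g)⁻¹ * gram o b (ricci g o)).trace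

/-- The multiple of `h` with determinant `1` relative to the fixed basis `b` (that is, of the same
volume as the metric for which `b` is orthonormal). This is a retraction of the space of invariant
metrics onto the space `M_1^G` of those of fixed volume. -/
def unitVol (h : Tensor2 F M) : Tensor2 F M :=
  ((mat o b h).det ^ (-(1 / (n : ℝ)))) • h

/-- The second derivative at `g` of the scalar curvature functional on the space `M_1^G` of
invariant metrics of fixed volume, evaluated at the tangent vectors `T`, `S`. At a critical point
of `scal|_{M_1^G}` it is the Hessian of `scal|_{M_1^G}` and can be computed along any two-parameter
family of fixed volume metrics with velocities `T` and `S`; we take the normalized affine one. -/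
def scalHess (g T S : Tensor2 F M) : ℝ :=
  deriv (fun s : ℝ ↦ deriv (fun t : ℝ ↦ scal o b (unitVol o b (g + t • T + s • S))) 0) 0

/-- The Einstein operator `E(h) = Ric(h) - (scal(h) / n) h`, at the point `o` (its values are
`G`-invariant tensors, which are determined by their value at `o`). -/
def einsteinOp (h : Tensor2 F M) (u v : TangentSpace 𝓘(ℝ, F) o) : ℝ :=
  ricci h o u v - scal o b h / n * h o u v

/-- The tensor `T` is in the kernel of the derivative `dE|_g`. -/
def InKerEinstein (g T : Tensor2 F M) : Prop :=
  ∀ u v : TangentSpace 𝓘(ℝ, F) o, deriv (fun t : ℝ ↦ einsteinOp o b (g + t • T) u v) 0 = 0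

variable (E G) in
/-- `T` belongs to the tangent space at `g` of the orbit `Aut(G/K) · g`: it is the velocity at
`t = 0` of `ψ_t^* g`, for a smooth path `φ_t` in `Aut(G/K)` (automorphisms of the Lie group `G`
taking `K` onto `K`) starting at the identity, where `ψ_t` is the diffeomorphism
`a • o ↦ φ_t(a) • o` of `M` defined by `φ_t`. -/
def IsTrivialVariation (g T : Tensor2 F M) : Prop :=
  ∃ (φ : ℝ → G ≃* G) (ψ : ℝ → M → M),
    ContMDiff (𝓘(ℝ, ℝ).prod 𝓘(ℝ, E)) 𝓘(ℝ, E) ∞ (fun q : ℝ × G ↦ φ q.1 q.2) ∧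
    (∀ t a, φ t a ∈ MulAction.stabilizer G o ↔ a ∈ MulAction.stabilizer G o) ∧
    (∀ a, φ 0 a = a) ∧
    (∀ t (a : G), ψ t (a • o) = φ t a • o) ∧
    ∀ (x : M) (u v : TangentSpace 𝓘(ℝ, F) x),
      HasDerivAt (fun t : ℝ ↦ g (ψ t x) (mfderiv 𝓘(ℝ, F) 𝓘(ℝ, F) (ψ t) x u)
        (mfderiv 𝓘(ℝ, F) 𝓘(ℝ, F) (ψ t) x v)) (T x u v) 0

section W

variable [IsManifold 𝓘(ℝ, F) ∞ M]

/-- The space `W_g`: the orthogonal complement in `S²(M)^G` of `ℝ g ⊕ T_g Aut(G/K) · g`, for the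
inner product `⟨T, S⟩_g = tr (A_T A_S)`, where `T_o = g_o(A_T ·, ·)`, `S_o = g_o(A_S ·, ·)`
(here `b` is `g_o`-orthonormal). -/
structure InW (g T : Tensor2 F M) : Prop where
  invSym : IsInvSym G T
  orth_metric : (mat o b T * mat o b g).trace = 0
  orth_trivial : ∀ S : Tensor2 F M, IsInvSym G S → IsTrivialVariation E G o g S →
    (mat o b T * mat o b S).trace = 0

/-! ### Stability types -/

/-- `g` is `G`-stable. -/
def GStable (g : Tensor2 F M) : Prop :=
  ∀ T : Tensor2 F M, InW o b g T → T ≠ 0 → scalHess o b g T T < 0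

/-- `g` is `G`-unstable. -/
def GUnstable (g : Tensor2 F M) : Prop :=
  ∃ T : Tensor2 F M, InW o b g T ∧ 0 < scalHess o b g T T

/-- `g` is `G`-non-degenerate. -/
def GNonDegenerate (g : Tensor2 F M) : Prop :=
  ∀ T : Tensor2 F M, InW o b g T →
    (∀ S : Tensor2 F M, InW o b g S → scalHess o b g T S = 0) → T = 0

/-- `g` is `G`-neutrally stable. -/
def GNeutrallyStable (g : Tensor2 F M) : Prop :=
  (∀ T : Tensor2 F M, InW o b g T → scalHess o b g T T ≤ 0) ∧ ¬ GNonDegenerate o b g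

/-- `g` is `G`-strongly unstable. -/
def GStronglyUnstable (g : Tensor2 F M) : Prop :=
  ∀ T : Tensor2 F M, InW o b g T → T ≠ 0 → 0 < scalHess o b g T T

/-- `g` is `G`-infinitesimally non-deformable. -/
def GInfNonDeformable (g : Tensor2 F M) : Prop :=
  ∀ T : Tensor2 F M, InW o b g T → InKerEinstein o b g T → T = 0

end W

end Homogeneous

/-! ### The operator `L_𝔭`

Operators on `𝔭` are written as matrices, and bilinear maps `𝔭 × 𝔭 → 𝔭` as arrays
`c i j k = ⟨c(X_i, X_j), X_k⟩`, relative to an orthonormal basis `X_1, …, X_n` of `𝔭`. -/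

section Operator

variable {n : ℕ}

/-- `θ(A) c = A c(·, ·) - c(A ·, ·) - c(·, A ·)`. -/
def theta (A : Matrix (Fin n) (Fin n) ℝ) (c : Fin n → Fin n → Fin n → ℝ) :
    Fin n → Fin n → Fin n → ℝ := fun i j k ↦
  ∑ l, A k l * c i j l - ∑ l, A l i * c l j k - ∑ l, A l j * c i l k

/-- The inner product `⟨c, d⟩ = ∑ ⟨c(X_i, X_j), d(X_i, X_j)⟩` of bilinear maps. -/
def ip3 (c d : Fin n → Fin n → Fin n → ℝ) : ℝ := ∑ i, ∑ j, ∑ k, c i j k * d i j k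

/-- `δ_c(A) = - θ(A) c`. -/
def delta (c : Fin n → Fin n → Fin n → ℝ) (A : Matrix (Fin n) (Fin n) ℝ) :
    Fin n → Fin n → Fin n → ℝ := - theta A c

/-- The transpose of `δ_c`: `⟨δ_c^t d, A⟩ = ⟨d, δ_c(A)⟩` for the inner product `tr (A Bᵗ)`. -/
def deltaT (c d : Fin n → Fin n → Fin n → ℝ) : Matrix (Fin n) (Fin n) ℝ :=
  Matrix.of fun i j ↦ ip3 d (delta c (Matrix.single i j 1))

/-- The moment map: `⟨M_c, A⟩ = (1/4) ⟨θ(A) c, c⟩` for the inner product `tr (A Bᵗ)`. -/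
def momentMap (c : Fin n → Fin n → Fin n → ℝ) : Matrix (Fin n) (Fin n) ℝ :=
  Matrix.of fun i j ↦ (1 / 4) * ip3 (theta (Matrix.single i j 1) c) c

/-- `L A = (1/2) S(δ_c^t δ_c A) + A M_c + M_c A`, with `S(B) = (B + Bᵗ) / 2`. -/
def lichOp (c : Fin n → Fin n → Fin n → ℝ) (A : Matrix (Fin n) (Fin n) ℝ) :
    Matrix (Fin n) (Fin n) ℝ :=
  (1 / 2 : ℝ) • ((1 / 2 : ℝ) • (deltaT c (delta c A) + (deltaT c (delta c A)).transpose))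
    + A * momentMap c + momentMap c * A

end Operator

section Spectrum

variable {E : Type*} [NormedAddCommGroup E] [NormedSpace ℝ E]
  {F : Type*} [NormedAddCommGroup F] [NormedSpace ℝ F]
  {G : Type*} [TopologicalSpace G] [ChartedSpace E G] [Group G]
  {M : Type*} [TopologicalSpace M] [ChartedSpace F M] [MulAction G M]
  {o : M} {p : Submodule ℝ (GroupLieAlgebra 𝓘(ℝ, E) G)} {n : ℕ}
  [IsManifold 𝓘(ℝ, F) ∞ M]

/-- The product `μ_𝔭 : 𝔭 × 𝔭 → 𝔭`, the Lie bracket of `𝔤` restricted to `𝔭` and projected on `𝔭`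
relative to `𝔤 = 𝔨 ⊕ 𝔭`, in the basis `b`. -/
def muP (hp : IsReductive (F := F) o p) (b : Module.Basis (Fin n) ℝ p) :
    Fin n → Fin n → Fin n → ℝ := fun i j k ↦
  b.repr (Submodule.projectionOnto p _ hp.isCompl
    ⁅(b i : GroupLieAlgebra 𝓘(ℝ, E) G), (b j : GroupLieAlgebra 𝓘(ℝ, E) G)⁆) k

/-- The operator `L_𝔭` of the metric for which `b` is orthonormal. -/
def Lp (hp : IsReductive (F := F) o p) (b : Module.Basis (Fin n) ℝ p) :
    Matrix (Fin n) (Fin n) ℝ → Matrix (Fin n) (Fin n) ℝ :=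
  lichOp (muP hp b)

/-- The spectrum of `L_𝔭` restricted to `W`, where `W` is the space of the operators `A` with
`g_o(A ·, ·) = T_o`, `T ∈ W_g`. -/
def specW (hp : IsReductive (F := F) o p) (b : Module.Basis (Fin n) ℝ p) (g : Tensor2 F M) :
    Set ℝ :=
  {c | ∃ T : Tensor2 F M, InW o b g T ∧ T ≠ 0 ∧ Lp hp b (mat o b T) = c • mat o b T}

/-- The minimum eigenvalue of `L_𝔭|_W`, with the convention `min ∅ = +∞` (if `W = 0`). -/
def lamMin (hp : IsReductive (F := F) o p) (b : Module.Basis (Fin n) ℝ p) (g : Tensor2 F M) :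
    EReal :=
  sInf ((fun c : ℝ ↦ (c : EReal)) '' specW hp b g)

/-- The maximum eigenvalue of `L_𝔭|_W`, with the convention `max ∅ = -∞` (if `W = 0`). -/
def lamMax (hp : IsReductive (F := F) o p) (b : Module.Basis (Fin n) ℝ p) (g : Tensor2 F M) :
    EReal :=
  sSup ((fun c : ℝ ↦ (c : EReal)) '' specW hp b g)

end Spectrum

end HomEinstein

end

noncomputable section

/-! Describe an invariant metric by its Gram matrix `H` in a basis of `𝔭` orthonormal for `g_o`, so
that `g` itself is `H = 1`. For unimodular `G` the Ricci tensor is an explicit function `ricMat c β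
H`, where `c` are the structure constants of `μ_𝔭` and `β`, which does not depend on `H`, is the
Killing form on `𝔭`. Three facts about this function carry the theorem.

(1) Its derivative at `1` in the direction `S` is `½ L_𝔭 S` (`lichOp_apply`,
`MatHasDerivAt.ricMat`). The first variation of the scalar curvature is minus the pairing with
Ricci, so a second differentiation at an Einstein metric gives `Sc''(T, S) = ½ ⟨T, (2ρ - L_𝔭) S⟩`
for traceless `T` (`hasDerivAt_normScalDeriv`, `scalHess_eq`). In the same way `dE(T) = ½ (L_𝔭 - 2ρ)
T` (`inKerEinstein_iff`).

(2) `L_𝔭` preserves `W`. It maps invariant tensors to invariant tensors, because it is a derivative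
of isotropy invariant Ricci forms, which extend from `o` to `M` (`exists_isInvSym_formAt`,
`exists_mat_eq_Lp`). It is self-adjoint (`frob_lichOp_comm`), it kills `g` because Ricci is scale
invariant (`lichOp_one`), and it is `2ρ` on trivial variations, because automorphisms change neither
`c` nor `β` and the Einstein equation therefore persists along the orbit
(`Lp_mat_of_isTrivialVariation`). So it preserves the orthogonal complement of these tensors.

(3) In an eigenbasis of `W` the Hessian is diagonal with entries `(2ρ - λ_i) / 2`, and all the
stability types are sign conditions on them (`stability_of_spectrum`).

The geometric half is the Ricci formula. The fundamental fields of the action are Killing, and the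
bracket of those of `X` and `Y` is minus that of `[X, Y]`. Koszul's formula expresses the connection
by brackets, its derivative expresses the curvature (`IsKillingFamily.inner_curvatureEndo`), and the
trace simplifies by unimodularity and by the skewness of the isotropy (`ricci_contraction`,
`IsKillingFamily.ricciCoord_eq`). The work is done in charts: `IsLocalAction` records a local group
law with a local action, and `bracket_eq_localBracket` identifies its bracket with that of the Lie
algebra. The formula is proved in every frame that is the image of the one of `𝔭` by an endomorphism
of the Lie algebra preserving `𝔨` (`ricci_hom_frame`); this generality yields both the isotropy
invariance of Ricci and the statement on trivial variations. -/

namespace HomEinstein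

set_option linter.unusedSectionVars false

open Filter Topology

/-! ### Curvature of a metric in terms of Killing fields. -/

section LocalKilling

variable {E : Type*} [NormedAddCommGroup E] [NormedSpace ℝ E]
  {F : Type*} [NormedAddCommGroup F] [NormedSpace ℝ F]

/-- A metric `γ` near `y₀`, with a Lie algebra `(E, br)` of Killing vector fields
`X ↦ (y ↦ ξ y X)`. -/
structure IsKillingFamily (γ : F → F →L[ℝ] F →L[ℝ] ℝ) (ξ : F → E →L[ℝ] F)
    (br : E →L[ℝ] E →L[ℝ] E) (y₀ : F) : Prop where
  contDiffAt_metric : ContDiffAt ℝ 2 γ y₀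
  contDiffAt_field : ContDiffAt ℝ 2 ξ y₀
  symm : ∀ᶠ y in 𝓝 y₀, ∀ u v, γ y u v = γ y v u
  isInvertible : (γ y₀).IsInvertible
  killing : ∀ᶠ y in 𝓝 y₀, ∀ X u v,
    fderiv ℝ γ y (ξ y X) u v + γ y (fderiv ℝ ξ y u X) v + γ y u (fderiv ℝ ξ y v X) = 0
  bracket : ∀ᶠ y in 𝓝 y₀, ∀ X Y,
    fderiv ℝ ξ y (ξ y X) Y - fderiv ℝ ξ y (ξ y Y) X = - ξ y (br X Y)

/-- The covariant derivative `∇_Y Z` of the vector fields defined by `Y` and `Z`. -/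
def nabla (γ : F → F →L[ℝ] F →L[ℝ] ℝ) (ξ : F → E →L[ℝ] F) (Y Z : E) (y : F) : F :=
  fderiv ℝ ξ y (ξ y Y) Z + christoffel γ y (ξ y Y) (ξ y Z)

variable {γ : F → F →L[ℝ] F →L[ℝ] ℝ} {ξ : F → E →L[ℝ] F} {br : E →L[ℝ] E →L[ℝ] E} {y₀ : F}

lemma christoffelLower_apply (y u v w : F) :
    christoffelLower γ y u v w
      = (1 / 2) * (fderiv ℝ γ y u v w + fderiv ℝ γ y v u w - fderiv ℝ γ y w u v) := by
  rfl

lemma christoffel_spec {y : F} (hy : (γ y).IsInvertible) (u v w : F) :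
    γ y (christoffel γ y u v) w = christoffelLower γ y u v w := by
  obtain ⟨e, he⟩ := hy
  have : γ y ((γ y).inverse (christoffelLower γ y u v)) = christoffelLower γ y u v := by
    rw [← he, ContinuousLinearMap.inverse_equiv]
    simp
  exact congrArg (fun l : F →L[ℝ] ℝ ↦ l w) this

lemma fderiv_metric_symm {y : F} (hd : DifferentiableAt ℝ γ y)
    (hs : ∀ᶠ z in 𝓝 y, ∀ u v, γ z u v = γ z v u) (h u v : F) :
    fderiv ℝ γ y h u v = fderiv ℝ γ y h v u := by
  have h1 : HasFDerivAt (fun z ↦ γ z u v) (((fderiv ℝ γ y).flip u).flip v) y := by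
    convert! (hd.hasFDerivAt.clm_apply (hasFDerivAt_const u y)).clm_apply
      (hasFDerivAt_const v y) using 1
    ext; simp
  have h2 : HasFDerivAt (fun z ↦ γ z v u) (((fderiv ℝ γ y).flip v).flip u) y := by
    convert! (hd.hasFDerivAt.clm_apply (hasFDerivAt_const v y)).clm_apply
      (hasFDerivAt_const u y) using 1
    ext; simp
  have h3 : (fun z ↦ γ z u v) =ᶠ[𝓝 y] fun z ↦ γ z v u := hs.mono fun z hz ↦ hz u v
  have := (h1.congr_of_eventuallyEq h3.symm).unique h2
  exact congrArg (fun l : F →L[ℝ] ℝ ↦ l h) this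

lemma fderiv_metric_eq {y : F} (hd : DifferentiableAt ℝ γ y)
    (hs : ∀ᶠ z in 𝓝 y, ∀ u v, γ z u v = γ z v u) (hy : (γ y).IsInvertible) (u v w : F) :
    fderiv ℝ γ y u v w = γ y (christoffel γ y u v) w + γ y v (christoffel γ y u w) := by
  rw [hs.self_of_nhds v, christoffel_spec hy, christoffel_spec hy, christoffelLower_apply,
    christoffelLower_apply, fderiv_metric_symm hd hs u w v, fderiv_metric_symm hd hs v u w,
    fderiv_metric_symm hd hs w u v]
  ring

lemma christoffel_symm {y : F} (hd : DifferentiableAt ℝ γ y)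
    (hs : ∀ᶠ z in 𝓝 y, ∀ u v, γ z u v = γ z v u) (u v : F) :
    christoffel γ y u v = christoffel γ y v u := by
  have : christoffelLower γ y u v = christoffelLower γ y v u := by
    ext w
    rw [christoffelLower_apply, christoffelLower_apply, fderiv_metric_symm hd hs w u v]
    ring
  exact congrArg (γ y).inverse this

lemma curvatureEndo_apply (y u v w : F) :
    curvatureEndo γ y v w u = fderiv ℝ (christoffel γ) y u v w - fderiv ℝ (christoffel γ) y v u w
      + christoffel γ y u (christoffel γ y v w) - christoffel γ y v (christoffel γ y u w) := by
  rfl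

namespace IsKillingFamily

variable [FiniteDimensional ℝ F] (h : IsKillingFamily γ ξ br y₀)
include h

lemma eventually_isInvertible : ∀ᶠ y in 𝓝 y₀, (γ y).IsInvertible := by
  have := FiniteDimensional.complete ℝ F
  obtain ⟨e, he⟩ := h.isInvertible
  have := h.contDiffAt_metric.continuousAt
  exact this (he ▸ e.nhds)

lemma differentiableAt_metric : DifferentiableAt ℝ γ y₀ :=
  h.contDiffAt_metric.differentiableAt (by simp)

lemma differentiableAt_field : DifferentiableAt ℝ ξ y₀ :=
  h.contDiffAt_field.differentiableAt (by simp)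

lemma differentiableAt_fderiv_field : DifferentiableAt ℝ (fderiv ℝ ξ) y₀ :=
  (h.contDiffAt_field.fderiv_right (m := 1) (by norm_num)).differentiableAt (by simp)

lemma differentiableAt_christoffel : DifferentiableAt ℝ (christoffel γ) y₀ := by
  have := FiniteDimensional.complete ℝ F
  have h1 : DifferentiableAt ℝ (fun y ↦ (γ y).inverse) y₀ := by
    obtain ⟨e, he⟩ := h.isInvertible
    have h2 : ContDiffAt ℝ 1 (ContinuousLinearMap.inverse : (F →L[ℝ] F →L[ℝ] ℝ) → _) (γ y₀) := by
      rw [← he]; exact contDiffAt_map_inverse e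
    exact (h2.differentiableAt (by simp)).comp y₀ h.differentiableAt_metric
  have h3 : DifferentiableAt ℝ (fderiv ℝ γ) y₀ :=
    (h.contDiffAt_metric.fderiv_right (m := 1) (by norm_num)).differentiableAt (by simp)
  have h4 : DifferentiableAt ℝ (christoffelLower γ) y₀ := by
    let fl : (F →L[ℝ] F →L[ℝ] ℝ) →L[ℝ] (F →L[ℝ] F →L[ℝ] ℝ) :=
      (ContinuousLinearMap.flipₗᵢ ℝ F F ℝ).toContinuousLinearEquiv.toContinuousLinearMap
    let fL : (F →L[ℝ] F →L[ℝ] F →L[ℝ] ℝ) →L[ℝ] (F →L[ℝ] F →L[ℝ] F →L[ℝ] ℝ) :=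
      (ContinuousLinearMap.flipₗᵢ ℝ F F (F →L[ℝ] ℝ)).toContinuousLinearEquiv.toContinuousLinearMap
    have e1 : DifferentiableAt ℝ (fun y ↦ fL (fderiv ℝ γ y)) y₀ := fL.differentiableAt.comp y₀ h3
    have e2 : DifferentiableAt ℝ (fun y ↦ fl.comp (fL (fderiv ℝ γ y))) y₀ :=
      (differentiableAt_const fl).clm_comp e1
    exact ((h3.add e1).sub e2).const_smul (1 / 2 : ℝ)
  exact ((ContinuousLinearMap.compL ℝ F (F →L[ℝ] ℝ) F).differentiableAt.comp y₀ h1).clm_comp h4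

/-- The derivative of the inner product of two Killing fields along a third one. -/
lemma hasFDerivAt_inner {y : F} (hd : DifferentiableAt ℝ γ y) (hd' : DifferentiableAt ℝ ξ y)
    (A B : E) :
    ∃ L : F →L[ℝ] ℝ, HasFDerivAt (fun z ↦ γ z (ξ z A) (ξ z B)) L y ∧
      ∀ v, L v = fderiv ℝ γ y v (ξ y A) (ξ y B) + γ y (fderiv ℝ ξ y v A) (ξ y B)
        + γ y (ξ y A) (fderiv ℝ ξ y v B) := by
  refine ⟨_, (hd.hasFDerivAt.clm_apply (hd'.hasFDerivAt.clm_apply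
    (hasFDerivAt_const A y))).clm_apply (hd'.hasFDerivAt.clm_apply (hasFDerivAt_const B y)), ?_⟩
  intro v
  simp
  ring

/-- The Lie derivative of the metric along a Killing field is zero, so only the brackets of `X` with
the two arguments remain. When `ξ y₀ X = 0` this becomes the skewness of the isotropy. -/
lemma inner_deriv_eq {A B X : E} {L : F →L[ℝ] ℝ}
    (hL : HasFDerivAt (fun z ↦ γ z (ξ z A) (ξ z B)) L y₀) :
    L (ξ y₀ X) = - γ y₀ (ξ y₀ (br X A)) (ξ y₀ B) - γ y₀ (ξ y₀ A) (ξ y₀ (br X B)) := by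
  obtain ⟨L', hL', hv⟩ := h.hasFDerivAt_inner h.differentiableAt_metric h.differentiableAt_field A B
  rw [hL.unique hL', hv]
  have k := h.killing.self_of_nhds X (ξ y₀ A) (ξ y₀ B)
  have b1 := congrArg (fun w ↦ γ y₀ w (ξ y₀ B)) (h.bracket.self_of_nhds X A)
  have b2 := congrArg (fun w ↦ γ y₀ (ξ y₀ A) w) (h.bracket.self_of_nhds X B)
  simp only [map_sub, map_neg, _root_.sub_apply, _root_.neg_apply]
    at b1 b2
  linarith

/-- Koszul's formula, with the derivatives of the metric eliminated by the Killing equation. The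
signs reflect that the fields of `Y` and `Z` have bracket `-ξ (br Y Z)`. -/
lemma eventually_inner_nabla : ∀ᶠ y in 𝓝 y₀, ∀ Y Z W, γ y (nabla γ ξ Y Z y) (ξ y W)
    = -(1 / 2) * (γ y (ξ y (br Y Z)) (ξ y W) + γ y (ξ y (br Y W)) (ξ y Z)
      + γ y (ξ y (br Z W)) (ξ y Y)) := by
  filter_upwards [h.eventually_isInvertible, h.symm, h.killing, h.bracket] with y hi hs hk hb Y Z W
  rw [nabla, map_add, _root_.add_apply, christoffel_spec hi, christoffelLower_apply]
  have k1 := hk Y (ξ y Z) (ξ y W)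
  have k2 := hk Z (ξ y Y) (ξ y W)
  have k3 := hk W (ξ y Y) (ξ y Z)
  have b1 := congrArg (fun w ↦ γ y w (ξ y W)) (hb Y Z)
  have b2 := congrArg (fun w ↦ γ y w (ξ y Z)) (hb Y W)
  have b3 := congrArg (fun w ↦ γ y w (ξ y Y)) (hb Z W)
  simp only [map_sub, map_neg, _root_.sub_apply, _root_.neg_apply]
    at b1 b2 b3
  rw [hs (ξ y Z) (fderiv ℝ ξ y (ξ y W) Y)] at k1
  rw [hs (ξ y Y) (fderiv ℝ ξ y (ξ y W) Z)] at k2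
  rw [hs (ξ y Y) (fderiv ℝ ξ y (ξ y Z) W)] at k3
  linarith

/-- The derivative of `∇_Y Z`. -/
lemma hasFDerivAt_nabla (Y Z : E) : ∃ L : F →L[ℝ] F, HasFDerivAt (nabla γ ξ Y Z) L y₀ ∧
    ∀ v, L v = fderiv ℝ (fderiv ℝ ξ) y₀ v (ξ y₀ Y) Z
      + fderiv ℝ ξ y₀ (fderiv ℝ ξ y₀ v Y) Z
      + fderiv ℝ (christoffel γ) y₀ v (ξ y₀ Y) (ξ y₀ Z)
      + christoffel γ y₀ (fderiv ℝ ξ y₀ v Y) (ξ y₀ Z)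
      + christoffel γ y₀ (ξ y₀ Y) (fderiv ℝ ξ y₀ v Z) := by
  have hY := h.differentiableAt_field.hasFDerivAt.clm_apply (hasFDerivAt_const Y y₀)
  have hZ := h.differentiableAt_field.hasFDerivAt.clm_apply (hasFDerivAt_const Z y₀)
  refine ⟨_, ((h.differentiableAt_fderiv_field.hasFDerivAt.clm_apply hY).clm_apply
    (hasFDerivAt_const Z y₀)).add
    ((h.differentiableAt_christoffel.hasFDerivAt.clm_apply hY).clm_apply hZ), ?_⟩
  intro v
  simp
  abel

/-- The curvature tensor on Killing fields. -/
lemma curvatureEndo_eq {X Y Z : E} {L L' : F →L[ℝ] F}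
    (hL : HasFDerivAt (nabla γ ξ Y Z) L y₀) (hL' : HasFDerivAt (nabla γ ξ X Z) L' y₀) :
    curvatureEndo γ y₀ (ξ y₀ Y) (ξ y₀ Z) (ξ y₀ X)
      = (L (ξ y₀ X) + christoffel γ y₀ (ξ y₀ X) (nabla γ ξ Y Z y₀))
        - (L' (ξ y₀ Y) + christoffel γ y₀ (ξ y₀ Y) (nabla γ ξ X Z y₀))
        + nabla γ ξ (br X Y) Z y₀ := by
  obtain ⟨L₁, hL₁, hv⟩ := h.hasFDerivAt_nabla Y Z
  obtain ⟨L₂, hL₂, hv'⟩ := h.hasFDerivAt_nabla X Z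
  rw [hL.unique hL₁, hL'.unique hL₂, hv, hv', curvatureEndo_apply]
  have hsym : fderiv ℝ (fderiv ℝ ξ) y₀ (ξ y₀ X) (ξ y₀ Y) = fderiv ℝ (fderiv ℝ ξ) y₀ (ξ y₀ Y) (ξ y₀ X) :=
    (h.contDiffAt_field.isSymmSndFDerivAt (by simp)).eq _ _
  have hc := christoffel_symm h.differentiableAt_metric h.symm
  -- The bracket of the two fields is `-ξ (br X Y)`, hence the plus sign of the term `∇_{br X Y} Z`.
  have b : fderiv ℝ ξ y₀ (ξ y₀ X) Y = fderiv ℝ ξ y₀ (ξ y₀ Y) X - ξ y₀ (br X Y) := by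
    rw [sub_eq_add_neg, ← h.bracket.self_of_nhds X Y]; abel
  simp only [nabla, hsym, b, map_sub, map_add, _root_.sub_apply]
  abel

/-- Koszul's formula differentiated along `ξ X`: metric compatibility distributes the derivative
over the two factors on the left, and `inner_deriv_eq` evaluates the right-hand side by brackets
alone. -/
lemma inner_nabla_deriv {Y Z X W : E} {L : F →L[ℝ] F} (hL : HasFDerivAt (nabla γ ξ Y Z) L y₀) :
    γ y₀ (L (ξ y₀ X) + christoffel γ y₀ (ξ y₀ X) (nabla γ ξ Y Z y₀)) (ξ y₀ W)
      + γ y₀ (nabla γ ξ Y Z y₀) (nabla γ ξ X W y₀)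
    = (1 / 2) * ((γ y₀ (ξ y₀ (br X (br Y Z))) (ξ y₀ W) + γ y₀ (ξ y₀ (br Y Z)) (ξ y₀ (br X W)))
      + (γ y₀ (ξ y₀ (br X (br Y W))) (ξ y₀ Z) + γ y₀ (ξ y₀ (br Y W)) (ξ y₀ (br X Z)))
      + (γ y₀ (ξ y₀ (br X (br Z W))) (ξ y₀ Y) + γ y₀ (ξ y₀ (br Z W)) (ξ y₀ (br X Y)))) := by
  have hd := h.differentiableAt_metric
  have hd' := h.differentiableAt_field
  have h1 := (hd.hasFDerivAt.clm_apply hL).clm_apply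
    (hd'.hasFDerivAt.clm_apply (hasFDerivAt_const W y₀))
  obtain ⟨L₁, hL₁, -⟩ := h.hasFDerivAt_inner hd hd' (br Y Z) W
  obtain ⟨L₂, hL₂, -⟩ := h.hasFDerivAt_inner hd hd' (br Y W) Z
  obtain ⟨L₃, hL₃, -⟩ := h.hasFDerivAt_inner hd hd' (br Z W) Y
  have h2 := ((hL₁.add hL₂).add hL₃).const_mul (-(1 / 2))
  have h3 := h1.unique (h2.congr_of_eventuallyEq
    (h.eventually_inner_nabla.mono fun y hy ↦ hy Y Z W))
  have h4 := congrArg (fun l : F →L[ℝ] ℝ ↦ l (ξ y₀ X)) h3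
  simp only [_root_.add_apply, _root_.smul_apply,
    h.inner_deriv_eq hL₁, h.inner_deriv_eq hL₂, h.inner_deriv_eq hL₃] at h4
  simp at h4
  have hm := fderiv_metric_eq hd h.symm h.isInvertible (ξ y₀ X) (nabla γ ξ Y Z y₀) (ξ y₀ W)
  rw [hm] at h4
  simp only [nabla, map_add, _root_.add_apply] at h4 ⊢
  linarith

/-- The curvature of an invariant metric in terms of brackets of Killing fields. -/
lemma inner_curvatureEndo (X Y Z W : E) :
    γ y₀ (curvatureEndo γ y₀ (ξ y₀ Y) (ξ y₀ Z) (ξ y₀ X)) (ξ y₀ W)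
    = (1 / 2) * ((γ y₀ (ξ y₀ (br X (br Y Z))) (ξ y₀ W) + γ y₀ (ξ y₀ (br Y Z)) (ξ y₀ (br X W)))
      + (γ y₀ (ξ y₀ (br X (br Y W))) (ξ y₀ Z) + γ y₀ (ξ y₀ (br Y W)) (ξ y₀ (br X Z)))
      + (γ y₀ (ξ y₀ (br X (br Z W))) (ξ y₀ Y) + γ y₀ (ξ y₀ (br Z W)) (ξ y₀ (br X Y))))
      - γ y₀ (nabla γ ξ Y Z y₀) (nabla γ ξ X W y₀)
      - (1 / 2) * ((γ y₀ (ξ y₀ (br Y (br X Z))) (ξ y₀ W) + γ y₀ (ξ y₀ (br X Z)) (ξ y₀ (br Y W)))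
      + (γ y₀ (ξ y₀ (br Y (br X W))) (ξ y₀ Z) + γ y₀ (ξ y₀ (br X W)) (ξ y₀ (br Y Z)))
      + (γ y₀ (ξ y₀ (br Y (br Z W))) (ξ y₀ X) + γ y₀ (ξ y₀ (br Z W)) (ξ y₀ (br Y X))))
      + γ y₀ (nabla γ ξ X Z y₀) (nabla γ ξ Y W y₀)
      + γ y₀ (nabla γ ξ (br X Y) Z y₀) (ξ y₀ W) := by
  obtain ⟨L, hL, -⟩ := h.hasFDerivAt_nabla Y Z
  obtain ⟨L', hL', -⟩ := h.hasFDerivAt_nabla X Z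
  rw [h.curvatureEndo_eq hL hL']
  have h1 := h.inner_nabla_deriv (X := X) (W := W) hL
  have h2 := h.inner_nabla_deriv (X := Y) (W := W) hL'
  rw [map_add, map_sub, _root_.add_apply, _root_.sub_apply]
  linarith

end IsKillingFamily

end LocalKilling

/-! ### The trace of the curvature: pure algebra of brackets. -/

section RicciAlgebra

variable {E : Type*} [NormedAddCommGroup E] [NormedSpace ℝ E] {n : ℕ}

/-- The form `(U, V, K) ↦ ∑ U_ij V_kl K_pq c_ikp c_jlq` of degree two in `c`. -/
def trilin (c : Fin n → Fin n → Fin n → ℝ) (U V K : Matrix (Fin n) (Fin n) ℝ) : ℝ :=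
  ∑ i, ∑ j, ∑ k, ∑ l, ∑ p, ∑ q, U i j * V k l * K p q * (c i k p * c j l q)

/-- The part of the Ricci tensor of the metric `H` given by the moment map of `c`, paired with
`X`. -/
def momentForm (c : Fin n → Fin n → Fin n → ℝ) (H X : Matrix (Fin n) (Fin n) ℝ) : ℝ :=
  -(1 / 2) * trilin c X H⁻¹ H + (1 / 4) * trilin c H⁻¹ H⁻¹ (H * X * H)

/-- The Ricci tensor of the invariant metric with matrix `H`, where `β` plays the role of the
Killing form. -/
def ricMat (c : Fin n → Fin n → Fin n → ℝ) (β H : Matrix (Fin n) (Fin n) ℝ) :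
    Matrix (Fin n) (Fin n) ℝ :=
  Matrix.of fun a b ↦ momentForm c H (Matrix.single a b 1) - (1 / 2) * β a b

/-- Against a symmetric matrix only the symmetrization in `i, j` counts, so bracket identities need
to hold only after it. -/
lemma sum_symm_mul {H : Matrix (Fin n) (Fin n) ℝ} (hH : H.IsSymm) (φ ψ : Fin n → Fin n → ℝ)
    (h : ∀ i j, φ i j + φ j i = ψ i j + ψ j i) :
    ∑ i, ∑ j, H i j * φ i j = ∑ i, ∑ j, H i j * ψ i j := by
  have key : ∀ χ : Fin n → Fin n → ℝ,
      2 * ∑ i, ∑ j, H i j * χ i j = ∑ i, ∑ j, H i j * (χ i j + χ j i) := by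
    intro χ
    have : ∑ i, ∑ j, H i j * χ i j = ∑ i, ∑ j, H i j * χ j i := by
      rw [Finset.sum_comm]
      refine Finset.sum_congr rfl fun i _ ↦ Finset.sum_congr rfl fun j _ ↦ ?_
      rw [hH.apply i j]
    rw [two_mul]
    nth_rewrite 2 [this]
    simp only [mul_add, Finset.sum_add_distrib]
  have h1 := key φ
  have h2 := key ψ
  simp only [h] at h1
  linarith

lemma sum_sum_swap (f : Fin n → Fin n → Fin n → Fin n → ℝ) :
    ∑ i, ∑ j, ∑ k, ∑ l, f i j k l = ∑ i, ∑ j, ∑ k, ∑ l, f k l i j := by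
  have h : ∀ g : Fin n → Fin n → Fin n → Fin n → ℝ, ∑ i, ∑ j, ∑ k, ∑ l, g i j k l
      = ∑ p : Fin n × Fin n, ∑ q : Fin n × Fin n, g p.1 p.2 q.1 q.2 := fun g ↦ by
    simp only [Fintype.sum_prod_type]
  rw [h, h, Finset.sum_comm]

/-- The analogue for the exchange of the pairs `(i, j)` and `(k, l)`. -/
lemma sum_symm_mul_mul {H : Matrix (Fin n) (Fin n) ℝ}
    (φ ψ : Fin n → Fin n → Fin n → Fin n → ℝ)
    (h : ∀ i j k l, φ i j k l + φ k l i j = ψ i j k l + ψ k l i j) :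
    ∑ i, ∑ j, ∑ k, ∑ l, H i j * H k l * φ i j k l
      = ∑ i, ∑ j, ∑ k, ∑ l, H i j * H k l * ψ i j k l := by
  have key : ∀ χ : Fin n → Fin n → Fin n → Fin n → ℝ,
      2 * ∑ i, ∑ j, ∑ k, ∑ l, H i j * H k l * χ i j k l
        = ∑ i, ∑ j, ∑ k, ∑ l, H i j * H k l * (χ i j k l + χ k l i j) := by
    intro χ
    have : ∑ i, ∑ j, ∑ k, ∑ l, H i j * H k l * χ i j k l
        = ∑ i, ∑ j, ∑ k, ∑ l, H i j * H k l * χ k l i j := by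
      rw [sum_sum_swap]
      refine Finset.sum_congr rfl fun i _ ↦ Finset.sum_congr rfl fun j _ ↦
        Finset.sum_congr rfl fun k _ ↦ Finset.sum_congr rfl fun l _ ↦ ?_
      ring
    rw [two_mul]
    nth_rewrite 2 [this]
    simp only [mul_add, Finset.sum_add_distrib]
  have h1 := key φ
  have h2 := key ψ
  simp only [h] at h1
  linarith

/-- Turns a metric contraction into the trace of an endomorphism: `q = r H` gives `tr (H⁻¹ q) = tr
r`. -/
lemma sum_contraction {H Hi : Matrix (Fin n) (Fin n) ℝ} (hHi : Hi.IsSymm) (hH' : H * Hi = 1)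
    (r q : Fin n → Fin n → ℝ) (hr : ∀ i j, q i j = ∑ k, r i k * H k j) :
    ∑ i, ∑ j, Hi i j * q i j = ∑ i, r i i := by
  refine Finset.sum_congr rfl fun i _ ↦ ?_
  have : ∀ k, ∑ j, Hi i j * H k j = if k = i then 1 else 0 := by
    intro k
    have := congrFun (congrFun hH' k) i
    rw [Matrix.mul_apply, Matrix.one_apply] at this
    rw [← this]
    exact Finset.sum_congr rfl fun j _ ↦ by rw [hHi.apply j i, mul_comm]
  calc ∑ j, Hi i j * q i j = ∑ j, ∑ k, r i k * (Hi i j * H k j) := by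
        refine Finset.sum_congr rfl fun j _ ↦ ?_
        rw [hr, Finset.mul_sum]
        exact Finset.sum_congr rfl fun k _ ↦ by ring
    _ = ∑ k, r i k * ∑ j, Hi i j * H k j := by
        rw [Finset.sum_comm]
        simp only [Finset.mul_sum]
    _ = r i i := by simp [this]

/-- The trace defining the Ricci tensor of a homogeneous space, in terms of a `Q`-skew part `K`. -/
lemma ricci_contraction (Q : E →L[ℝ] E →L[ℝ] ℝ) (br : E →L[ℝ] E →L[ℝ] E)
    (hQ : ∀ A B, Q A B = Q B A) (hbr : ∀ A B, br A B = - br B A) (x : Fin n → E)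
    (r : E →ₗ[ℝ] Fin n → ℝ) {H Hi : Matrix (Fin n) (Fin n) ℝ} (hHi : Hi.IsSymm)
    (hH' : H * Hi = 1) (hr : ∀ A j, Q A (x j) = ∑ k, r A k * H k j)
    (hskew : ∀ K, r K = 0 → ∀ A B, Q (br K A) B = - Q A (br K B))
    (hrx : ∀ A, r (A - ∑ i, r A i • x i) = 0)
    (huni : ∀ A, ∑ i, r (br A (x i)) i = 0) (a b : Fin n) (N : E → E → E → ℝ)
    (hN : ∀ Y Z W, N Y Z W = -(1 / 2) * (Q (br Y Z) W + Q (br Y W) Z + Q (br Z W) Y)) :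
    ∑ i, ∑ j, Hi i j * ((1 / 2) * ((Q (br (x i) (br (x a) (x b))) (x j)
            + Q (br (x a) (x b)) (br (x i) (x j)))
          + (Q (br (x i) (br (x a) (x j))) (x b) + Q (br (x a) (x j)) (br (x i) (x b)))
          + (Q (br (x i) (br (x b) (x j))) (x a) + Q (br (x b) (x j)) (br (x i) (x a))))
        - (∑ k, ∑ l, Hi k l * (N (x a) (x b) (x k) * N (x i) (x j) (x l)))
        - (1 / 2) * ((Q (br (x a) (br (x i) (x b))) (x j)
            + Q (br (x i) (x b)) (br (x a) (x j)))
          + (Q (br (x a) (br (x i) (x j))) (x b) + Q (br (x i) (x j)) (br (x a) (x b)))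
          + (Q (br (x a) (br (x b) (x j))) (x i) + Q (br (x b) (x j)) (br (x a) (x i))))
        + (∑ k, ∑ l, Hi k l * (N (x i) (x b) (x k) * N (x a) (x j) (x l)))
        + N (br (x i) (x a)) (x b) (x j))
      = ∑ i, ∑ j, Hi i j * (-(1 / 2) * Q (br (x a) (x i)) (br (x b) (x j)))
        + (1 / 4) * ∑ i, ∑ j, ∑ k, ∑ l, Hi i j * Hi k l *
          (Q (br (x i) (x k)) (x a) * Q (br (x j) (x l)) (x b))
        - (1 / 2) * ∑ i, (r (br (x b) (br (x a) (x i))) i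
          + r (br (x a) (br (x b) (x i) - ∑ l, r (br (x b) (x i)) l • x l)) i) := by
  have htr : ∀ A : Fin n → E, ∑ i, ∑ j, Hi i j * Q (A i) (x j) = ∑ i, r (A i) i := fun A ↦
    sum_contraction hHi hH' (fun i ↦ r (A i)) _ fun i j ↦ hr (A i) j
  have hrl : ∀ A l, ∑ k, Hi k l * Q A (x k) = r A l := by
    intro A l
    have : ∀ m, ∑ k, Hi k l * H m k = if m = l then 1 else 0 := by
      intro m
      have := congrFun (congrFun hH' m) l
      rw [Matrix.mul_apply, Matrix.one_apply] at this
      rw [← this]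
      exact Finset.sum_congr rfl fun j _ ↦ by rw [mul_comm]
    calc ∑ k, Hi k l * Q A (x k) = ∑ k, ∑ m, r A m * (Hi k l * H m k) := by
          refine Finset.sum_congr rfl fun j _ ↦ ?_
          rw [hr, Finset.mul_sum]
          exact Finset.sum_congr rfl fun k _ ↦ by ring
      _ = ∑ m, r A m * ∑ k, Hi k l * H m k := by
          rw [Finset.sum_comm]
          simp only [Finset.mul_sum]
      _ = r A l := by simp [this]
  -- the mean curvature terms vanish
  have hmean : ∀ A, ∑ i, ∑ j, Hi i j * N (x i) (x j) A = 0 := by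
    intro A
    rw [← huni A, ← htr fun i ↦ br A (x i)]
    refine sum_symm_mul hHi _ _ fun i j ↦ ?_
    rw [hN, hN, hbr (x j) (x i), hbr (x i) A, hbr (x j) A]
    simp only [map_neg, neg_apply]
    ring
  have hT2 : ∑ i, ∑ j, Hi i j * ∑ k, ∑ l, Hi k l * (N (x a) (x b) (x k) * N (x i) (x j) (x l))
      = 0 := by
    calc _ = ∑ k, ∑ l, Hi k l * N (x a) (x b) (x k) * ∑ i, ∑ j, Hi i j * N (x i) (x j) (x l) := by
          simp only [Finset.mul_sum]
          rw [sum_sum_swap]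
          refine Finset.sum_congr rfl fun i _ ↦ Finset.sum_congr rfl fun j _ ↦
            Finset.sum_congr rfl fun k _ ↦ Finset.sum_congr rfl fun l _ ↦ ?_
          ring
      _ = 0 := by simp [hmean]
  -- Contraction over `k, l` sees a bracket only through its components `r`. This is why the
  -- projection `∑ l, r (br (x b) (x i)) l • x l` occurs here instead of `br (x b) (x i)`.
  have hT4 : ∑ i, ∑ j, Hi i j * ∑ k, ∑ l, Hi k l * (N (x i) (x b) (x k) * N (x a) (x j) (x l))
      = (1 / 4) * (∑ i, ∑ j, ∑ k, ∑ l, Hi i j * Hi k l *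
          (Q (br (x i) (x k)) (x a) * Q (br (x j) (x l)) (x b)))
        - (1 / 2) * ∑ i, ∑ j, Hi i j * Q (br (x j) (∑ l, r (br (x b) (x i)) l • x l)) (x a) := by
    have e1 : ∑ i, ∑ j, Hi i j * Q (br (x j) (∑ l, r (br (x b) (x i)) l • x l)) (x a)
        = ∑ i, ∑ j, ∑ k, ∑ l, Hi i j * Hi k l *
          (Q (br (x b) (x i)) (x k) * Q (br (x j) (x l)) (x a)) := by
      refine Finset.sum_congr rfl fun i _ ↦ Finset.sum_congr rfl fun j _ ↦ ?_
      rw [Finset.sum_comm]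
      simp only [map_sum, map_smul, _root_.sum_apply, smul_apply,
        smul_eq_mul, Finset.mul_sum]
      refine Finset.sum_congr rfl fun l _ ↦ ?_
      rw [← hrl, Finset.sum_mul, Finset.mul_sum]
      exact Finset.sum_congr rfl fun k _ ↦ by ring
    have e2 : ∑ i, ∑ j, ∑ k, ∑ l, Hi i j * Hi k l *
          (Q (br (x i) (x k)) (x a) * Q (br (x j) (x l)) (x b))
        = ∑ i, ∑ j, ∑ k, ∑ l, Hi i j * Hi k l *
          (Q (br (x i) (x k)) (x b) * Q (br (x j) (x l)) (x a)) := by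
      rw [Finset.sum_comm]
      refine Finset.sum_congr rfl fun i _ ↦ Finset.sum_congr rfl fun j _ ↦ ?_
      rw [Finset.sum_comm]
      refine Finset.sum_congr rfl fun k _ ↦ Finset.sum_congr rfl fun l _ ↦ ?_
      rw [hHi.apply i j, hHi.apply k l]; ring
    rw [e1, e2, Finset.mul_sum, Finset.mul_sum, ← Finset.sum_sub_distrib]
    simp only [Finset.mul_sum, ← Finset.sum_sub_distrib]
    have := sum_symm_mul_mul (H := Hi)
      (fun i j k l ↦ N (x i) (x b) (x k) * N (x a) (x j) (x l))
      (fun i j k l ↦ (1 / 4) * (Q (br (x i) (x k)) (x b) * Q (br (x j) (x l)) (x a))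
        - (1 / 2) * (Q (br (x b) (x i)) (x k) * Q (br (x j) (x l)) (x a))) (by
      intro i j k l
      simp only [hN]
      rw [hbr (x i) (x b), hbr (x k) (x b), hbr (x k) (x i), hbr (x l) (x j)]
      simp only [map_neg, neg_apply]
      ring)
    calc _ = _ := by
          refine Finset.sum_congr rfl fun i _ ↦ Finset.sum_congr rfl fun j _ ↦
            Finset.sum_congr rfl fun k _ ↦ Finset.sum_congr rfl fun l _ ↦ ?_
          exact (mul_assoc _ _ _).symm
      _ = _ := this
      _ = _ := by
          refine Finset.sum_congr rfl fun i _ ↦ Finset.sum_congr rfl fun j _ ↦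
            Finset.sum_congr rfl fun k _ ↦ Finset.sum_congr rfl fun l _ ↦ ?_
          ring
  have hT : ∑ i, ∑ j, Hi i j * ((1 / 2) * ((Q (br (x i) (br (x a) (x b))) (x j)
            + Q (br (x a) (x b)) (br (x i) (x j)))
          + (Q (br (x i) (br (x a) (x j))) (x b) + Q (br (x a) (x j)) (br (x i) (x b)))
          + (Q (br (x i) (br (x b) (x j))) (x a) + Q (br (x b) (x j)) (br (x i) (x a))))
        - (1 / 2) * ((Q (br (x a) (br (x i) (x b))) (x j)
            + Q (br (x i) (x b)) (br (x a) (x j)))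
          + (Q (br (x a) (br (x i) (x j))) (x b) + Q (br (x i) (x j)) (br (x a) (x b)))
          + (Q (br (x a) (br (x b) (x j))) (x i) + Q (br (x b) (x j)) (br (x a) (x i))))
        + N (br (x i) (x a)) (x b) (x j))
      = ∑ i, ∑ j, Hi i j * (-(1 / 2) * Q (br (br (x a) (x b)) (x i)) (x j)
        - (1 / 2) * Q (br (x a) (x i)) (br (x b) (x j))
        + (1 / 2) * Q (br (x j) (br (x b) (x i))) (x a)
        - (1 / 2) * Q (br (x b) (br (x a) (x i))) (x j)) := by
    refine sum_symm_mul hHi _ _ fun i j ↦ ?_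
    simp only [hN]
    rw [hbr (x i) (br (x a) (x b)), hbr (x j) (br (x a) (x b)), hbr (br (x i) (x a)) (x b),
      hbr (br (x j) (x a)) (x b), hbr (br (x i) (x a)) (x j), hbr (br (x j) (x a)) (x i),
      hbr (x i) (x a), hbr (x j) (x a), hbr (x i) (x b), hbr (x j) (x b), hbr (x j) (x i)]
    simp only [map_neg, neg_apply, neg_neg]
    rw [hQ (br (x a) (x j)) (br (x b) (x i)), hQ (br (x a) (x i)) (br (x b) (x j))]
    ring
  -- The bracket minus its projection lies in the kernel of `r`, so its adjoint action is `Q`-skew.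
  -- The resulting trace is the isotropy half of the Killing form.
  have hK : ∀ i j, Q (br (x j) (br (x b) (x i) - ∑ l, r (br (x b) (x i)) l • x l)) (x a)
      = - Q (br (x a) (br (x b) (x i) - ∑ l, r (br (x b) (x i)) l • x l)) (x j) := by
    intro i j
    set K := br (x b) (x i) - ∑ l, r (br (x b) (x i)) l • x l with hKdef
    rw [hbr (x j), hbr (x a)]
    simp only [map_neg, neg_apply, neg_neg]
    rw [hskew K (hrx _), neg_neg, hQ]
  have hsplit : ∀ φ ψ χ τ : Fin n → Fin n → ℝ, ∀ T : Fin n → Fin n → ℝ,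
      ∑ i, ∑ j, Hi i j * (φ i j - χ i j - ψ i j + τ i j + T i j)
      = ∑ i, ∑ j, Hi i j * (φ i j - ψ i j + T i j) - ∑ i, ∑ j, Hi i j * χ i j
        + ∑ i, ∑ j, Hi i j * τ i j := by
    intro φ ψ χ τ T
    simp only [← Finset.sum_sub_distrib, ← Finset.sum_add_distrib]
    exact Finset.sum_congr rfl fun i _ ↦ Finset.sum_congr rfl fun j _ ↦ by ring
  rw [hsplit, hT, hT2, hT4]
  simp only [mul_add, mul_sub, Finset.sum_add_distrib, Finset.sum_sub_distrib]
  have c1 : ∑ i, ∑ j, Hi i j * (-(1 / 2) * Q (br (br (x a) (x b)) (x i)) (x j)) = 0 := by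
    have := htr fun i ↦ br (br (x a) (x b)) (x i)
    rw [huni] at this
    rw [← mul_zero (-(1 / 2) : ℝ), ← this]
    simp only [Finset.mul_sum]
    exact Finset.sum_congr rfl fun i _ ↦ Finset.sum_congr rfl fun j _ ↦ by ring
  have c2 : ∑ i, ∑ j, Hi i j * ((1 / 2) * Q (br (x b) (br (x a) (x i))) (x j))
      = (1 / 2) * ∑ i, r (br (x b) (br (x a) (x i))) i := by
    rw [← htr fun i ↦ br (x b) (br (x a) (x i))]
    simp only [Finset.mul_sum]
    exact Finset.sum_congr rfl fun i _ ↦ Finset.sum_congr rfl fun j _ ↦ by ring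
  have c3 : ∑ i, ∑ j, Hi i j * ((1 / 2) * Q (br (x j) (br (x b) (x i))) (x a))
      - (1 / 2) * ∑ i, ∑ j, Hi i j * Q (br (x j) (∑ l, r (br (x b) (x i)) l • x l)) (x a)
      = -(1 / 2) * ∑ i, r (br (x a) (br (x b) (x i) - ∑ l, r (br (x b) (x i)) l • x l)) i := by
    rw [← htr fun i ↦ br (x a) (br (x b) (x i) - ∑ l, r (br (x b) (x i)) l • x l)]
    simp only [Finset.mul_sum, ← Finset.sum_sub_distrib]
    refine Finset.sum_congr rfl fun i _ ↦ Finset.sum_congr rfl fun j _ ↦ ?_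
    have := hK i j
    rw [map_sub (br (x j)), map_sub Q, sub_apply] at this
    linear_combination (1 / 2) * Hi i j * this
  have c4 : ∑ i, ∑ j, Hi i j * (-(1 / 2) * Q (br (x a) (x i)) (br (x b) (x j)))
      = - ∑ i, ∑ j, Hi i j * ((1 / 2) * Q (br (x a) (x i)) (br (x b) (x j))) := by
    simp only [← Finset.sum_neg_distrib]
    exact Finset.sum_congr rfl fun i _ ↦ Finset.sum_congr rfl fun j _ ↦ by ring
  rw [c1, c2, c4]
  linear_combination c3

end RicciAlgebra

/-! ### The Ricci tensor in terms of structure constants. -/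

section RicciCoord

variable {E : Type*} [NormedAddCommGroup E] [NormedSpace ℝ E]
  {F : Type*} [NormedAddCommGroup F] [NormedSpace ℝ F] {n : ℕ}

/-- The structure constants of the bracket projected to `F` by `ξ₀`, for elements `x i`
over a basis `ε`. -/
def structConst (ξ₀ : E →L[ℝ] F) (br : E →L[ℝ] E →L[ℝ] E) (x : Fin n → E)
    (ε : Module.Basis (Fin n) ℝ F) : Fin n → Fin n → Fin n → ℝ :=
  fun i j k ↦ ε.repr (ξ₀ (br (x i) (x j))) k

/-- The component of `A` in the kernel of `ξ₀`, for the complement spanned by the `x i`. -/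
def kerPart (ξ₀ : E →L[ℝ] F) (x : Fin n → E) (ε : Module.Basis (Fin n) ℝ F) (A : E) : E :=
  A - ∑ l, ε.repr (ξ₀ A) l • x l

/-- The matrix of the restriction to the span of the `x i` of the Killing form. -/
def killingMat (ξ₀ : E →L[ℝ] F) (br : E →L[ℝ] E →L[ℝ] E) (x : Fin n → E)
    (ε : Module.Basis (Fin n) ℝ F) : Matrix (Fin n) (Fin n) ℝ :=
  Matrix.of fun a b ↦ ∑ i, (ε.repr (ξ₀ (br (x b) (br (x a) (x i)))) i
    + ε.repr (ξ₀ (br (x a) (kerPart ξ₀ x ε (br (x b) (x i))))) i)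

/-- The Gram matrix of a bilinear form. -/
def gramMat (B : F →L[ℝ] F →L[ℝ] ℝ) (ε : Fin n → F) : Matrix (Fin n) (Fin n) ℝ :=
  Matrix.of fun i j ↦ B (ε i) (ε j)

lemma bilin_apply_basis (B : F →L[ℝ] F →L[ℝ] ℝ) (ε : Module.Basis (Fin n) ℝ F) (u v : F) :
    B u v = ∑ p, ∑ q, ε.repr u p * ε.repr v q * gramMat B ε p q := by
  conv_lhs => rw [← ε.sum_repr u, ← ε.sum_repr v]
  simp only [map_sum, map_smul, _root_.sum_apply, smul_apply, smul_eq_mul, Finset.mul_sum, gramMat,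
    Matrix.of_apply]
  rw [Finset.sum_comm]
  exact Finset.sum_congr rfl fun _ _ ↦ Finset.sum_congr rfl fun _ _ ↦ by ring

lemma bilin_apply_basis_right (B : F →L[ℝ] F →L[ℝ] ℝ) (ε : Module.Basis (Fin n) ℝ F) (u : F)
    (j : Fin n) : B u (ε j) = ∑ k, ε.repr u k * gramMat B ε k j := by
  conv_lhs => rw [← ε.sum_repr u]
  simp only [map_sum, map_smul, _root_.sum_apply, smul_apply, smul_eq_mul, gramMat, Matrix.of_apply]

lemma isUnit_det_gramMat {B : F →L[ℝ] F →L[ℝ] ℝ} (hB : B.IsInvertible)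
    (ε : Module.Basis (Fin n) ℝ F) : IsUnit (gramMat B ε).det := by
  rw [← Matrix.isUnit_iff_isUnit_det, ← Matrix.vecMul_injective_iff_isUnit,
    ← Matrix.coe_vecMulLinear, injective_iff_map_eq_zero]
  intro v hv
  have h1 : B (∑ i, v i • ε i) = 0 := by
    apply ContinuousLinearMap.coe_injective
    refine ε.ext fun j ↦ ?_
    have := congrFun hv j
    simpa [Matrix.vecMul, dotProduct, gramMat] using! this
  have h2 : ∑ i, v i • ε i = 0 := by
    obtain ⟨e, rfl⟩ := hB
    exact e.map_eq_zero_iff.mp h1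
  funext i
  have := congrArg (fun w ↦ ε.repr w i) h2
  simpa [map_sum, Finsupp.single_apply] using this

lemma trilin_single (c : Fin n → Fin n → Fin n → ℝ) (a b : Fin n)
    (V K : Matrix (Fin n) (Fin n) ℝ) :
    trilin c (Matrix.single a b 1) V K
      = ∑ k, ∑ l, ∑ p, ∑ q, V k l * K p q * (c a k p * c b l q) := by
  rw [trilin, Finset.sum_eq_single a, Finset.sum_eq_single b]
  · simp
  · intro j _ hj
    simp [hj.symm]
  · simp
  · intro i _ hi
    simp [hi.symm]
  · simp

lemma mul_single_mul_apply (H : Matrix (Fin n) (Fin n) ℝ) (a b p q : Fin n) :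
    (H * (Matrix.single a b 1 : Matrix (Fin n) (Fin n) ℝ) * H) p q = H p a * H b q := by
  rw [Matrix.mul_apply, Finset.sum_eq_single b]
  · simp
  · intro j _ hj
    simp [Matrix.mul_apply, hj.symm]
  · simp

/-- The Ricci tensor of an invariant metric in terms of structure constants. -/
theorem IsKillingFamily.ricciCoord_eq [FiniteDimensional ℝ F]
    {γ : F → F →L[ℝ] F →L[ℝ] ℝ} {ξ : F → E →L[ℝ] F}
    {br : E →L[ℝ] E →L[ℝ] E} {y₀ : F} (h : IsKillingFamily γ ξ br y₀)
    (hbr : ∀ A B, br A B = - br B A) (x : Fin n → E) (ε : Module.Basis (Fin n) ℝ F)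
    (hε : ∀ i, ξ y₀ (x i) = ε i) (huni : ∀ j, ∑ i, structConst (ξ y₀) br x ε j i i = 0)
    (a b : Fin n) :
    ricciCoord γ y₀ (ε a) (ε b)
      = ricMat (structConst (ξ y₀) br x ε) (killingMat (ξ y₀) br x ε) (gramMat (γ y₀) ε) a b := by
  set H := gramMat (γ y₀) ε with hHdef
  have hsymm := h.symm.self_of_nhds
  have hHs : H.IsSymm := by
    ext i j
    exact hsymm _ _
  have hdet : IsUnit H.det := isUnit_det_gramMat h.isInvertible ε
  have hH' : H * H⁻¹ = 1 := Matrix.mul_nonsing_inv H hdet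
  have hHi : (H⁻¹).IsSymm := by
    rw [Matrix.IsSymm, Matrix.transpose_nonsing_inv, hHs.eq]
  let Q : E →L[ℝ] E →L[ℝ] ℝ := (γ y₀).bilinearComp (ξ y₀) (ξ y₀)
  have hQ : ∀ A B, Q A B = γ y₀ (ξ y₀ A) (ξ y₀ B) := fun A B ↦ rfl
  let r : E →ₗ[ℝ] Fin n → ℝ := ε.equivFun.toLinearMap ∘ₗ (ξ y₀ : E →ₗ[ℝ] F)
  have hr : ∀ A i, r A i = ε.repr (ξ y₀ A) i := fun A i ↦ rfl
  have hrQ : ∀ A j, Q A (x j) = ∑ k, r A k * H k j := by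
    intro A j
    rw [hQ, hε, bilin_apply_basis_right]
    rfl
  have hr0 : ∀ K, r K = 0 → ξ y₀ K = 0 := by
    intro K hK
    exact ε.equivFun.map_eq_zero_iff.mp hK
  have hrx : ∀ A, r (A - ∑ i, r A i • x i) = 0 := by
    intro A
    funext i
    rw [hr, map_sub, map_sum]
    simp only [map_smul, hε, hr, ε.sum_repr, sub_self, map_zero, Finsupp.coe_zero, Pi.zero_apply]
  -- The field of `K` vanishes at `y₀`, so the derivative along it in `inner_deriv_eq` is zero.
  have hskew : ∀ K, r K = 0 → ∀ A B, Q (br K A) B = - Q A (br K B) := by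
    intro K hK A B
    obtain ⟨L, hL, -⟩ := h.hasFDerivAt_inner h.differentiableAt_metric h.differentiableAt_field A B
    have := h.inner_deriv_eq (X := K) hL
    rw [hr0 K hK, map_zero] at this
    rw [hQ, hQ]
    linarith
  -- Split `A` into a part in the kernel of `ξ y₀`, which acts skewly and hence without trace, and a
  -- combination of the `x j`, for which the trace vanishes by `huni`.
  have huniAll : ∀ A, ∑ i, r (br A (x i)) i = 0 := by
    intro A
    have hA : A = (A - ∑ i, r A i • x i) + ∑ i, r A i • x i := by abel
    set K := A - ∑ i, r A i • x i with hKdef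
    have h1 : ∑ i, r (br K (x i)) i = 0 := by
      rw [← sum_contraction hHi hH' (fun i ↦ r (br K (x i))) _ fun i j ↦ hrQ (br K (x i)) j]
      rw [sum_symm_mul hHi _ (fun _ _ ↦ 0)]
      · simp
      · intro i j
        rw [hskew K (hrx A), hQ, hQ, hsymm]
        simp
    have h2 : ∀ i, r (br A (x i)) i
        = r (br K (x i)) i + ∑ j, r A j * structConst (ξ y₀) br x ε j i i := by
      intro i
      conv_lhs => rw [hA]
      simp only [map_add, map_sum, map_smul, _root_.add_apply, _root_.sum_apply, smul_apply,
        Pi.add_apply, Finset.sum_apply, Pi.smul_apply, smul_eq_mul]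
      rfl
    simp only [h2, Finset.sum_add_distrib, h1]
    rw [Finset.sum_comm]
    simp [← Finset.mul_sum, huni]
  have hcontr : ∀ u v, γ y₀ u v
      = ∑ k, ∑ l, H⁻¹ k l * (γ y₀ u (ε k) * γ y₀ v (ε l)) := by
    intro u v
    rw [sum_contraction hHi hH' (fun k l ↦ γ y₀ u (ε k) * ε.repr v l)]
    · conv_lhs => rw [← ε.sum_repr v]
      simp only [map_sum, map_smul, smul_eq_mul]
      exact Finset.sum_congr rfl fun _ _ ↦ mul_comm _ _
    · intro i j
      rw [bilin_apply_basis_right _ _ v, Finset.mul_sum]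
      exact Finset.sum_congr rfl fun _ _ ↦ by rw [mul_assoc]
  let N : E → E → E → ℝ := fun Y Z W ↦ γ y₀ (nabla γ ξ Y Z y₀) (ξ y₀ W)
  have hN : ∀ Y Z W, N Y Z W
      = -(1 / 2) * (Q (br Y Z) W + Q (br Y W) Z + Q (br Z W) Y) :=
    h.eventually_inner_nabla.self_of_nhds
  have hNN : ∀ Y Z Y' Z', γ y₀ (nabla γ ξ Y Z y₀) (nabla γ ξ Y' Z' y₀)
      = ∑ k, ∑ l, H⁻¹ k l * (N Y Z (x k) * N Y' Z' (x l)) := by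
    intro Y Z Y' Z'
    rw [hcontr]
    simp only [N, hε]
  have htrace : ricciCoord γ y₀ (ε a) (ε b) = ∑ i, ∑ j, H⁻¹ i j *
      γ y₀ (curvatureEndo γ y₀ (ξ y₀ (x a)) (ξ y₀ (x b)) (ξ y₀ (x i))) (ξ y₀ (x j)) := by
    rw [ricciCoord, LinearMap.trace_eq_matrix_trace ℝ ε, Matrix.trace]
    simp only [hε]
    rw [sum_contraction hHi hH'
      (fun i ↦ ε.repr (curvatureEndo γ y₀ (ε a) (ε b) (ε i))) _
      fun i j ↦ bilin_apply_basis_right _ _ _ _]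
    exact Finset.sum_congr rfl fun i _ ↦ by
      rw [Matrix.diag_apply, LinearMap.toMatrix_apply]; rfl
  rw [htrace]
  simp only [h.inner_curvatureEndo, hNN, ← hQ]
  -- The last sum obtained is `killingMat`. Its first half is the trace of `ad x_b ad x_a` on the
  -- span of the `x i`; in the reductive case its second half is the trace on `𝔨`, carried to `𝔭` by
  -- cyclicity.
  have main := ricci_contraction Q br (fun A B ↦ hsymm _ _) hbr x r hHi hH' hrQ hskew hrx huniAll
    a b N hN
  refine main.trans ?_
  rw [ricMat, Matrix.of_apply, momentForm]
  have hQc : ∀ i j k l, Q (br (x i) (x j)) (br (x k) (x l)) = ∑ p, ∑ q,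
      structConst (ξ y₀) br x ε i j p * structConst (ξ y₀) br x ε k l q * H p q :=
    fun i j k l ↦ bilin_apply_basis _ ε _ _
  have hQx : ∀ i j k, Q (br (x i) (x j)) (x k) = ∑ p, structConst (ξ y₀) br x ε i j p * H p k :=
    fun i j k ↦ hrQ _ _
  congr 1
  congr 1
  · rw [trilin_single]
    simp only [Finset.mul_sum, hQc]
    refine Finset.sum_congr rfl fun i _ ↦ Finset.sum_congr rfl fun j _ ↦
      Finset.sum_congr rfl fun k _ ↦ Finset.sum_congr rfl fun l _ ↦ ?_
    ring
  · congr 1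
    rw [trilin]
    refine Finset.sum_congr rfl fun i _ ↦ Finset.sum_congr rfl fun j _ ↦
      Finset.sum_congr rfl fun k _ ↦ Finset.sum_congr rfl fun l _ ↦ ?_
    rw [hQx, hQx, Finset.sum_mul_sum, Finset.mul_sum]
    refine Finset.sum_congr rfl fun p _ ↦ ?_
    rw [Finset.mul_sum]
    refine Finset.sum_congr rfl fun q _ ↦ ?_
    rw [mul_single_mul_apply, hHs.apply q b]
    ring

end RicciCoord

/-! ### Derivatives of curves of matrices. -/

section MatrixCalculus

variable {n : ℕ}

/-- Entrywise differentiability of a curve of matrices. -/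
def MatHasDerivAt (U : ℝ → Matrix (Fin n) (Fin n) ℝ) (U' : Matrix (Fin n) (Fin n) ℝ) (t : ℝ) :
    Prop :=
  ∀ i j, HasDerivAt (fun s ↦ U s i j) (U' i j) t

namespace MatHasDerivAt

variable {U V K : ℝ → Matrix (Fin n) (Fin n) ℝ} {U' V' K' : Matrix (Fin n) (Fin n) ℝ} {t : ℝ}

lemma const (A : Matrix (Fin n) (Fin n) ℝ) (t : ℝ) : MatHasDerivAt (fun _ ↦ A) 0 t :=
  fun _ _ ↦ hasDerivAt_const _ _

lemma line (A B : Matrix (Fin n) (Fin n) ℝ) (t : ℝ) : MatHasDerivAt (fun s ↦ A + s • B) B t := by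
  intro i j
  simpa using ((hasDerivAt_id t).mul_const (B i j)).const_add (A i j)

lemma mul (hU : MatHasDerivAt U U' t) (hV : MatHasDerivAt V V' t) :
    MatHasDerivAt (fun s ↦ U s * V s) (U' * V t + U t * V') t := by
  intro i j
  simp only [Matrix.mul_apply, Matrix.add_apply, ← Finset.sum_add_distrib]
  exact HasDerivAt.fun_sum fun k _ ↦ (hU i k).mul (hV k j)

lemma trace (hU : MatHasDerivAt U U' t) : HasDerivAt (fun s ↦ (U s).trace) U'.trace t :=
  HasDerivAt.fun_sum fun i _ ↦ hU i i

lemma differentiableAt_det (hU : MatHasDerivAt U U' t) :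
    DifferentiableAt ℝ (fun s ↦ (U s).det) t := by
  simp only [Matrix.det_apply]
  refine DifferentiableAt.fun_sum fun σ _ ↦ DifferentiableAt.const_smul ?_ _
  exact DifferentiableAt.fun_finsetProd fun i _ ↦ (hU _ _).differentiableAt

/-- Cramer's rule shows that the entries of the inverse are differentiable; their derivative is then
forced by `U⁻¹ U = 1`. -/
lemma inv (hU : MatHasDerivAt U U' t) (h : (U t).det ≠ 0) :
    MatHasDerivAt (fun s ↦ (U s)⁻¹) (-((U t)⁻¹ * U' * (U t)⁻¹)) t := by
  have hd : ∀ i j, DifferentiableAt ℝ (fun s ↦ (U s)⁻¹ i j) t := by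
    intro i j
    have h1 : ∀ s, (U s)⁻¹ i j = ((U s).det)⁻¹ * ((U s).updateRow j (Pi.single i 1)).det := by
      intro s
      rw [Matrix.inv_def, Matrix.smul_apply, Matrix.adjugate_apply, Ring.inverse_eq_inv', smul_eq_mul]
    simp only [h1]
    refine (hU.differentiableAt_det.inv h).mul ?_
    have h2 : MatHasDerivAt (fun s ↦ (U s).updateRow j (Pi.single i 1)) (U'.updateRow j 0) t := by
      intro k l
      by_cases hk : k = j
      · subst hk
        simpa using hasDerivAt_const t _
      · simpa [Matrix.updateRow_apply, hk] using hU k l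
    exact h2.differentiableAt_det
  let W : Fin n → Fin n → ℝ := fun i j ↦ deriv (fun s ↦ (U s)⁻¹ i j) t
  have hW' : MatHasDerivAt (fun s ↦ (U s)⁻¹) (Matrix.of W) t := fun i j ↦ (hd i j).hasDerivAt
  have hev : ∀ᶠ s in nhds t, (U s)⁻¹ * U s = 1 := by
    filter_upwards [hU.differentiableAt_det.continuousAt.eventually_ne h] with s hs
    exact Matrix.nonsing_inv_mul _ (isUnit_iff_ne_zero.mpr hs)
  have h0 : Matrix.of W * U t + (U t)⁻¹ * U' = 0 := by
    ext i j
    have := (hW'.mul hU) i j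
    refine this.unique ?_
    refine (hasDerivAt_const t ((1 : Matrix (Fin n) (Fin n) ℝ) i j)).congr_of_eventuallyEq ?_
    filter_upwards [hev] with s hs
    rw [hs]
  have h1 : Matrix.of W = -((U t)⁻¹ * U' * (U t)⁻¹) := by
    have := congrArg (fun A ↦ A * (U t)⁻¹) h0
    simp only [add_mul, Matrix.mul_assoc, Matrix.mul_nonsing_inv _ (isUnit_iff_ne_zero.mpr h),
      mul_one, zero_mul] at this
    rw [Matrix.mul_assoc]
    exact eq_neg_of_add_eq_zero_left this
  rw [← h1]
  exact hW'

lemma trilin (c : Fin n → Fin n → Fin n → ℝ) (hU : MatHasDerivAt U U' t)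
    (hV : MatHasDerivAt V V' t) (hK : MatHasDerivAt K K' t) :
    HasDerivAt (fun s ↦ trilin c (U s) (V s) (K s))
      (HomEinstein.trilin c U' (V t) (K t) + HomEinstein.trilin c (U t) V' (K t)
        + HomEinstein.trilin c (U t) (V t) K') t := by
  simp only [HomEinstein.trilin, ← Finset.sum_add_distrib]
  refine HasDerivAt.fun_sum fun i _ ↦ HasDerivAt.fun_sum fun j _ ↦ HasDerivAt.fun_sum fun k _ ↦
    HasDerivAt.fun_sum fun l _ ↦ HasDerivAt.fun_sum fun p _ ↦ HasDerivAt.fun_sum fun q _ ↦ ?_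
  convert! (((hU i j).mul (hV k l)).mul (hK p q)).mul_const (c i k p * c j l q) using 1
  simp only [Pi.mul_apply]
  ring

end MatHasDerivAt

/-- After `det H` is factored out, this is the expansion `det (1 + t A) = 1 + t tr A + O(t²)`. -/
lemma hasDerivAt_det_line (H T : Matrix (Fin n) (Fin n) ℝ) (h : H.det ≠ 0) :
    HasDerivAt (fun t : ℝ ↦ (H + t • T).det) (H.det * (H⁻¹ * T).trace) 0 := by
  have h1 : ∀ t : ℝ, (H + t • T).det = H.det * (1 + t • (H⁻¹ * T)).det := by
    intro t
    rw [← Matrix.det_mul, mul_add, mul_one, Matrix.mul_smul,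
      Matrix.mul_nonsing_inv_cancel_left _ _ (isUnit_iff_ne_zero.mpr h)]
  simp only [h1]
  refine HasDerivAt.const_mul _ ?_
  have h3 : ∀ t : ℝ, (1 + t • (H⁻¹ * T)).det = 1 + (H⁻¹ * T).trace * t + _ :=
    fun t ↦ Matrix.det_one_add_smul t (H⁻¹ * T)
  rw [funext h3]
  convert! ((hasDerivAt_const (0 : ℝ) (1 : ℝ)).add
    ((hasDerivAt_id (0 : ℝ)).const_mul (H⁻¹ * T).trace)).add
    (((Polynomial.differentiable _) 0).hasDerivAt.mul ((hasDerivAt_id (0 : ℝ)).pow 2)) using 1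
  simp

end MatrixCalculus

/-! ### Multilinearity and symmetries of `trilin`. -/

section Trilin

variable {n : ℕ} (c : Fin n → Fin n → Fin n → ℝ)

lemma trilin_add_left (U U' V K : Matrix (Fin n) (Fin n) ℝ) :
    trilin c (U + U') V K = trilin c U V K + trilin c U' V K := by
  simp only [trilin, ← Finset.sum_add_distrib, Matrix.add_apply, add_mul]

lemma trilin_smul_left (s : ℝ) (U V K : Matrix (Fin n) (Fin n) ℝ) :
    trilin c (s • U) V K = s * trilin c U V K := by
  simp only [trilin, Finset.mul_sum, Matrix.smul_apply, smul_eq_mul, mul_assoc]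

lemma trilin_add_right (U V K K' : Matrix (Fin n) (Fin n) ℝ) :
    trilin c U V (K + K') = trilin c U V K + trilin c U V K' := by
  simp only [trilin, ← Finset.sum_add_distrib, Matrix.add_apply, add_mul, mul_add]

lemma trilin_smul_right (s : ℝ) (U V K : Matrix (Fin n) (Fin n) ℝ) :
    trilin c U V (s • K) = s * trilin c U V K := by
  simp only [trilin, Finset.mul_sum, Matrix.smul_apply, smul_eq_mul]
  refine Finset.sum_congr rfl fun i _ ↦ Finset.sum_congr rfl fun j _ ↦
    Finset.sum_congr rfl fun k _ ↦ Finset.sum_congr rfl fun l _ ↦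
    Finset.sum_congr rfl fun p _ ↦ Finset.sum_congr rfl fun q _ ↦ ?_
  ring

lemma trilin_smul_mid (s : ℝ) (U V K : Matrix (Fin n) (Fin n) ℝ) :
    trilin c U (s • V) K = s * trilin c U V K := by
  simp only [trilin, Finset.mul_sum, Matrix.smul_apply, smul_eq_mul]
  refine Finset.sum_congr rfl fun i _ ↦ Finset.sum_congr rfl fun j _ ↦
    Finset.sum_congr rfl fun k _ ↦ Finset.sum_congr rfl fun l _ ↦
    Finset.sum_congr rfl fun p _ ↦ Finset.sum_congr rfl fun q _ ↦ ?_
  ring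

lemma trilin_transpose (U V K : Matrix (Fin n) (Fin n) ℝ) :
    trilin c U.transpose V.transpose K.transpose = trilin c U V K := by
  simp only [trilin, Matrix.transpose_apply]
  rw [Finset.sum_comm]
  refine Finset.sum_congr rfl fun i _ ↦ Finset.sum_congr rfl fun j _ ↦ ?_
  rw [Finset.sum_comm]
  refine Finset.sum_congr rfl fun k _ ↦ Finset.sum_congr rfl fun l _ ↦ ?_
  rw [Finset.sum_comm]
  refine Finset.sum_congr rfl fun p _ ↦ Finset.sum_congr rfl fun q _ ↦ ?_
  ring

/-- The form is quadratic in `c`, so the two signs from antisymmetry cancel. -/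
lemma trilin_swap {c : Fin n → Fin n → Fin n → ℝ} (hc : ∀ i j k, c i j k = - c j i k)
    (U V K : Matrix (Fin n) (Fin n) ℝ) : trilin c U V K = trilin c V U K := by
  simp only [trilin]
  rw [sum_sum_swap fun i j k l ↦ ∑ p, ∑ q, U i j * V k l * K p q * (c i k p * c j l q)]
  refine Finset.sum_congr rfl fun i _ ↦ Finset.sum_congr rfl fun j _ ↦
    Finset.sum_congr rfl fun k _ ↦ Finset.sum_congr rfl fun l _ ↦
    Finset.sum_congr rfl fun p _ ↦ Finset.sum_congr rfl fun q _ ↦ ?_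
  rw [hc k i p, hc l j q]
  ring

lemma trilin_one_mid (U K : Matrix (Fin n) (Fin n) ℝ) :
    trilin c U 1 K = ∑ i, ∑ j, ∑ k, ∑ p, ∑ q, U i j * K p q * (c i k p * c j k q) := by
  simp only [trilin]
  refine Finset.sum_congr rfl fun i _ ↦ Finset.sum_congr rfl fun j _ ↦
    Finset.sum_congr rfl fun k _ ↦ ?_
  rw [Finset.sum_eq_single k]
  · simp
  · intro l _ hl
    simp [Matrix.one_apply_ne hl.symm]
  · simp

lemma trilin_one_right (U V : Matrix (Fin n) (Fin n) ℝ) :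
    trilin c U V 1 = ∑ i, ∑ j, ∑ k, ∑ l, ∑ p, U i j * V k l * (c i k p * c j l p) := by
  simp only [trilin]
  refine Finset.sum_congr rfl fun i _ ↦ Finset.sum_congr rfl fun j _ ↦
    Finset.sum_congr rfl fun k _ ↦ Finset.sum_congr rfl fun l _ ↦
    Finset.sum_congr rfl fun p _ ↦ ?_
  rw [Finset.sum_eq_single p]
  · simp
  · intro q _ hq
    simp [Matrix.one_apply_ne hq.symm]
  · simp

end Trilin

/-! ### `L` as the linearized Ricci tensor. -/

section LichOp

variable {n : ℕ}

lemma sum_symm_three (φ ψ : Fin n → Fin n → Fin n → ℝ)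
    (h : ∀ i j k, φ i j k + φ j i k = ψ i j k + ψ j i k) :
    ∑ i, ∑ j, ∑ k, φ i j k = ∑ i, ∑ j, ∑ k, ψ i j k := by
  have key : ∀ χ : Fin n → Fin n → Fin n → ℝ,
      2 * ∑ i, ∑ j, ∑ k, χ i j k = ∑ i, ∑ j, ∑ k, (χ i j k + χ j i k) := by
    intro χ
    rw [two_mul]
    nth_rewrite 2 [Finset.sum_comm]
    simp only [Finset.sum_add_distrib]
  have h1 := key φ
  have h2 := key ψ
  simp only [h] at h1
  linarith

lemma trilin_one_one (c : Fin n → Fin n → Fin n → ℝ) (K : Matrix (Fin n) (Fin n) ℝ) :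
    trilin c 1 1 K = ∑ i, ∑ k, ∑ p, ∑ q, K p q * (c i k p * c i k q) := by
  rw [trilin_one_mid]
  refine Finset.sum_congr rfl fun i _ ↦ ?_
  rw [Finset.sum_eq_single i]
  · simp
  · intro l _ hl
    simp [Matrix.one_apply_ne hl.symm]
  · simp

lemma trilin_mid_one_right (c : Fin n → Fin n → Fin n → ℝ) (U : Matrix (Fin n) (Fin n) ℝ) :
    trilin c U 1 1 = ∑ i, ∑ j, ∑ k, ∑ p, U i j * (c i k p * c j k p) := by
  rw [trilin_one_mid]
  refine Finset.sum_congr rfl fun i _ ↦ Finset.sum_congr rfl fun j _ ↦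
    Finset.sum_congr rfl fun k _ ↦ Finset.sum_congr rfl fun p _ ↦ ?_
  rw [Finset.sum_eq_single p]
  · simp
  · intro l _ hl
    simp [Matrix.one_apply_ne hl.symm]
  · simp

variable {c : Fin n → Fin n → Fin n → ℝ}

/-- The inner product of two tangent vectors to the orbit of `c`. -/
lemma ip3_theta (hc : ∀ i j k, c i j k = - c j i k) (A B : Matrix (Fin n) (Fin n) ℝ) :
    ip3 (theta A c) (theta B c) = trilin c 1 1 (A.transpose * B) - 2 * trilin c B 1 A
      - 2 * trilin c A 1 B + 2 * trilin c (A * B.transpose) 1 1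
      + 2 * trilin c A B.transpose 1 := by
  let a₁ : Matrix (Fin n) (Fin n) ℝ → Fin n → Fin n → Fin n → ℝ := fun A i j k ↦ ∑ l, A k l * c i j l
  let a₂ : Matrix (Fin n) (Fin n) ℝ → Fin n → Fin n → Fin n → ℝ := fun A i j k ↦ ∑ l, A l i * c l j k
  have h₁ : ∀ A i j k, a₁ A j i k = - a₁ A i j k := by
    intro A i j k
    simp only [a₁, ← Finset.sum_neg_distrib]
    exact Finset.sum_congr rfl fun l _ ↦ by rw [hc j i]; ring
  -- Antisymmetry of `c` reduces the action on the second argument to that on the first with `i, j`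
  -- exchanged, so that `a₁` and `a₂` suffice.
  have hθ : ∀ A i j k, theta A c i j k = a₁ A i j k - a₂ A i j k + a₂ A j i k := by
    intro A i j k
    have : a₂ A j i k = - ∑ l, A l j * c i l k := by
      simp only [a₂, ← Finset.sum_neg_distrib]
      exact Finset.sum_congr rfl fun l _ ↦ by rw [hc l i]; ring
    rw [this]
    rfl
  have e11 : ∑ i, ∑ j, ∑ k, a₁ A i j k * a₁ B i j k = trilin c 1 1 (A.transpose * B) := by
    rw [trilin_one_one]
    refine Finset.sum_congr rfl fun i _ ↦ Finset.sum_congr rfl fun j _ ↦ ?_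
    simp only [a₁, Finset.sum_mul_sum, Matrix.mul_apply, Matrix.transpose_apply]
    simp only [Finset.sum_mul]
    rw [Finset.sum_comm]
    refine Finset.sum_congr rfl fun l _ ↦ ?_
    rw [Finset.sum_comm]
    exact Finset.sum_congr rfl fun m _ ↦ Finset.sum_congr rfl fun k _ ↦ by ring
  have e12 : ∀ A B, ∑ i, ∑ j, ∑ k, a₁ A i j k * a₂ B i j k = trilin c B 1 A := by
    intro A B
    rw [← trilin_transpose, Matrix.transpose_one, trilin_one_mid]
    refine Finset.sum_congr rfl fun i _ ↦ ?_
    conv_rhs => rw [Finset.sum_comm]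
    refine Finset.sum_congr rfl fun j _ ↦ ?_
    simp only [a₁, a₂, Finset.sum_mul_sum, Matrix.transpose_apply]
    conv_rhs => rw [Finset.sum_comm]
    rw [Finset.sum_comm]
    refine Finset.sum_congr rfl fun l _ ↦ ?_
    rw [Finset.sum_comm]
    exact Finset.sum_congr rfl fun m _ ↦ Finset.sum_congr rfl fun k _ ↦ by ring
  have e22 : ∑ i, ∑ j, ∑ k, a₂ A i j k * a₂ B i j k = trilin c (A * B.transpose) 1 1 := by
    rw [trilin_mid_one_right]
    simp only [a₂, Finset.sum_mul_sum, Matrix.mul_apply, Matrix.transpose_apply]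
    simp only [Finset.sum_mul]
    have : ∀ i, ∑ j, ∑ k, ∑ l, ∑ m, A l i * c l j k * (B m i * c m j k)
        = ∑ l, ∑ m, ∑ j, ∑ k, A l i * c l j k * (B m i * c m j k) :=
      fun i ↦ sum_sum_swap fun j k l m ↦ A l i * c l j k * (B m i * c m j k)
    refine (Finset.sum_congr rfl fun i _ ↦ this i).trans ?_
    rw [Finset.sum_comm]
    refine Finset.sum_congr rfl fun l _ ↦ ?_
    rw [Finset.sum_comm]
    refine Finset.sum_congr rfl fun m _ ↦ ?_
    rw [Finset.sum_comm]
    refine Finset.sum_congr rfl fun j _ ↦ ?_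
    rw [Finset.sum_comm]
    exact Finset.sum_congr rfl fun k _ ↦ Finset.sum_congr rfl fun i _ ↦ by ring
  have e23 : ∑ i, ∑ j, ∑ k, a₂ A i j k * a₂ B j i k = - trilin c A B.transpose 1 := by
    rw [trilin_one_right]
    conv_rhs => rw [Finset.sum_comm]
    rw [← Finset.sum_neg_distrib]
    refine Finset.sum_congr rfl fun i _ ↦ ?_
    conv_rhs => rw [Finset.sum_comm]
    rw [← Finset.sum_neg_distrib]
    refine Finset.sum_congr rfl fun j _ ↦ ?_
    simp only [a₂, Finset.sum_mul_sum, Matrix.transpose_apply]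
    rw [Finset.sum_comm, ← Finset.sum_neg_distrib]
    refine Finset.sum_congr rfl fun l _ ↦ ?_
    rw [Finset.sum_comm, ← Finset.sum_neg_distrib]
    refine Finset.sum_congr rfl fun m _ ↦ ?_
    rw [← Finset.sum_neg_distrib]
    exact Finset.sum_congr rfl fun k _ ↦ by rw [hc i m]; ring
  have e21 : ∑ i, ∑ j, ∑ k, a₂ A i j k * a₁ B i j k = trilin c A 1 B := by
    rw [← e12 B A]
    exact Finset.sum_congr rfl fun i _ ↦ Finset.sum_congr rfl fun j _ ↦
      Finset.sum_congr rfl fun k _ ↦ mul_comm _ _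
  have hneg : trilin c A B.transpose 1 = - ∑ i, ∑ j, ∑ k, a₂ A i j k * a₂ B j i k := by
    rw [e23, neg_neg]
  rw [← e11, ← e12 A B, ← e21, ← e22, hneg, ip3, mul_neg, ← sub_eq_add_neg]
  simp only [Finset.mul_sum, ← Finset.sum_sub_distrib, ← Finset.sum_add_distrib]
  refine sum_symm_three _ _ fun i j k ↦ ?_
  rw [hθ, hθ, hθ, hθ, h₁ A i j, h₁ B i j]
  ring

lemma theta_one (c : Fin n → Fin n → Fin n → ℝ) : theta 1 c = - c := by
  funext i j k
  simp [theta, Matrix.one_apply]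

/-- Because `c = -θ(1) c`, the pairing of `θ(A) c` with `c` is a case of `ip3_theta`. -/
lemma momentMap_apply (hc : ∀ i j k, c i j k = - c j i k) (a b : Fin n) :
    momentMap c a b = (1 / 4) * trilin c 1 1 (Matrix.single a b 1)
      - (1 / 2) * trilin c (Matrix.single a b 1) 1 1 := by
  have h1 : c = - theta 1 c := by rw [theta_one, neg_neg]
  have h2 : ∀ d, ip3 d c = - ip3 d (theta 1 c) := by
    intro d
    conv_lhs => rw [h1]
    simp [ip3]
  rw [momentMap, Matrix.of_apply, h2, ip3_theta hc, Matrix.transpose_one, mul_one, mul_one]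
  have h3 := trilin_transpose c 1 1 (Matrix.single a b 1)
  rw [Matrix.transpose_one] at h3
  rw [h3]
  ring

lemma single_eq_smul (a b : Fin n) (s : ℝ) :
    (Matrix.single a b s : Matrix (Fin n) (Fin n) ℝ) = s • Matrix.single a b 1 := by
  rw [Matrix.smul_single, smul_eq_mul, mul_one]

lemma trilin_sum_left {ι : Type*} (s : Finset ι) (U : ι → Matrix (Fin n) (Fin n) ℝ)
    (V K : Matrix (Fin n) (Fin n) ℝ) :
    trilin c (∑ i ∈ s, U i) V K = ∑ i ∈ s, trilin c (U i) V K :=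
  map_sum (AddMonoidHom.mk' (fun U ↦ trilin c U V K) fun _ _ ↦ trilin_add_left c _ _ _ _) U s

lemma trilin_sum_right {ι : Type*} (s : Finset ι) (K : ι → Matrix (Fin n) (Fin n) ℝ)
    (U V : Matrix (Fin n) (Fin n) ℝ) :
    trilin c U V (∑ i ∈ s, K i) = ∑ i ∈ s, trilin c U V (K i) :=
  map_sum (AddMonoidHom.mk' (fun K ↦ trilin c U V K) fun _ _ ↦ trilin_add_right c _ _ _ _) K s

lemma mul_single_eq_sum (S : Matrix (Fin n) (Fin n) ℝ) (a b : Fin n) :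
    S * (Matrix.single a b 1 : Matrix (Fin n) (Fin n) ℝ) = ∑ l, S l a • Matrix.single l b 1 := by
  ext p q
  simp [Matrix.sum_apply, Matrix.single_apply, Matrix.mul_apply]
  by_cases h : b = q <;> simp [h]

lemma single_mul_eq_sum (S : Matrix (Fin n) (Fin n) ℝ) (a b : Fin n) :
    (Matrix.single a b 1 : Matrix (Fin n) (Fin n) ℝ) * S = ∑ l, S b l • Matrix.single a l 1 := by
  ext p q
  simp [Matrix.sum_apply, Matrix.single_apply, Matrix.mul_apply]
  by_cases h : a = p <;> simp [h]

/-- The derivative at the metric `1` of `momentForm c · X` in the direction `S`. -/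
def momentDeriv (c : Fin n → Fin n → Fin n → ℝ) (S X : Matrix (Fin n) (Fin n) ℝ) : ℝ :=
  -(1 / 2) * (trilin c X (-S) 1 + trilin c X 1 S)
    + (1 / 4) * (trilin c (-S) 1 X + trilin c 1 (-S) X + trilin c 1 1 (S * X + X * S))

/-- The operator `L` is twice the derivative of the moment map part of the Ricci tensor. -/
lemma lichOp_apply (hc : ∀ i j k, c i j k = - c j i k) {S : Matrix (Fin n) (Fin n) ℝ}
    (hS : S.IsSymm) (a b : Fin n) :
    lichOp c S a b = 2 * momentDeriv c S (Matrix.single a b 1) := by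
  set X : Matrix (Fin n) (Fin n) ℝ := Matrix.single a b 1 with hX
  have hXt : Matrix.single b a 1 = X.transpose := by rw [hX, Matrix.transpose_single]
  have hd : ∀ i j, deltaT c (delta c S) i j = ip3 (theta S c) (theta (Matrix.single i j 1) c) := by
    intro i j
    simp [deltaT, delta, ip3]
  have hm1 : (S * momentMap c) a b
      = (1 / 4) * trilin c 1 1 (S * X) - (1 / 2) * trilin c (S * X) 1 1 := by
    rw [Matrix.mul_apply, hX, mul_single_eq_sum, trilin_sum_left, trilin_sum_right,
      Finset.mul_sum, Finset.mul_sum, ← Finset.sum_sub_distrib]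
    refine Finset.sum_congr rfl fun l _ ↦ ?_
    rw [momentMap_apply hc, trilin_smul_left, trilin_smul_right, hS.apply]
    ring
  have hm2 : (momentMap c * S) a b
      = (1 / 4) * trilin c 1 1 (X * S) - (1 / 2) * trilin c (X * S) 1 1 := by
    rw [Matrix.mul_apply, hX, single_mul_eq_sum, trilin_sum_left, trilin_sum_right,
      Finset.mul_sum, Finset.mul_sum, ← Finset.sum_sub_distrib]
    refine Finset.sum_congr rfl fun l _ ↦ ?_
    rw [momentMap_apply hc, trilin_smul_left, trilin_smul_right, hS.apply]
    ring
  have t1 : trilin c 1 1 (S * X.transpose) = trilin c 1 1 (X * S) := by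
    rw [← trilin_transpose, Matrix.transpose_mul, Matrix.transpose_transpose, hS.eq,
      Matrix.transpose_one]
  have t2 : trilin c (X * S) 1 1 = trilin c (S * X.transpose) 1 1 := by
    rw [← trilin_transpose, Matrix.transpose_mul, hS.eq, Matrix.transpose_one]
  have t3 : trilin c X.transpose 1 S = trilin c X 1 S := by
    rw [← trilin_transpose, Matrix.transpose_transpose, hS.eq, Matrix.transpose_one]
  have t4 : trilin c S 1 X.transpose = trilin c S 1 X := by
    rw [← trilin_transpose, Matrix.transpose_transpose, hS.eq, Matrix.transpose_one]
  have t5 : trilin c S X.transpose 1 = trilin c S X 1 := by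
    rw [← trilin_transpose, Matrix.transpose_transpose, hS.eq, Matrix.transpose_one]
  have n1 : ∀ V K, trilin c (-S) V K = - trilin c S V K := fun V K ↦ by
    rw [← neg_one_smul ℝ S, trilin_smul_left, neg_one_mul]
  have n2 : ∀ U K, trilin c U (-S) K = - trilin c U S K := fun U K ↦ by
    rw [← neg_one_smul ℝ S, trilin_smul_mid, neg_one_mul]
  -- The terms `trilin c (S * X) 1 1` and `trilin c (X * S) 1 1` of `A M + M A` cancel those of `½
  -- S(δᵗ δ A)`; the remaining ones are exactly the linearized moment part of Ricci.
  simp only [lichOp, Matrix.add_apply, Matrix.smul_apply, Matrix.transpose_apply, smul_eq_mul, hd,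
    ip3_theta hc, hm1, hm2, momentDeriv, hS.eq, hXt, ← hX, Matrix.transpose_transpose, t1, t2, t3,
    t4, t5, n1, n2, trilin_add_right]
  rw [trilin_swap hc 1 S X, trilin_swap hc X S 1]
  ring

/-- The operator `L` maps symmetric matrices to symmetric matrices. -/
lemma lichOp_isSymm (hc : ∀ i j k, c i j k = - c j i k) {S : Matrix (Fin n) (Fin n) ℝ}
    (hS : S.IsSymm) : (lichOp c S).IsSymm := by
  have hM : (momentMap c).transpose = momentMap c := by
    ext a b
    rw [Matrix.transpose_apply, momentMap_apply hc, momentMap_apply hc,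
      ← trilin_transpose c 1 1 (Matrix.single a b 1), ← trilin_transpose c (Matrix.single a b 1) 1 1,
      Matrix.transpose_single, Matrix.transpose_one]
  rw [Matrix.IsSymm, lichOp, Matrix.transpose_add, Matrix.transpose_add, Matrix.transpose_mul,
    Matrix.transpose_mul, hM, hS.eq, Matrix.transpose_smul, Matrix.transpose_smul,
    Matrix.transpose_add, Matrix.transpose_transpose,
    add_comm (deltaT c (delta c S)).transpose, add_right_comm]

end LichOp

/-! ### First and second variation of the normalized scalar curvature. -/

section Hessian

variable {n : ℕ} {c : Fin n → Fin n → Fin n → ℝ}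

/-- The Frobenius inner product of matrices. -/
def frob (A B : Matrix (Fin n) (Fin n) ℝ) : ℝ := ∑ i, ∑ j, A i j * B i j

lemma frob_comm (A B : Matrix (Fin n) (Fin n) ℝ) : frob A B = frob B A :=
  Finset.sum_congr rfl fun _ _ ↦ Finset.sum_congr rfl fun _ _ ↦ mul_comm _ _

lemma frob_add_left (A A' B : Matrix (Fin n) (Fin n) ℝ) :
    frob (A + A') B = frob A B + frob A' B := by
  simp only [frob, Matrix.add_apply, add_mul, Finset.sum_add_distrib]

lemma frob_smul_left (s : ℝ) (A B : Matrix (Fin n) (Fin n) ℝ) :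
    frob (s • A) B = s * frob A B := by
  simp only [frob, Matrix.smul_apply, smul_eq_mul, Finset.mul_sum, mul_assoc]

lemma frob_sub_left (A A' B : Matrix (Fin n) (Fin n) ℝ) :
    frob (A - A') B = frob A B - frob A' B := by
  rw [sub_eq_add_neg, frob_add_left, ← neg_one_smul ℝ A', frob_smul_left]
  ring

lemma frob_sub_right (A B B' : Matrix (Fin n) (Fin n) ℝ) :
    frob A (B - B') = frob A B - frob A B' := by
  rw [frob_comm, frob_sub_left, frob_comm B, frob_comm B']

lemma frob_smul_right (s : ℝ) (A B : Matrix (Fin n) (Fin n) ℝ) :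
    frob A (s • B) = s * frob A B := by
  rw [frob_comm, frob_smul_left, frob_comm]

lemma frob_eq_trace_mul (A : Matrix (Fin n) (Fin n) ℝ) {B : Matrix (Fin n) (Fin n) ℝ}
    (hB : B.IsSymm) : frob A B = (A * B).trace := by
  simp only [Matrix.trace, Matrix.diag_apply, Matrix.mul_apply]
  exact Finset.sum_congr rfl fun _ _ ↦ Finset.sum_congr rfl fun _ _ ↦ by rw [hB.apply]

lemma frob_self_nonneg (A : Matrix (Fin n) (Fin n) ℝ) : 0 ≤ frob A A :=
  Finset.sum_nonneg fun _ _ ↦ Finset.sum_nonneg fun _ _ ↦ mul_self_nonneg _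

lemma eq_zero_of_frob_self {A : Matrix (Fin n) (Fin n) ℝ} (h : frob A A = 0) : A = 0 := by
  ext i j
  have h1 := (Finset.sum_eq_zero_iff_of_nonneg fun i _ ↦
    Finset.sum_nonneg fun j _ ↦ mul_self_nonneg (A i j)).mp h i (Finset.mem_univ i)
  have h2 := (Finset.sum_eq_zero_iff_of_nonneg fun j _ ↦ mul_self_nonneg (A i j)).mp h1 j
    (Finset.mem_univ j)
  exact mul_self_eq_zero.mp h2

lemma momentForm_add (H X X' : Matrix (Fin n) (Fin n) ℝ) :
    momentForm c H (X + X') = momentForm c H X + momentForm c H X' := by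
  rw [momentForm, momentForm, momentForm, trilin_add_left, Matrix.mul_add, Matrix.add_mul,
    trilin_add_right]
  ring

lemma momentForm_smul (s : ℝ) (H X : Matrix (Fin n) (Fin n) ℝ) :
    momentForm c H (s • X) = s * momentForm c H X := by
  rw [momentForm, momentForm, trilin_smul_left, Matrix.mul_smul, Matrix.smul_mul,
    trilin_smul_right]
  ring

lemma momentDeriv_add_right (S X X' : Matrix (Fin n) (Fin n) ℝ) :
    momentDeriv c S (X + X') = momentDeriv c S X + momentDeriv c S X' := by
  simp only [momentDeriv, trilin_add_left, trilin_add_right, mul_add, add_mul]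
  ring

lemma momentDeriv_smul_right (s : ℝ) (S X : Matrix (Fin n) (Fin n) ℝ) :
    momentDeriv c S (s • X) = s * momentDeriv c S X := by
  simp only [momentDeriv, trilin_smul_left, trilin_smul_right, Matrix.mul_smul, Matrix.smul_mul,
    ← smul_add]
  ring

/-- A linear functional on matrices is the Frobenius product with the matrix of its values. -/
lemma frob_of_linear {f : Matrix (Fin n) (Fin n) ℝ → ℝ} (hadd : ∀ X Y, f (X + Y) = f X + f Y)
    (hsmul : ∀ (s : ℝ) X, f (s • X) = s * f X) (X : Matrix (Fin n) (Fin n) ℝ) :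
    frob X (Matrix.of fun a b ↦ f (Matrix.single a b 1)) = f X := by
  let F : Matrix (Fin n) (Fin n) ℝ →ₗ[ℝ] ℝ := ⟨⟨f, hadd⟩, hsmul⟩
  have : f X = F X := rfl
  rw [this]
  conv_rhs => rw [Matrix.matrix_eq_sum_single X]
  simp only [map_sum, frob, Matrix.of_apply]
  refine Finset.sum_congr rfl fun i _ ↦ Finset.sum_congr rfl fun j _ ↦ ?_
  rw [single_eq_smul i j (X i j), map_smul, smul_eq_mul]
  rfl

lemma frob_lichOp (hc : ∀ i j k, c i j k = - c j i k) {S : Matrix (Fin n) (Fin n) ℝ}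
    (hS : S.IsSymm) (X : Matrix (Fin n) (Fin n) ℝ) :
    frob X (lichOp c S) = 2 * momentDeriv c S X := by
  rw [← frob_of_linear (f := fun X ↦ 2 * momentDeriv c S X)
    (fun _ _ ↦ by rw [momentDeriv_add_right, mul_add])
    (fun _ _ ↦ by rw [momentDeriv_smul_right]; ring) X]
  congr 1
  ext a b
  exact lichOp_apply hc hS a b

/-- The only term not visibly symmetric is `trilin c X S 1`, which is symmetric by `trilin_swap`. -/
lemma momentDeriv_comm (hc : ∀ i j k, c i j k = - c j i k) (S X : Matrix (Fin n) (Fin n) ℝ) :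
    momentDeriv c S X = momentDeriv c X S := by
  have n1 : ∀ S V K, trilin c (-S) V K = - trilin c S V K := fun S V K ↦ by
    rw [← neg_one_smul ℝ S, trilin_smul_left, neg_one_mul]
  have n2 : ∀ S U K, trilin c U (-S) K = - trilin c U S K := fun S U K ↦ by
    rw [← neg_one_smul ℝ S, trilin_smul_mid, neg_one_mul]
  simp only [momentDeriv, n1, n2]
  rw [trilin_swap hc 1 S X, trilin_swap hc 1 X S, trilin_swap hc X S 1, add_comm (S * X)]
  ring

/-- Self-adjointness of `L` on symmetric matrices; both the invariance of `W` and the spectral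
theorem rest on it. -/
lemma frob_lichOp_comm (hc : ∀ i j k, c i j k = - c j i k) {S X : Matrix (Fin n) (Fin n) ℝ}
    (hS : S.IsSymm) (hX : X.IsSymm) : frob X (lichOp c S) = frob S (lichOp c X) := by
  rw [frob_lichOp hc hS, frob_lichOp hc hX, momentDeriv_comm hc]

lemma frob_left_injective {A B : Matrix (Fin n) (Fin n) ℝ} (h : ∀ X, frob X A = frob X B) :
    A = B := by
  have := eq_zero_of_frob_self (A := A - B) (by rw [frob_sub_right, h, sub_self])
  exact sub_eq_zero.mp this

lemma lichOp_add (hc : ∀ i j k, c i j k = - c j i k) {A B : Matrix (Fin n) (Fin n) ℝ}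
    (hA : A.IsSymm) (hB : B.IsSymm) : lichOp c (A + B) = lichOp c A + lichOp c B := by
  refine frob_left_injective fun X ↦ ?_
  rw [frob_lichOp hc (hA.add hB), frob_comm, frob_add_left, frob_comm, frob_lichOp hc hA,
    frob_comm _ X, frob_lichOp hc hB, momentDeriv_comm hc, momentDeriv_add_right,
    momentDeriv_comm hc X, momentDeriv_comm hc X]
  ring

lemma lichOp_smul (hc : ∀ i j k, c i j k = - c j i k) (s : ℝ) {A : Matrix (Fin n) (Fin n) ℝ}
    (hA : A.IsSymm) : lichOp c (s • A) = s • lichOp c A := by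
  refine frob_left_injective fun X ↦ ?_
  rw [frob_lichOp hc (hA.smul s), frob_smul_right, frob_lichOp hc hA, momentDeriv_comm hc,
    momentDeriv_smul_right, momentDeriv_comm hc X]
  ring

/-- The metric itself is in the kernel of `L`. -/
lemma lichOp_one (hc : ∀ i j k, c i j k = - c j i k) : lichOp c (1 : Matrix (Fin n) (Fin n) ℝ) = 0 := by
  refine frob_left_injective fun X ↦ ?_
  have n1 : ∀ S V K, trilin c (-S) V K = - trilin c S V K := fun S V K ↦ by
    rw [← neg_one_smul ℝ S, trilin_smul_left, neg_one_mul]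
  have n2 : ∀ S U K, trilin c U (-S) K = - trilin c U S K := fun S U K ↦ by
    rw [← neg_one_smul ℝ S, trilin_smul_mid, neg_one_mul]
  -- The variations of `H` and of `H⁻¹` along `1` cancel, as they must since Ricci is scale
  -- invariant.
  rw [frob_lichOp hc Matrix.isSymm_one, momentDeriv, n1, n2, n2, one_mul, mul_one,
    trilin_add_right]
  simp [frob]

lemma frob_ricMat (β H X : Matrix (Fin n) (Fin n) ℝ) :
    frob X (ricMat c β H) = momentForm c H X - (1 / 2) * frob X β := by
  rw [← frob_of_linear (f := fun X ↦ momentForm c H X - (1 / 2) * frob X β) (fun _ _ ↦ by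
    rw [momentForm_add, frob_add_left]; ring) (fun _ _ ↦ by
    rw [momentForm_smul, frob_smul_left]; ring) X]
  congr 1
  ext a b
  have : frob (Matrix.single a b 1) β = β a b := by
    rw [frob, Finset.sum_eq_single a, Finset.sum_eq_single b]
    · simp
    · intro j _ hj; simp [hj.symm]
    · simp
    · intro j _ hj; simp [hj.symm]
    · simp
  rw [Matrix.of_apply, this]
  rfl

/-- Each term is homogeneous of degree zero in `H`. -/
lemma ricMat_smul (β : Matrix (Fin n) (Fin n) ℝ) {d : ℝ} (hd : d ≠ 0)
    {H : Matrix (Fin n) (Fin n) ℝ} (hH : IsUnit H.det) :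
    ricMat c β (d • H) = ricMat c β H := by
  have hi : (d • H)⁻¹ = d⁻¹ • H⁻¹ := by
    have := Matrix.inv_smul' H (Units.mk0 d hd) hH
    simpa [Units.smul_def] using this
  ext a b
  rw [ricMat, ricMat, Matrix.of_apply, Matrix.of_apply, momentForm, momentForm, hi]
  simp only [trilin_smul_left, trilin_smul_mid, trilin_smul_right, Matrix.smul_mul, Matrix.mul_smul]
  field_simp

/-- The scalar curvature of the metric with matrix `H`. -/
def scalMat (c : Fin n → Fin n → Fin n → ℝ) (β H : Matrix (Fin n) (Fin n) ℝ) : ℝ :=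
  -(1 / 4) * trilin c H⁻¹ H⁻¹ H - (1 / 2) * frob H⁻¹ β

/-- For `X = H⁻¹` both terms of `momentForm` are multiples of the same `trilin`, with `-1/2 + 1/4 =
-1/4`. -/
lemma trace_inv_mul_ricMat (β : Matrix (Fin n) (Fin n) ℝ) {H : Matrix (Fin n) (Fin n) ℝ}
    (hH : IsUnit H.det) (hs : H.IsSymm) : (H⁻¹ * ricMat c β H).trace = scalMat c β H := by
  have hi : (H⁻¹).IsSymm := by
    rw [Matrix.IsSymm, Matrix.transpose_nonsing_inv, hs.eq]
  rw [Matrix.trace_mul_comm, ← frob_eq_trace_mul _ hi, frob_comm, frob_ricMat, momentForm, scalMat,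
    Matrix.mul_nonsing_inv _ hH, one_mul]
  ring

lemma isUnit_det_of_ne {H : Matrix (Fin n) (Fin n) ℝ} (h : H.det ≠ 0) : IsUnit H.det :=
  isUnit_iff_ne_zero.mpr h

/-- First variation of the scalar curvature. -/
lemma MatHasDerivAt.scalMat (hc : ∀ i j k, c i j k = - c j i k) (β : Matrix (Fin n) (Fin n) ℝ)
    {H : ℝ → Matrix (Fin n) (Fin n) ℝ} {T : Matrix (Fin n) (Fin n) ℝ} {t : ℝ}
    (hH : MatHasDerivAt H T t) (hdet : (H t).det ≠ 0) :
    HasDerivAt (fun s ↦ scalMat c β (H s))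
      (- frob ((H t)⁻¹ * T * (H t)⁻¹) (ricMat c β (H t))) t := by
  have hi := hH.inv hdet
  have hf : HasDerivAt (fun s ↦ frob (H s)⁻¹ β) (frob (-((H t)⁻¹ * T * (H t)⁻¹)) β) t :=
    HasDerivAt.fun_sum fun i _ ↦ HasDerivAt.fun_sum fun j _ ↦ (hi i j).mul_const _
  have h := ((hi.trilin c hi hH).const_mul (-(1 / 4))).sub (hf.const_mul (1 / 2))
  convert! h using 1
  have hu := isUnit_det_of_ne hdet
  have hX : H t * ((H t)⁻¹ * T * (H t)⁻¹) * H t = T := by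
    rw [Matrix.mul_assoc, Matrix.mul_assoc ((H t)⁻¹ * T), Matrix.nonsing_inv_mul _ hu, mul_one,
      Matrix.mul_nonsing_inv_cancel_left _ _ hu]
  rw [frob_ricMat, momentForm, hX]
  set X := (H t)⁻¹ * T * (H t)⁻¹
  rw [← neg_one_smul ℝ X, trilin_smul_left, trilin_smul_mid, frob_smul_left,
    trilin_swap hc (H t)⁻¹ X]
  ring

/-- First variation of the Ricci tensor. -/
lemma MatHasDerivAt.ricMat (hc : ∀ i j k, c i j k = - c j i k) (β : Matrix (Fin n) (Fin n) ℝ)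
    {H : ℝ → Matrix (Fin n) (Fin n) ℝ} {S : Matrix (Fin n) (Fin n) ℝ} {t : ℝ}
    (hH : MatHasDerivAt H S t) (hS : S.IsSymm) (h1 : H t = 1) :
    MatHasDerivAt (fun s ↦ ricMat c β (H s)) ((1 / 2 : ℝ) • lichOp c S) t := by
  intro a b
  have hdet : (H t).det ≠ 0 := by rw [h1, Matrix.det_one]; exact one_ne_zero
  have hi := hH.inv hdet
  set X : Matrix (Fin n) (Fin n) ℝ := Matrix.single a b 1 with hX
  have hcX := MatHasDerivAt.const X t
  have h := ((((hcX.trilin c hi hH).const_mul (-(1 / 2))).add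
    ((hi.trilin c hi ((hH.mul hcX).mul hH)).const_mul (1 / 4))).sub
    (hasDerivAt_const t ((1 / 2) * β a b)))
  simp only [HomEinstein.ricMat, momentForm, Matrix.of_apply, ← hX]
  convert! h using 1
  have z : ∀ V K, HomEinstein.trilin c 0 V K = 0 := fun V K ↦ by
    rw [← zero_smul ℝ (0 : Matrix (Fin n) (Fin n) ℝ), trilin_smul_left, zero_mul]
  rw [Matrix.smul_apply, lichOp_apply hc hS, ← hX, momentDeriv, smul_eq_mul]
  simp only [h1, inv_one, one_mul, mul_one, mul_zero, add_zero, z]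
  ring

/-- The scalar curvature of the metric with matrix `H` after normalizing the volume. -/
def normScal (c : Fin n → Fin n → Fin n → ℝ) (β H : Matrix (Fin n) (Fin n) ℝ) : ℝ :=
  H.det ^ (1 / (n : ℝ)) * scalMat c β H

/-- The derivative of `normScal c β` at `H` in the direction `T`. -/
def normScalDeriv (c : Fin n → Fin n → Fin n → ℝ) (β H T : Matrix (Fin n) (Fin n) ℝ) : ℝ :=
  H.det ^ (1 / (n : ℝ)) * ((1 / (n : ℝ)) * (H⁻¹ * T).trace * scalMat c β H
    - frob (H⁻¹ * T * H⁻¹) (ricMat c β H))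

/-- Scaling leaves Ricci fixed and divides its trace by the factor, so normalizing the volume
multiplies the scalar curvature by `det ^ (1 / n)`. -/
lemma trace_smul_inv_mul_ricMat (β : Matrix (Fin n) (Fin n) ℝ) {H : Matrix (Fin n) (Fin n) ℝ}
    (hH : 0 < H.det) (hs : H.IsSymm) :
    ((H.det ^ (-(1 / (n : ℝ))) • H)⁻¹ * ricMat c β (H.det ^ (-(1 / (n : ℝ))) • H)).trace
      = normScal c β H := by
  have hu := isUnit_det_of_ne hH.ne'
  have hd : H.det ^ (-(1 / (n : ℝ))) ≠ 0 := (Real.rpow_pos_of_pos hH _).ne'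
  have hi : (H.det ^ (-(1 / (n : ℝ))) • H)⁻¹ = (H.det ^ (-(1 / (n : ℝ))))⁻¹ • H⁻¹ := by
    have := Matrix.inv_smul' H (Units.mk0 _ hd) hu
    simpa [Units.smul_def] using this
  rw [ricMat_smul β hd hu, hi, Matrix.smul_mul, Matrix.trace_smul, trace_inv_mul_ricMat β hu hs,
    Real.rpow_neg hH.le, inv_inv]
  rfl

lemma hasDerivAt_normScal (hc : ∀ i j k, c i j k = - c j i k)
    (β T : Matrix (Fin n) (Fin n) ℝ) {H : Matrix (Fin n) (Fin n) ℝ}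
    (hH : 0 < H.det) :
    HasDerivAt (fun t : ℝ ↦ normScal c β (H + t • T)) (normScalDeriv c β H T) 0 := by
  have h0 : H + (0 : ℝ) • T = H := by simp
  have h1 := (hasDerivAt_det_line H T hH.ne').rpow_const (p := 1 / (n : ℝ))
    (Or.inl (by rw [h0]; exact hH.ne'))
  have h2 := (MatHasDerivAt.line H T 0).scalMat hc β (by rw [h0]; exact hH.ne')
  convert! h1.mul h2 using 1
  rw [normScalDeriv]
  simp only [h0, Real.rpow_sub_one hH.ne']
  have := hH.ne'
  field_simp
  ring

/-- Second variation of the normalized scalar curvature at an Einstein metric. -/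
lemma hasDerivAt_normScalDeriv (hc : ∀ i j k, c i j k = - c j i k)
    (β : Matrix (Fin n) (Fin n) ℝ) {S T : Matrix (Fin n) (Fin n) ℝ} (hS : S.IsSymm)
    (hT : T.trace = 0) {ρ : ℝ} (hρ : ricMat c β 1 = ρ • 1) :
    HasDerivAt (fun s : ℝ ↦ normScalDeriv c β (1 + s • S) T)
      ((1 / 2) * frob T ((2 * ρ) • S - lichOp c S)) 0 := by
  have h0 : (1 : Matrix (Fin n) (Fin n) ℝ) + (0 : ℝ) • S = 1 := by simp
  have hl := MatHasDerivAt.line 1 S 0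
  have hdet : ((1 : Matrix (Fin n) (Fin n) ℝ) + (0 : ℝ) • S).det ≠ 0 := by
    rw [h0, Matrix.det_one]; exact one_ne_zero
  have hi := hl.inv hdet
  have hcT := MatHasDerivAt.const T 0
  have h1 := (hl.differentiableAt_det.hasDerivAt).rpow_const (p := 1 / (n : ℝ)) (Or.inl hdet)
  have h2 := ((hi.mul hcT).trace.const_mul (1 / (n : ℝ))).mul (hl.scalMat hc β hdet)
  have hX := (hi.mul hcT).mul hi
  have hR := hl.ricMat hc β hS h0
  have h3 : HasDerivAt _ _ (0 : ℝ) := HasDerivAt.fun_sum fun i (_ : i ∈ Finset.univ) ↦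
    HasDerivAt.fun_sum fun j (_ : j ∈ Finset.univ) ↦ (hX i j).mul (hR i j)
  -- The bracket multiplying `det ^ (1 / n)` vanishes at `1` because `T` is traceless, so the
  -- derivative of this power does not contribute.
  convert! h1.mul (h2.sub h3) using 1
  simp only [h0, inv_one, one_mul, mul_one, hT, mul_zero, add_zero, Matrix.det_one, Real.one_rpow,
    hρ, Finset.sum_add_distrib]
  have e1 : scalMat c β 1 = n * ρ := by
    rw [← trace_inv_mul_ricMat β (by simp) Matrix.isSymm_one, hρ, inv_one, one_mul,
      Matrix.trace_smul, Matrix.trace_one, Fintype.card_fin, smul_eq_mul, mul_comm]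
  have e2 : ∀ A : Matrix (Fin n) (Fin n) ℝ, ∑ i, ∑ j, A i j * (ρ • (1 : Matrix (Fin n) (Fin n) ℝ)) i j
      = ρ * A.trace := by
    intro A
    have := frob_eq_trace_mul A (B := ρ • (1 : Matrix (Fin n) (Fin n) ℝ))
      (Matrix.isSymm_one.smul ρ)
    rw [Matrix.mul_smul, mul_one, Matrix.trace_smul, smul_eq_mul] at this
    exact this
  have e3 : ∑ i, ∑ j, T i j * ((1 / 2 : ℝ) • lichOp c S) i j = (1 / 2) * frob T (lichOp c S) := by
    rw [← frob_smul_right]; rfl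
  -- For `n = 0` the factor `1 / n` is `0`, but then every trace is zero too.
  have e4 : (1 / (n : ℝ)) * (-S * T).trace * (n * ρ) = - ρ * (S * T).trace := by
    rcases Nat.eq_zero_or_pos n with hn | hn
    · subst hn
      simp [Matrix.trace]
    · have : (n : ℝ) ≠ 0 := by positivity
      rw [neg_mul, Matrix.trace_neg]
      field_simp
  have e5 : (T * S).trace = (S * T).trace := Matrix.trace_mul_comm _ _
  simp only [neg_mul, mul_neg, zero_mul, Pi.sub_apply, Pi.mul_apply] at e4 ⊢
  simp only [h0, inv_one, one_mul, mul_one, hT, mul_zero, zero_mul, e1, e2, e3, hρ, Matrix.trace_add,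
    Matrix.trace_neg, frob_sub_right, frob_smul_right, frob_eq_trace_mul T hS, e5] at e4 ⊢
  -- The coefficient of `tr (S T)` is `-ρ` from the inverse in the trace term plus `2ρ` from the two
  -- inverses in `H⁻¹ T H⁻¹`, in total `ρ = ½ · 2ρ`.
  linear_combination (-1 : ℝ) * e4

end Hessian

/-! ### The spectral theorem and the stability types. -/

section Spectral

variable {n : ℕ}

/-- The spectral theorem for a Frobenius-self-adjoint operator on a space of matrices. -/
lemma exists_eigenbasis (V : Submodule ℝ (Matrix (Fin n) (Fin n) ℝ)) (L : V →ₗ[ℝ] V)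
    (hL : ∀ A B : V, frob (L A : Matrix (Fin n) (Fin n) ℝ) B = frob A (L B : Matrix (Fin n) (Fin n) ℝ)) :
    ∃ (m : ℕ) (v : Fin m → V) (lam : Fin m → ℝ), (∀ i, v i ≠ 0) ∧ (∀ i, L (v i) = lam i • v i) ∧
      (∀ A : V, ∃ a : Fin m → ℝ, A = ∑ i, a i • v i) ∧
      (∀ i j, frob (v i : Matrix (Fin n) (Fin n) ℝ) (v j) = if i = j then 1 else 0) := by
  let core : InnerProductSpace.Core ℝ V :=
    { inner := fun A B ↦ frob (A : Matrix (Fin n) (Fin n) ℝ) B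
      conj_inner_symm := fun A B ↦ frob_comm _ _
      re_inner_nonneg := fun A ↦ frob_self_nonneg _
      add_left := fun A B C ↦ frob_add_left _ _ _
      smul_left := fun A B s ↦ frob_smul_left _ _ _
      definite := fun A hA ↦ Subtype.ext (eq_zero_of_frob_self hA) }
  let _ : NormedAddCommGroup V := core.toNormedAddCommGroup
  let _ : InnerProductSpace ℝ V := InnerProductSpace.ofCore core.toCore
  have hsym : L.IsSymmetric := fun A B ↦ hL A B
  let v := hsym.eigenvectorBasis rfl
  refine ⟨_, v, hsym.eigenvalues rfl, fun i h ↦ ?_, fun i ↦ ?_, fun A ↦ ⟨_, (v.sum_repr A).symm⟩,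
    fun i j ↦ orthonormal_iff_ite.mp v.orthonormal i j⟩
  · have := v.orthonormal.1 i
    rw [h, norm_zero] at this
    exact zero_ne_one this
  · exact hsym.apply_eigenvectorBasis rfl i

end Spectral

section Stability

/-- A nonempty finite range attains its minimum, which makes the strict inequality pass to the
infimum; the empty range gives `⊤`, in agreement with the convention for `W = 0`. -/
lemma coe_lt_sInf_range {m : ℕ} (lam : Fin m → ℝ) (k : ℝ) :
    (k : EReal) < sInf ((fun c : ℝ ↦ (c : EReal)) '' Set.range lam) ↔ ∀ i, k < lam i := by
  constructor
  · intro h i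
    exact EReal.coe_lt_coe_iff.mp (h.trans_le (sInf_le ⟨_, ⟨i, rfl⟩, rfl⟩))
  · intro h
    rcases isEmpty_or_nonempty (Fin m) with hm | hm
    · rw [Set.range_eq_empty, Set.image_empty, sInf_empty]
      exact EReal.coe_lt_top k
    · obtain ⟨i, hi⟩ := Finite.exists_min lam
      refine (EReal.coe_lt_coe_iff.mpr (h i)).trans_le (le_sInf ?_)
      rintro _ ⟨_, ⟨j, rfl⟩, rfl⟩
      exact EReal.coe_le_coe_iff.mpr (hi j)

lemma sInf_range_lt_coe {m : ℕ} (lam : Fin m → ℝ) (k : ℝ) :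
    sInf ((fun c : ℝ ↦ (c : EReal)) '' Set.range lam) < (k : EReal) ↔ ∃ i, lam i < k := by
  rw [sInf_lt_iff]
  constructor
  · rintro ⟨_, ⟨_, ⟨i, rfl⟩, rfl⟩, h⟩
    exact ⟨i, EReal.coe_lt_coe_iff.mp h⟩
  · rintro ⟨i, h⟩
    exact ⟨_, ⟨_, ⟨i, rfl⟩, rfl⟩, EReal.coe_lt_coe_iff.mpr h⟩

lemma sInf_range_eq_coe {m : ℕ} (lam : Fin m → ℝ) (k : ℝ) :
    sInf ((fun c : ℝ ↦ (c : EReal)) '' Set.range lam) = (k : EReal)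
      ↔ (∀ i, k ≤ lam i) ∧ ∃ i, lam i = k := by
  have h1 := coe_lt_sInf_range lam k
  have h2 := sInf_range_lt_coe lam k
  constructor
  · intro h
    rw [h] at h1 h2
    simp only [lt_self_iff_false, false_iff, not_forall, not_exists, not_lt] at h1 h2
    obtain ⟨i, hi⟩ := h1
    exact ⟨h2, i, le_antisymm hi (h2 i)⟩
  · rintro ⟨h, i, hi⟩
    refine le_antisymm (not_lt.mp fun h' ↦ ?_) (not_lt.mp fun h' ↦ ?_)
    · exact (h1.mp h' i).ne hi.symm
    · obtain ⟨j, hj⟩ := h2.mp h'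
      exact absurd (h j) (not_le.mpr hj)

lemma sSup_range_lt_coe {m : ℕ} (lam : Fin m → ℝ) (k : ℝ) :
    sSup ((fun c : ℝ ↦ (c : EReal)) '' Set.range lam) < (k : EReal) ↔ ∀ i, lam i < k := by
  constructor
  · intro h i
    exact EReal.coe_lt_coe_iff.mp (lt_of_le_of_lt (le_sSup (Set.mem_image_of_mem _ (Set.mem_range_self i))) h)
  · intro h
    rcases isEmpty_or_nonempty (Fin m) with hm | hm
    · rw [Set.range_eq_empty, Set.image_empty, sSup_empty]
      exact EReal.bot_lt_coe k
    · obtain ⟨i, hi⟩ := Finite.exists_max lam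
      refine lt_of_le_of_lt (sSup_le ?_) (EReal.coe_lt_coe_iff.mpr (h i))
      rintro _ ⟨_, ⟨j, rfl⟩, rfl⟩
      exact EReal.coe_le_coe_iff.mpr (hi j)

variable {n : ℕ}

/-- The stability types of the quadratic form `A ↦ ⟨A, (k - L) A⟩` in terms of the spectrum
of `L`. -/
theorem stability_of_spectrum (V : Submodule ℝ (Matrix (Fin n) (Fin n) ℝ)) (L : V →ₗ[ℝ] V)
    (hL : ∀ A B : V, frob (L A : Matrix (Fin n) (Fin n) ℝ) B = frob A (L B : Matrix (Fin n) (Fin n) ℝ))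
    (k : ℝ) (spec : Set ℝ) (hspec : spec = {c | ∃ A : V, A ≠ 0 ∧ L A = c • A})
    (q : V → V → ℝ)
    (hq : ∀ A B, q A B = (1 / 2) * frob A ((k • B - L B : V) : Matrix (Fin n) (Fin n) ℝ)) :
    ((∃ A : V, A ≠ 0) → (∃ c, IsLeast spec c) ∧ (∃ c, IsGreatest spec c)) ∧
    ((∀ A, A ≠ 0 → q A A < 0) ↔ (k : EReal) < sInf ((fun c : ℝ ↦ (c : EReal)) '' spec)) ∧
    ((∃ A, 0 < q A A) ↔ sInf ((fun c : ℝ ↦ (c : EReal)) '' spec) < (k : EReal)) ∧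
    ((∀ A, (∀ B, q A B = 0) → A = 0) ↔ ∀ A, L A = k • A → A = 0) ∧
    ((∀ A, L A = k • A → A = 0) ↔ k ∉ spec) ∧
    (((∀ A, q A A ≤ 0) ∧ ¬ (∀ A, (∀ B, q A B = 0) → A = 0)) ↔
      sInf ((fun c : ℝ ↦ (c : EReal)) '' spec) = (k : EReal)) ∧
    ((∀ A, A ≠ 0 → 0 < q A A) ↔ sSup ((fun c : ℝ ↦ (c : EReal)) '' spec) < (k : EReal)) := by
  obtain ⟨m, v, lam, hv0, hv, hspan, hon⟩ := exists_eigenbasis V L hL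
  have hLs : ∀ a : Fin m → ℝ, L (∑ i, a i • v i) = ∑ i, (lam i * a i) • v i := by
    intro a
    rw [map_sum]
    exact Finset.sum_congr rfl fun i _ ↦ by rw [map_smul, hv, smul_smul, mul_comm]
  have hfr : ∀ a b : Fin m → ℝ, frob ((∑ i, a i • v i : V) : Matrix (Fin n) (Fin n) ℝ)
      ((∑ i, b i • v i : V) : Matrix (Fin n) (Fin n) ℝ) = ∑ i, a i * b i := by
    intro a b
    have h1 : ∀ (w : Matrix (Fin n) (Fin n) ℝ) (a : Fin m → ℝ),
        frob ((∑ i, a i • v i : V) : Matrix (Fin n) (Fin n) ℝ) w = ∑ i, a i * frob (v i) w := by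
      intro w a
      let f : V →ₗ[ℝ] ℝ := ⟨⟨fun A ↦ frob (A : Matrix (Fin n) (Fin n) ℝ) w,
        fun _ _ ↦ frob_add_left _ _ _⟩, fun _ _ ↦ frob_smul_left _ _ _⟩
      have := map_sum f (fun i ↦ a i • v i) Finset.univ
      simp only [map_smul, smul_eq_mul] at this
      exact this
    rw [h1]
    refine Finset.sum_congr rfl fun i _ ↦ ?_
    rw [frob_comm, h1]
    simp [hon]
  -- In the eigenbasis `q` is diagonal with entries `(k - lam i) / 2`; every claim below is read off
  -- from their signs.
  have hqs : ∀ a b : Fin m → ℝ, q (∑ i, a i • v i) (∑ i, b i • v i)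
      = (1 / 2) * ∑ i, (k - lam i) * (a i * b i) := by
    intro a b
    have : k • (∑ i, b i • v i) - L (∑ i, b i • v i) = ∑ i, ((k - lam i) * b i) • v i := by
      rw [hLs, Finset.smul_sum, ← Finset.sum_sub_distrib]
      exact Finset.sum_congr rfl fun i _ ↦ by rw [smul_smul, ← sub_smul, sub_mul]
    rw [hq, this, hfr]
    congr 1
    exact Finset.sum_congr rfl fun i _ ↦ by ring
  have hv1 : ∀ i, v i = ∑ j, (Pi.single i (1 : ℝ) : Fin m → ℝ) j • v j := by
    intro i
    simp [Pi.single_apply]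
  have hqv : ∀ i, q (v i) (v i) = (1 / 2) * (k - lam i) := by
    intro i
    rw [hv1 i, hqs]
    simp [Pi.single_apply]
  have hne : ∀ a : Fin m → ℝ, ∑ i, a i • v i ≠ 0 → ∃ i, a i ≠ 0 := by
    intro a ha
    by_contra! h
    exact ha (Finset.sum_eq_zero fun i _ ↦ by rw [h i, zero_smul])
  have hrange : spec = Set.range lam := by
    rw [hspec]
    ext c
    constructor
    · rintro ⟨A, hA, hLA⟩
      obtain ⟨a, rfl⟩ := hspan A
      obtain ⟨i, hi⟩ := hne a hA
      refine ⟨i, ?_⟩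
      -- Pairing the eigenvalue equation with `v i`, where `a i ≠ 0`, isolates one coefficient.
      have h1 := hfr (fun i ↦ lam i * a i) (Pi.single i 1)
      rw [← hLs, hLA, Submodule.coe_smul, frob_smul_left, hfr] at h1
      simp only [Pi.single_apply, mul_ite, mul_one, mul_zero, Finset.sum_ite_eq', Finset.mem_univ,
        if_true] at h1
      exact (mul_right_cancel₀ hi h1).symm
    · rintro ⟨i, rfl⟩
      exact ⟨v i, hv0 i, hv i⟩
  have hker : (∀ A, L A = k • A → A = 0) ↔ k ∉ spec := by
    rw [hspec]
    constructor
    · rintro h ⟨A, hA, hLA⟩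
      exact hA (h A hLA)
    · intro h A hA
      by_contra h0
      exact h ⟨A, h0, hA⟩
  have hnd : (∀ A, (∀ B, q A B = 0) → A = 0) ↔ ∀ A, L A = k • A → A = 0 := by
    have : ∀ A, (∀ B, q A B = 0) ↔ L A = k • A := by
      intro A
      have hsw : ∀ B, q A B = (1 / 2) * frob ((k • A - L A : V) : Matrix (Fin n) (Fin n) ℝ) B := by
        intro B
        rw [hq]
        simp only [Submodule.coe_sub, Submodule.coe_smul, frob_sub_left, frob_sub_right,
          frob_smul_left, frob_smul_right, hL]
      constructor
      · intro h
        -- Self-adjointness moves `k - L` to `A`; testing against `(k - L) A` itself shows that it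
        -- is zero.
        have h1 := h (k • A - L A)
        rw [hsw] at h1
        have h2 := eq_zero_of_frob_self (by linarith : frob ((k • A - L A : V) : Matrix (Fin n) (Fin n) ℝ)
          ((k • A - L A : V) : Matrix (Fin n) (Fin n) ℝ) = 0)
        have h3 : k • A - L A = 0 := Subtype.ext h2
        exact (sub_eq_zero.mp h3).symm
      · intro h B
        rw [hsw, h, sub_self]
        simp [frob]
    simp only [this]
  have hstab : (∀ A, A ≠ 0 → q A A < 0) ↔ ∀ i, k < lam i := by
    constructor
    · intro h i
      have := h _ (hv0 i)
      rw [hqv] at this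
      linarith
    · intro h A hA
      obtain ⟨a, rfl⟩ := hspan A
      obtain ⟨i, hi⟩ := hne a hA
      rw [hqs]
      have : ∑ i, (k - lam i) * (a i * a i) < 0 := by
        refine Finset.sum_neg' (fun j _ ↦ ?_) ⟨i, Finset.mem_univ i, ?_⟩
        · exact mul_nonpos_of_nonpos_of_nonneg (sub_nonpos.mpr (h j).le) (mul_self_nonneg _)
        · exact mul_neg_of_neg_of_pos (sub_neg.mpr (h i)) (mul_self_pos.mpr hi)
      linarith
  have hstr : (∀ A, A ≠ 0 → 0 < q A A) ↔ ∀ i, lam i < k := by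
    constructor
    · intro h i
      have := h _ (hv0 i)
      rw [hqv] at this
      linarith
    · intro h A hA
      obtain ⟨a, rfl⟩ := hspan A
      obtain ⟨i, hi⟩ := hne a hA
      rw [hqs]
      have : 0 < ∑ i, (k - lam i) * (a i * a i) := by
        refine Finset.sum_pos' (fun j _ ↦ ?_) ⟨i, Finset.mem_univ i, ?_⟩
        · exact mul_nonneg (sub_nonneg.mpr (h j).le) (mul_self_nonneg _)
        · exact mul_pos (sub_pos.mpr (h i)) (mul_self_pos.mpr hi)
      linarith
  have hnonpos : (∀ A, q A A ≤ 0) ↔ ∀ i, k ≤ lam i := by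
    constructor
    · intro h i
      have := h (v i)
      rw [hqv] at this
      linarith
    · intro h A
      obtain ⟨a, rfl⟩ := hspan A
      rw [hqs]
      have : ∑ i, (k - lam i) * (a i * a i) ≤ 0 := Finset.sum_nonpos fun j _ ↦
        mul_nonpos_of_nonpos_of_nonneg (sub_nonpos.mpr (h j)) (mul_self_nonneg _)
      linarith
  refine ⟨?_, ?_, ?_, hnd, hker, ?_, ?_⟩
  · rintro ⟨A, hA⟩
    obtain ⟨a, rfl⟩ := hspan A
    obtain ⟨i, -⟩ := hne a hA
    have : Nonempty (Fin m) := ⟨i⟩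
    rw [hrange]
    obtain ⟨i₀, h₀⟩ := Finite.exists_min lam
    obtain ⟨i₁, h₁⟩ := Finite.exists_max lam
    refine ⟨⟨lam i₀, ⟨i₀, rfl⟩, ?_⟩, ⟨lam i₁, ⟨i₁, rfl⟩, ?_⟩⟩
    · rintro _ ⟨j, rfl⟩
      exact h₀ j
    · rintro _ ⟨j, rfl⟩
      exact h₁ j
  · rw [hstab, hrange, coe_lt_sInf_range]
  · rw [hrange, sInf_range_lt_coe, ← not_iff_not]
    push Not
    exact hnonpos
  · rw [hnonpos, hnd, hker, hrange, sInf_range_eq_coe, not_not]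
    rfl
  · rw [hstr, hrange, sSup_range_lt_coe]

end Stability

/-! ### Local group actions: fundamental fields are Killing. -/

section LocalAction

variable {E : Type*} [NormedAddCommGroup E] [NormedSpace ℝ E]
  {F : Type*} [NormedAddCommGroup F] [NormedSpace ℝ F]

/-- A local group law `k` near `e` and a local action `m` of it near `y₀`. -/
structure IsLocalAction (k : E × E → E) (m : E × F → F) (e : E) (y₀ : F) : Prop where
  contDiffAt_mul : ContDiffAt ℝ 3 k (e, e)
  contDiffAt_act : ContDiffAt ℝ 3 m (e, y₀)
  one_mul : ∀ᶠ a in 𝓝 e, k (e, a) = a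
  mul_one : ∀ᶠ a in 𝓝 e, k (a, e) = a
  one_act : ∀ᶠ y in 𝓝 y₀, m (e, y) = y
  assoc : ∀ᶠ q : (E × E) × F in 𝓝 ((e, e), y₀), m (k q.1, q.2) = m (q.1.1, m (q.1.2, q.2))

/-- The fundamental vector fields of a local action. -/
def fundField (m : E × F → F) (e : E) (y : F) : E →L[ℝ] F :=
  (fderiv ℝ m (e, y)).comp (ContinuousLinearMap.inl ℝ E F)

/-- The mixed second derivative of a local group law. -/
def mixedDeriv (k : E × E → E) (e : E) : E →L[ℝ] E →L[ℝ] E :=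
  (fderiv ℝ (fderiv ℝ k) (e, e)).bilinearComp (ContinuousLinearMap.inl ℝ E E)
    (ContinuousLinearMap.inr ℝ E E)

/-- The Lie bracket of a local group law. -/
def localBracket (k : E × E → E) (e : E) : E →L[ℝ] E →L[ℝ] E :=
  mixedDeriv k e - (mixedDeriv k e).flip

lemma localBracket_apply (k : E × E → E) (e X Y : E) : localBracket k e X Y
    = fderiv ℝ (fderiv ℝ k) (e, e) (X, 0) (0, Y) - fderiv ℝ (fderiv ℝ k) (e, e) (Y, 0) (0, X) := rfl

lemma localBracket_antisymm (k : E × E → E) (e X Y : E) :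
    localBracket k e X Y = - localBracket k e Y X := by
  rw [localBracket_apply, localBracket_apply, neg_sub]

lemma fundField_apply (m : E × F → F) (e : E) (y : F) (X : E) :
    fundField m e y X = fderiv ℝ m (e, y) (X, 0) := rfl

lemma hasFDerivAt_pair_left (a : E) (y : F) :
    HasFDerivAt (fun a : E ↦ (a, y)) (ContinuousLinearMap.inl ℝ E F) a :=
  (hasFDerivAt_id a).prodMk (hasFDerivAt_const y a)

lemma hasFDerivAt_pair_right (a : E) (y : F) :
    HasFDerivAt (fun y : F ↦ (a, y)) (ContinuousLinearMap.inr ℝ E F) y :=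
  (hasFDerivAt_const a y).prodMk (hasFDerivAt_id y)

namespace IsLocalAction

variable {k : E × E → E} {m : E × F → F} {e : E} {y₀ : F} (h : IsLocalAction k m e y₀)
include h

lemma differentiableAt_act : DifferentiableAt ℝ m (e, y₀) :=
  h.contDiffAt_act.differentiableAt (by simp)

lemma differentiableAt_fderiv_act : DifferentiableAt ℝ (fderiv ℝ m) (e, y₀) :=
  (h.contDiffAt_act.fderiv_right (m := 1) (by norm_num)).differentiableAt (by simp)

lemma differentiableAt_fderiv_mul : DifferentiableAt ℝ (fderiv ℝ k) (e, e) :=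
  (h.contDiffAt_mul.fderiv_right (m := 1) (by norm_num)).differentiableAt (by simp)

lemma fderiv_act_symm (p q : E × F) :
    fderiv ℝ (fderiv ℝ m) (e, y₀) p q = fderiv ℝ (fderiv ℝ m) (e, y₀) q p :=
  ((h.contDiffAt_act.of_le (n := 3) (m := 2) (by norm_num)).isSymmSndFDerivAt (by simp)).eq _ _

lemma one_act_self : m (e, y₀) = y₀ := h.one_act.self_of_nhds

lemma fderiv_act_right (u : F) : fderiv ℝ m (e, y₀) (0, u) = u := by
  have h1 := h.differentiableAt_act.hasFDerivAt.comp y₀ (hasFDerivAt_pair_right e y₀)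
  have h2 := (hasFDerivAt_id (𝕜 := ℝ) y₀).congr_of_eventuallyEq (f₁ := m ∘ fun y ↦ (e, y)) h.one_act
  exact congrArg (fun l : F →L[ℝ] F ↦ l u) (h1.unique h2)

lemma fderiv_mul_right (u : E) : fderiv ℝ k (e, e) (0, u) = u := by
  have h1 := (h.contDiffAt_mul.differentiableAt (by simp)).hasFDerivAt.comp e
    (hasFDerivAt_pair_right e e)
  have h2 := (hasFDerivAt_id (𝕜 := ℝ) e).congr_of_eventuallyEq (f₁ := k ∘ fun y ↦ (e, y)) h.one_mul
  exact congrArg (fun l : E →L[ℝ] E ↦ l u) (h1.unique h2)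

lemma fderiv_mul_left (u : E) : fderiv ℝ k (e, e) (u, 0) = u := by
  have h1 := HasFDerivAt.comp (f := fun a : E ↦ (a, e)) e
    (h.contDiffAt_mul.differentiableAt (by simp)).hasFDerivAt (hasFDerivAt_pair_left e e)
  have h2 := (hasFDerivAt_id (𝕜 := ℝ) e).congr_of_eventuallyEq (f₁ := k ∘ fun y ↦ (y, e)) h.mul_one
  exact congrArg (fun l : E →L[ℝ] E ↦ l u) (h1.unique h2)

lemma tendsto_left : Tendsto (fun a : E ↦ (a, y₀)) (𝓝 e) (𝓝 (e, y₀)) :=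
  (hasFDerivAt_pair_left e y₀).continuousAt

/-- The conditions are open in the base point, so an identity proved at `y₀` for all local actions
holds at all nearby points. `IsKillingFamily` needs it in that form. -/
lemma eventually_at : ∀ᶠ y in 𝓝 y₀, IsLocalAction k m e y := by
  have t1 : Tendsto (fun y : F ↦ (e, y)) (𝓝 y₀) (𝓝 (e, y₀)) :=
    (hasFDerivAt_pair_right (E := E) e y₀).continuousAt
  have t2 : Tendsto (fun y : F ↦ ((e, e), y)) (𝓝 y₀) (𝓝 ((e, e), y₀)) :=
    (hasFDerivAt_pair_right (E := E × E) (e, e) y₀).continuousAt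
  filter_upwards [t1.eventually (h.contDiffAt_act.eventually (by simp)),
    h.one_act.eventually_nhds, t2.eventually h.assoc.eventually_nhds] with y h1 h2 h3
  exact ⟨h.contDiffAt_mul, h1, h.one_mul, h.mul_one, h2, h3⟩

lemma hasFDerivAt_fundField : HasFDerivAt (fundField m e)
    (((ContinuousLinearMap.compL ℝ E (E × F) F).flip (ContinuousLinearMap.inl ℝ E F)).comp
      ((fderiv ℝ (fderiv ℝ m) (e, y₀)).comp (ContinuousLinearMap.inr ℝ E F))) y₀ := by
  have h1 := h.differentiableAt_fderiv_act.hasFDerivAt.comp y₀ (hasFDerivAt_pair_right e y₀)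
  exact ((ContinuousLinearMap.compL ℝ E (E × F) F).flip
    (ContinuousLinearMap.inl ℝ E F)).hasFDerivAt.comp y₀ h1

lemma fderiv_fundField (u : F) (X : E) :
    fderiv ℝ (fundField m e) y₀ u X = fderiv ℝ (fderiv ℝ m) (e, y₀) (0, u) (X, 0) := by
  rw [h.hasFDerivAt_fundField.fderiv]
  rfl

lemma contDiffAt_fundField : ContDiffAt ℝ 2 (fundField m e) y₀ := by
  have h1 : ContDiffAt ℝ 2 (fderiv ℝ m) (e, y₀) :=
    h.contDiffAt_act.fderiv_right (m := 2) (by norm_num)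
  have h2 : ContDiffAt ℝ 2 (fun y : F ↦ fderiv ℝ m (e, y)) y₀ :=
    h1.comp y₀ (contDiffAt_const.prodMk contDiffAt_id)
  exact ((ContinuousLinearMap.compL ℝ E (E × F) F).flip
    (ContinuousLinearMap.inl ℝ E F)).contDiff.contDiffAt.comp y₀ h2

/-- Left-invariant fields on the group are mapped by the orbit map to the translates. -/
lemma fderiv_act_mul (Y : E) : ∀ᶠ a in 𝓝 e,
    fderiv ℝ m (a, y₀) (fderiv ℝ k (a, e) (0, Y), 0)
      = fderiv ℝ m (a, y₀) (0, fundField m e y₀ Y) := by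
  have t1 : Tendsto (fun a : E ↦ ((a, e), y₀)) (𝓝 e) (𝓝 ((e, e), y₀)) := by
    have : ContinuousAt (fun a : E ↦ ((a, e), y₀)) e := by fun_prop
    exact this
  have t2 : Tendsto (fun a : E ↦ (a, e)) (𝓝 e) (𝓝 (e, e)) :=
    (hasFDerivAt_pair_left e e).continuousAt
  filter_upwards [t1.eventually h.assoc.eventually_nhds, h.mul_one,
    t2.eventually (h.contDiffAt_mul.eventually (by simp)),
    h.tendsto_left.eventually (h.contDiffAt_act.eventually (by simp))] with a ha hk hdk hdm
  have t3 : Tendsto (fun b : E ↦ ((a, b), y₀)) (𝓝 e) (𝓝 ((a, e), y₀)) := by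
    have : ContinuousAt (fun b : E ↦ ((a, b), y₀)) e := by fun_prop
    exact this
  have hm := (hdm.differentiableAt (by simp)).hasFDerivAt
  have h1 : HasFDerivAt (fun b ↦ m (k (a, b), y₀)) ((fderiv ℝ m (a, y₀)).comp
      (((fderiv ℝ k (a, e)).comp (ContinuousLinearMap.inr ℝ E E)).prod (0 : E →L[ℝ] F))) e := by
    have i1 := ((hdk.differentiableAt (by simp)).hasFDerivAt.comp e
      (hasFDerivAt_pair_right a e)).prodMk (hasFDerivAt_const y₀ e)
    refine HasFDerivAt.comp (f := fun b ↦ (k (a, b), y₀)) (g := m) e ?_ i1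
    simpa only [hk] using hm
  have h2 : HasFDerivAt (fun b ↦ m (a, m (b, y₀))) ((fderiv ℝ m (a, y₀)).comp
      ((0 : E →L[ℝ] E).prod ((fderiv ℝ m (e, y₀)).comp (ContinuousLinearMap.inl ℝ E F)))) e := by
    have i1 := (hasFDerivAt_const a e).prodMk
      (h.differentiableAt_act.hasFDerivAt.comp e (hasFDerivAt_pair_left e y₀))
    refine HasFDerivAt.comp (f := fun b ↦ (a, m (b, y₀))) (g := m) e ?_ i1
    simpa only [h.one_act_self] using hm
  -- Associativity `(a b) y₀ = a (b y₀)`, to be differentiated in `b` at `e`.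
  have h3 : (fun b ↦ m (k (a, b), y₀)) =ᶠ[𝓝 e] fun b ↦ m (a, m (b, y₀)) := t3.eventually ha
  exact DFunLike.congr_fun ((h1.congr_of_eventuallyEq h3.symm).unique h2) Y

/-- The derivative of `fderiv_act_mul` in `a` at `e` along `X`. After antisymmetrization in `X, Y`
the second derivative of `m` drops out and the bracket of fields remains. -/
lemma fundField_mixedDeriv (X Y : E) :
    fderiv ℝ (fderiv ℝ m) (e, y₀) (X, 0) (Y, 0) + fundField m e y₀ (mixedDeriv k e X Y)
      = fderiv ℝ (fundField m e) y₀ (fundField m e y₀ Y) X := by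
  have hD := h.differentiableAt_fderiv_act.hasFDerivAt.comp e (hasFDerivAt_pair_left e y₀)
  have hK := (HasFDerivAt.comp (f := fun a : E ↦ (a, e)) e
    h.differentiableAt_fderiv_mul.hasFDerivAt (hasFDerivAt_pair_left e e)).clm_apply (hasFDerivAt_const ((0 : E), Y) e)
  have h1 := hD.clm_apply (hK.prodMk (hasFDerivAt_const (0 : F) e))
  have h2 := hD.clm_apply (hasFDerivAt_const ((0 : E), fundField m e y₀ Y) e)
  have h3 := DFunLike.congr_fun
    ((h1.congr_of_eventuallyEq ((h.fderiv_act_mul Y).mono fun _ ↦ Eq.symm)).unique h2) X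
  rw [h.fderiv_fundField, h.fderiv_act_symm (0, fundField m e y₀ Y)]
  have hkY := h.fderiv_mul_right Y
  simp [hkY] at h3
  rw [← h3, add_comm]
  rfl

/-- The bracket of fundamental vector fields. -/
lemma bracket_fundField (X Y : E) :
    fderiv ℝ (fundField m e) y₀ (fundField m e y₀ X) Y
      - fderiv ℝ (fundField m e) y₀ (fundField m e y₀ Y) X
    = - fundField m e y₀ (localBracket k e X Y) := by
  have h1 := h.fundField_mixedDeriv X Y
  have h2 := h.fundField_mixedDeriv Y X
  rw [← h1, ← h2, h.fderiv_act_symm (X, 0) (Y, 0), localBracket]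
  simp only [_root_.sub_apply, ContinuousLinearMap.flip_apply, map_sub]
  abel

/-- Fundamental fields preserve an invariant form. -/
lemma killing_fundField {γ : F → F →L[ℝ] F →L[ℝ] ℝ} (hγ : DifferentiableAt ℝ γ y₀)
    (hinv : ∀ᶠ a in 𝓝 e, ∀ u v, γ (m (a, y₀)) (fderiv ℝ m (a, y₀) (0, u))
      (fderiv ℝ m (a, y₀) (0, v)) = γ y₀ u v) (X : E) (u v : F) :
    fderiv ℝ γ y₀ (fundField m e y₀ X) u v + γ y₀ (fderiv ℝ (fundField m e) y₀ u X) v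
      + γ y₀ u (fderiv ℝ (fundField m e) y₀ v X) = 0 := by
  have hm := h.differentiableAt_act.hasFDerivAt.comp e (hasFDerivAt_pair_left e y₀)
  have hD := h.differentiableAt_fderiv_act.hasFDerivAt.comp e (hasFDerivAt_pair_left e y₀)
  have hγ' : HasFDerivAt γ (fderiv ℝ γ y₀) ((m ∘ fun a ↦ (a, y₀)) e) := by
    simpa only [Function.comp_apply, h.one_act_self] using hγ.hasFDerivAt
  have h1 := ((hγ'.comp e hm).clm_apply (hD.clm_apply (hasFDerivAt_const ((0 : E), u) e))).clm_apply
    (hD.clm_apply (hasFDerivAt_const ((0 : E), v) e))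
  -- Invariance makes the pulled back form constant in `a`; the vanishing of its derivative along
  -- `X` is the Killing equation.
  have h2 := (hasFDerivAt_const (𝕜 := ℝ) (γ y₀ u v) e).congr_of_eventuallyEq
    (hinv.mono fun a ha ↦ ha u v)
  have h3 := DFunLike.congr_fun (h1.unique h2) X
  have hu := h.fderiv_act_right
  have h0 := h.one_act_self
  rw [h.fderiv_fundField, h.fderiv_fundField, h.fderiv_act_symm (0, u), h.fderiv_act_symm (0, v)]
  simp [hu, h0] at h3
  rw [← h3, fundField_apply]
  ring

/-- The fundamental fields of a local isometric action. -/
theorem isKillingFamily {γ : F → F →L[ℝ] F →L[ℝ] ℝ} (hγ : ContDiffAt ℝ 2 γ y₀)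
    (hsymm : ∀ᶠ y in 𝓝 y₀, ∀ u v, γ y u v = γ y v u) (hi : (γ y₀).IsInvertible)
    (hinv : ∀ᶠ q in 𝓝 (e, y₀), ∀ u v, γ (m q) (fderiv ℝ m q (0, u)) (fderiv ℝ m q (0, v))
      = γ q.2 u v) :
    IsKillingFamily γ (fundField m e) (localBracket k e) y₀ where
  contDiffAt_metric := hγ
  contDiffAt_field := h.contDiffAt_fundField
  symm := hsymm
  isInvertible := hi
  killing := by
    have t1 : Tendsto (fun y : F ↦ (e, y)) (𝓝 y₀) (𝓝 (e, y₀)) :=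
      (hasFDerivAt_pair_right (E := E) e y₀).continuousAt
    filter_upwards [h.eventually_at, hγ.eventually (by simp),
      t1.eventually hinv.eventually_nhds] with y hy hγy hiy X u v
    exact hy.killing_fundField (hγy.differentiableAt (by simp))
      (hy.tendsto_left.eventually hiy) X u v
  bracket := by
    filter_upwards [h.eventually_at] with y hy X Y
    exact hy.bracket_fundField X Y

end IsLocalAction

end LocalAction

/-! ### Tensor fields in a preferred chart. -/

section Charts

variable {F : Type*} [NormedAddCommGroup F] [NormedSpace ℝ F]
  {M : Type*} [TopologicalSpace M] [ChartedSpace F M] [IsManifold 𝓘(ℝ, F) ∞ M]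

instance isManifold_one : IsManifold 𝓘(ℝ, F) 1 M := IsManifold.of_le (n := ∞) (by simp)

lemma contMDiffAt_extChartAt_symm (x : M) {y : F} (hy : y ∈ (extChartAt 𝓘(ℝ, F) x).target) :
    ContMDiffAt 𝓘(ℝ, F) 𝓘(ℝ, F) ∞ (extChartAt 𝓘(ℝ, F) x).symm y :=
  (contMDiffOn_extChartAt_symm x).contMDiffAt
    ((isOpen_extChartAt_target x).mem_nhds hy)

lemma mfderiv_extChartAt_symm_self (x : M) (u : F) :
    mfderiv 𝓘(ℝ, F) 𝓘(ℝ, F) (extChartAt 𝓘(ℝ, F) x).symm (extChartAt 𝓘(ℝ, F) x x) u = u := by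
  have h := mfderivWithin_range_extChartAt_symm (I := 𝓘(ℝ, F)) (x := x)
  rw [modelWithCornersSelf_coe, Set.range_id, mfderivWithin_univ] at h
  exact DFunLike.congr_fun h u

lemma mfderiv_extChartAt_self_apply (x : M) (u : TangentSpace 𝓘(ℝ, F) x) :
    (mfderiv 𝓘(ℝ, F) 𝓘(ℝ, F) (extChartAt 𝓘(ℝ, F) x) x u : F) = u := by
  have h := mfderiv_extChartAt_self (I := 𝓘(ℝ, F)) (x := x)
  exact DFunLike.congr_fun h u

lemma inChart_apply (T : Tensor2 F M) (x : M) (y u v : F) :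
    inChart T x y u v = T ((extChartAt 𝓘(ℝ, F) x).symm y)
      (mfderiv 𝓘(ℝ, F) 𝓘(ℝ, F) (extChartAt 𝓘(ℝ, F) x).symm y u)
      (mfderiv 𝓘(ℝ, F) 𝓘(ℝ, F) (extChartAt 𝓘(ℝ, F) x).symm y v) := rfl

lemma inChart_self (T : Tensor2 F M) (x : M) (u v : F) :
    inChart T x (extChartAt 𝓘(ℝ, F) x x) u v = T x u v := by
  rw [inChart_apply]
  have h : (extChartAt 𝓘(ℝ, F) x).symm (extChartAt 𝓘(ℝ, F) x x) = x :=
    extChartAt_to_inv x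
  have h1 := mfderiv_extChartAt_symm_self x u
  have h2 := mfderiv_extChartAt_symm_self x v
  -- The vectors live over the image of `x` by the chart and its inverse, a point equal to `x` only
  -- propositionally; generalizing them permits the substitution.
  generalize hu : mfderiv 𝓘(ℝ, F) 𝓘(ℝ, F) (extChartAt 𝓘(ℝ, F) x).symm (extChartAt 𝓘(ℝ, F) x x) u = u' at h1 ⊢
  generalize hv : mfderiv 𝓘(ℝ, F) 𝓘(ℝ, F) (extChartAt 𝓘(ℝ, F) x).symm (extChartAt 𝓘(ℝ, F) x x) v = v' at h2 ⊢
  clear hu hv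
  generalize (extChartAt 𝓘(ℝ, F) x).symm (extChartAt 𝓘(ℝ, F) x x) = x' at *
  subst h
  change u' = u at h1
  change v' = v at h2
  rw [h1, h2]

lemma ricci_eq (T : Tensor2 F M) (x : M) (u v : TangentSpace 𝓘(ℝ, F) x) :
    ricci T x u v = ricciCoord (inChart T x) (extChartAt 𝓘(ℝ, F) x x) u v := by
  have h1 := mfderiv_extChartAt_self_apply x u
  have h2 := mfderiv_extChartAt_self_apply x v
  exact congrArg₂ (ricciCoord (inChart T x) (extChartAt 𝓘(ℝ, F) x x)) h1 h2

lemma linearMapAt_trivial (x₀ x : M) (r : ℝ) :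
    (trivializationAt ℝ (Bundle.Trivial M ℝ) x₀).linearMapAt ℝ x r = r := by
  simp

/-- The inverse trivialization of the tangent bundle at `x₀` is the derivative of the inverse chart,
so bundle coordinates of `T` are its pullback. This reduces smoothness of a section to smoothness of
`inChart`. -/
lemma inCoordinates_eq_inChart (T : Tensor2 F M) (x₀ : M) {y : F}
    (hy : y ∈ (extChartAt 𝓘(ℝ, F) x₀).target) (u v : F) :
    ContinuousLinearMap.inCoordinates F (TangentSpace 𝓘(ℝ, F)) (F →L[ℝ] ℝ)
      (fun x : M ↦ TangentSpace 𝓘(ℝ, F) x →L[ℝ] ℝ) x₀ ((extChartAt 𝓘(ℝ, F) x₀).symm y) x₀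
        ((extChartAt 𝓘(ℝ, F) x₀).symm y) (T ((extChartAt 𝓘(ℝ, F) x₀).symm y)) u v
      = inChart T x₀ y u v := by
  have hx : (extChartAt 𝓘(ℝ, F) x₀).symm y ∈ (chartAt F x₀).source := by
    simpa using (extChartAt 𝓘(ℝ, F) x₀).map_target hy
  have h := inCoordinates_apply_eq₂ (𝕜 := ℝ) (F₁ := F) (F₂ := F) (F₃ := ℝ)
    (E₁ := (TangentSpace 𝓘(ℝ, F) : M → Type _)) (E₂ := (TangentSpace 𝓘(ℝ, F) : M → Type _))
    (E₃ := Bundle.Trivial M ℝ) (x₀ := x₀) (x := (extChartAt 𝓘(ℝ, F) x₀).symm y)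
    (ϕ := T ((extChartAt 𝓘(ℝ, F) x₀).symm y)) (v := u) (w := v)
    (by simpa using hx) (by simpa using hx) (by simp)
  have h3 : ∀ w : F, (trivializationAt F (TangentSpace 𝓘(ℝ, F)) x₀).symm
        ((extChartAt 𝓘(ℝ, F) x₀).symm y) w
      = mfderiv 𝓘(ℝ, F) 𝓘(ℝ, F) (extChartAt 𝓘(ℝ, F) x₀).symm y w := by
    intro w
    have h4 := TangentBundle.symmL_trivializationAt (I := 𝓘(ℝ, F)) hx
    rw [modelWithCornersSelf_coe, Set.range_id, mfderivWithin_univ,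
      (extChartAt 𝓘(ℝ, F) x₀).right_inv hy] at h4
    exact (Trivialization.symmL_apply _ (by simpa using hx) _).symm.trans (DFunLike.congr_fun h4 w)
  refine h.trans ((linearMapAt_trivial x₀ _ _).trans ?_)
  exact congrArg₂ (fun p q ↦ T ((extChartAt 𝓘(ℝ, F) x₀).symm y) p q) (h3 u) (h3 v)

/-- The smoothness of a tensor field at a point, in a chart. -/
lemma contMDiffAt_tensor2_iff (T : Tensor2 F M) (x₀ : M) :
    ContMDiffAt 𝓘(ℝ, F) (𝓘(ℝ, F).prod 𝓘(ℝ, F →L[ℝ] F →L[ℝ] ℝ)) ∞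
      (fun x : M ↦ TotalSpace.mk' (F →L[ℝ] F →L[ℝ] ℝ)
        (E := fun x : M ↦ TangentSpace 𝓘(ℝ, F) x →L[ℝ] TangentSpace 𝓘(ℝ, F) x →L[ℝ] ℝ) x (T x)) x₀
    ↔ ContDiffAt ℝ ∞ (inChart T x₀) (extChartAt 𝓘(ℝ, F) x₀ x₀) := by
  have hev : ∀ᶠ y in 𝓝 (extChartAt 𝓘(ℝ, F) x₀ x₀), y ∈ (extChartAt 𝓘(ℝ, F) x₀).target :=
    extChartAt_target_mem_nhds x₀
  have hev' : ∀ᶠ x in 𝓝 x₀, x ∈ (extChartAt 𝓘(ℝ, F) x₀).source := extChartAt_source_mem_nhds x₀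
  rw [contMDiffAt_hom_bundle]
  constructor
  · rintro ⟨-, h⟩
    rw [← contMDiffAt_iff_contDiffAt]
    have h1 : ContMDiffAt 𝓘(ℝ, F) 𝓘(ℝ, F) ∞ (extChartAt 𝓘(ℝ, F) x₀).symm
        (extChartAt 𝓘(ℝ, F) x₀ x₀) :=
      contMDiffAt_extChartAt_symm x₀ (mem_extChartAt_target x₀)
    refine (ContMDiffAt.comp_of_eq h h1 (extChartAt_to_inv x₀)).congr_of_eventuallyEq ?_
    filter_upwards [hev] with y hy
    ext u v
    exact (inCoordinates_eq_inChart T x₀ hy u v).symm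
  · intro h
    refine ⟨contMDiffAt_id, ?_⟩
    rw [← contMDiffAt_iff_contDiffAt] at h
    refine (h.comp x₀ (contMDiffAt_extChartAt (I := 𝓘(ℝ, F)) (n := ∞))).congr_of_eventuallyEq ?_
    filter_upwards [hev'] with x hx
    ext u v
    have h2 := inCoordinates_eq_inChart T x₀ ((extChartAt 𝓘(ℝ, F) x₀).map_source hx) u v
    rwa [(extChartAt 𝓘(ℝ, F) x₀).left_inv hx] at h2

end Charts

/-! ### The group law and the action in charts. -/

section ChartAction

variable (E : Type*) [NormedAddCommGroup E] [NormedSpace ℝ E]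
  {F : Type*} [NormedAddCommGroup F] [NormedSpace ℝ F]
  (G : Type*) [TopologicalSpace G] [ChartedSpace E G] [Group G]
  {M : Type*} [TopologicalSpace M] [ChartedSpace F M] [MulAction G M]

/-- The action of `G` on `M` in the preferred charts at `1` and `o`. -/
def chartAct (o : M) (q : E × F) : F :=
  extChartAt 𝓘(ℝ, F) o
    ((extChartAt 𝓘(ℝ, E) (1 : G)).symm q.1 • (extChartAt 𝓘(ℝ, F) o).symm q.2)

/-- The multiplication of `G` in the preferred chart at `1`. -/
def chartMul (q : E × E) : E := chartAct (F := E) (M := G) E G 1 q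

variable [LieGroup 𝓘(ℝ, E) ∞ G] [IsManifold 𝓘(ℝ, F) ∞ M] [ContMDiffSMul 𝓘(ℝ, E) 𝓘(ℝ, F) ∞ G M]

instance isManifold_group : IsManifold 𝓘(ℝ, E) ∞ G := inferInstance

lemma contMDiffAt_smul_chart (o : M) : ContMDiffAt 𝓘(ℝ, E × F) 𝓘(ℝ, F) ∞
    (fun q : E × F ↦
      (extChartAt 𝓘(ℝ, E) (1 : G)).symm q.1 • (extChartAt 𝓘(ℝ, F) o).symm q.2)
    (extChartAt 𝓘(ℝ, E) (1 : G) 1, extChartAt 𝓘(ℝ, F) o o) := by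
  have h1 : ContMDiffAt 𝓘(ℝ, E × F) 𝓘(ℝ, E) ∞
      (fun q : E × F ↦ (extChartAt 𝓘(ℝ, E) (1 : G)).symm q.1)
      (extChartAt 𝓘(ℝ, E) (1 : G) 1, extChartAt 𝓘(ℝ, F) o o) :=
    ContMDiffAt.comp (I' := 𝓘(ℝ, E)) _ (contMDiffAt_extChartAt_symm (1 : G) (mem_extChartAt_target 1))
      contDiff_fst.contMDiff.contMDiffAt
  have h2 : ContMDiffAt 𝓘(ℝ, E × F) 𝓘(ℝ, F) ∞
      (fun q : E × F ↦ (extChartAt 𝓘(ℝ, F) o).symm q.2)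
      (extChartAt 𝓘(ℝ, E) (1 : G) 1, extChartAt 𝓘(ℝ, F) o o) :=
    ContMDiffAt.comp (I' := 𝓘(ℝ, F)) _ (contMDiffAt_extChartAt_symm o (mem_extChartAt_target o))
      contDiff_snd.contMDiff.contMDiffAt
  exact h1.smul h2

lemma smul_chart_self (o : M) :
    (extChartAt 𝓘(ℝ, E) (1 : G)).symm (extChartAt 𝓘(ℝ, E) (1 : G) 1) •
      (extChartAt 𝓘(ℝ, F) o).symm (extChartAt 𝓘(ℝ, F) o o) = o := by
  rw [extChartAt_to_inv, extChartAt_to_inv, one_smul]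

lemma chartAct_self (o : M) :
    chartAct E G o (extChartAt 𝓘(ℝ, E) (1 : G) 1, extChartAt 𝓘(ℝ, F) o o)
      = extChartAt 𝓘(ℝ, F) o o :=
  congrArg (extChartAt 𝓘(ℝ, F) o) (smul_chart_self E G o)

lemma contDiffAt_chartAct (o : M) : ContDiffAt ℝ ∞ (chartAct (F := F) E G o)
    (extChartAt 𝓘(ℝ, E) (1 : G) 1, extChartAt 𝓘(ℝ, F) o o) := by
  rw [← contMDiffAt_iff_contDiffAt]
  exact ContMDiffAt.comp_of_eq (contMDiffAt_extChartAt (I := 𝓘(ℝ, F)) (n := ∞) (x := o))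
    (contMDiffAt_smul_chart E G o) (smul_chart_self E G o)

/-- By continuity the image stays in the chart domain near `(1, o)`, so the chart and its inverse
cancel. Global identities of the action become local ones in this way. -/
lemma eventually_symm_chartAct (o : M) :
    ∀ᶠ q : E × F in 𝓝 (extChartAt 𝓘(ℝ, E) (1 : G) 1, extChartAt 𝓘(ℝ, F) o o),
      (extChartAt 𝓘(ℝ, F) o).symm (chartAct E G o q)
        = (extChartAt 𝓘(ℝ, E) (1 : G)).symm q.1 • (extChartAt 𝓘(ℝ, F) o).symm q.2 := by
  have h := (contMDiffAt_smul_chart (F := F) E G o).continuousAt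
  have h2 := h.eventually (p := fun x ↦ x ∈ (extChartAt 𝓘(ℝ, F) o).source) (by
    show _ ∈ 𝓝 ((extChartAt 𝓘(ℝ, E) (1 : G)).symm (extChartAt 𝓘(ℝ, E) (1 : G) 1) •
      (extChartAt 𝓘(ℝ, F) o).symm (extChartAt 𝓘(ℝ, F) o o))
    rw [smul_chart_self]; exact extChartAt_source_mem_nhds o)
  filter_upwards [h2] with q hq
  exact (extChartAt 𝓘(ℝ, F) o).left_inv hq

theorem isLocalAction_chartAct (o : M) :
    IsLocalAction (chartMul E G) (chartAct (F := F) E G o) (extChartAt 𝓘(ℝ, E) (1 : G) 1)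
      (extChartAt 𝓘(ℝ, F) o o) where
  contDiffAt_mul := (contDiffAt_chartAct (F := E) (M := G) E G 1).of_le ENat.LEInfty.out
  contDiffAt_act := (contDiffAt_chartAct E G o).of_le ENat.LEInfty.out
  one_mul := by
    filter_upwards [extChartAt_target_mem_nhds (I := 𝓘(ℝ, E)) (1 : G)] with a ha
    simp only [chartMul, chartAct, extChartAt_to_inv, one_smul]
    exact (extChartAt 𝓘(ℝ, E) (1 : G)).right_inv ha
  mul_one := by
    filter_upwards [extChartAt_target_mem_nhds (I := 𝓘(ℝ, E)) (1 : G)] with a ha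
    simp only [chartMul, chartAct, extChartAt_to_inv, smul_eq_mul, _root_.mul_one]
    exact (extChartAt 𝓘(ℝ, E) (1 : G)).right_inv ha
  one_act := by
    filter_upwards [extChartAt_target_mem_nhds (I := 𝓘(ℝ, F)) o] with a ha
    simp only [chartAct, extChartAt_to_inv, one_smul]
    exact (extChartAt 𝓘(ℝ, F) o).right_inv ha
  assoc := by
    have t1 : Tendsto (fun q : (E × E) × F ↦ q.1)
        (𝓝 ((extChartAt 𝓘(ℝ, E) (1 : G) 1, extChartAt 𝓘(ℝ, E) (1 : G) 1), extChartAt 𝓘(ℝ, F) o o))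
        (𝓝 (extChartAt 𝓘(ℝ, E) (1 : G) 1, extChartAt 𝓘(ℝ, E) (1 : G) 1)) := by
      exact continuous_fst.tendsto _
    have t2 : Tendsto (fun q : (E × E) × F ↦ (q.1.2, q.2))
        (𝓝 ((extChartAt 𝓘(ℝ, E) (1 : G) 1, extChartAt 𝓘(ℝ, E) (1 : G) 1), extChartAt 𝓘(ℝ, F) o o))
        (𝓝 (extChartAt 𝓘(ℝ, E) (1 : G) 1, extChartAt 𝓘(ℝ, F) o o)) := by
      exact ((continuous_snd.comp continuous_fst).prodMk continuous_snd).tendsto _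
    filter_upwards [t1.eventually (eventually_symm_chartAct (F := E) (M := G) E G 1),
      t2.eventually (eventually_symm_chartAct E G o)] with q h1 h2
    have h3 : (extChartAt 𝓘(ℝ, E) (1 : G)).symm (chartMul E G q.1) = _ := h1
    have h4 : (extChartAt 𝓘(ℝ, F) o).symm (chartAct E G o (q.1.2, q.2)) = _ := h2
    simp only [chartAct] at h4 ⊢
    rw [h3, h4, smul_eq_mul, mul_smul]

lemma tensor2_congr (T : Tensor2 F M) {x x' : M} (h : x = x') {u u' v v' : F} (hu : u = u')
    (hv : v = v') : T x u v = T x' u' v' := by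
  subst h hu hv
  rfl

variable {G} in
lemma mdifferentiableAt_const_smul (E : Type*) [NormedAddCommGroup E] [NormedSpace ℝ E]
    [ChartedSpace E G] [ContMDiffSMul 𝓘(ℝ, E) 𝓘(ℝ, F) ∞ G M] (a : G) (x : M) :
    MDifferentiableAt 𝓘(ℝ, F) 𝓘(ℝ, F) (fun y : M ↦ a • y) x := by
  have h : ContMDiffAt 𝓘(ℝ, F) 𝓘(ℝ, F) ∞ (fun y : M ↦ a • y) x :=
    (contMDiffAt_const (I' := 𝓘(ℝ, E)) (c := a)).smul contMDiffAt_id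
  exact h.mdifferentiableAt (by simp)

lemma hasFDerivAt_chartAct_right {o : M} {q : E × F}
    (hq : DifferentiableAt ℝ (chartAct (F := F) E G o) q) :
    HasFDerivAt (fun y ↦ chartAct E G o (q.1, y))
      ((fderiv ℝ (chartAct (F := F) E G o) q).comp (ContinuousLinearMap.inr ℝ E F)) q.2 :=
  HasFDerivAt.comp (f := fun y : F ↦ (q.1, y)) q.2 hq.hasFDerivAt (hasFDerivAt_pair_right q.1 q.2)

/-- The derivative of the action, in charts. -/
lemma eventually_mfderiv_symm_chartAct (o : M) :
    ∀ᶠ q : E × F in 𝓝 (extChartAt 𝓘(ℝ, E) (1 : G) 1, extChartAt 𝓘(ℝ, F) o o), ∀ u : F,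
      (mfderiv 𝓘(ℝ, F) 𝓘(ℝ, F) (extChartAt 𝓘(ℝ, F) o).symm (chartAct E G o q)
        (fderiv ℝ (chartAct (F := F) E G o) q (0, u)) : F)
      = mfderiv 𝓘(ℝ, F) 𝓘(ℝ, F) (fun y : M ↦ (extChartAt 𝓘(ℝ, E) (1 : G)).symm q.1 • y)
        ((extChartAt 𝓘(ℝ, F) o).symm q.2)
        (mfderiv 𝓘(ℝ, F) 𝓘(ℝ, F) (extChartAt 𝓘(ℝ, F) o).symm q.2 u) := by
  have h1 := contDiffAt_chartAct (F := F) E G o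
  have t1 := h1.continuousAt.eventually (p := fun y ↦ y ∈ (extChartAt 𝓘(ℝ, F) o).target) (by
    rw [chartAct_self]; exact extChartAt_target_mem_nhds o)
  have t2 : ∀ᶠ q : E × F in 𝓝 (extChartAt 𝓘(ℝ, E) (1 : G) 1, extChartAt 𝓘(ℝ, F) o o),
      q.2 ∈ (extChartAt 𝓘(ℝ, F) o).target :=
    (continuous_snd.tendsto _).eventually (extChartAt_target_mem_nhds (I := 𝓘(ℝ, F)) o)
  filter_upwards [(eventually_symm_chartAct (F := F) E G o).eventually_nhds, t1, t2,
    (h1.of_le (n := ∞) (m := 1) (by simp)).eventually (by simp)] with q h2 h3 h4 h5 u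
  have d1 := hasFDerivAt_chartAct_right E G (h5.differentiableAt (by simp))
  have d2 : MDifferentiableAt 𝓘(ℝ, F) 𝓘(ℝ, F) (extChartAt 𝓘(ℝ, F) o).symm (chartAct E G o q) :=
    (contMDiffAt_extChartAt_symm o h3).mdifferentiableAt (by simp)
  have d3 : MDifferentiableAt 𝓘(ℝ, F) 𝓘(ℝ, F) (extChartAt 𝓘(ℝ, F) o).symm q.2 :=
    (contMDiffAt_extChartAt_symm o h4).mdifferentiableAt (by simp)
  have e1 := HasMFDerivAt.comp q.2 (I' := 𝓘(ℝ, F)) (f := fun y ↦ chartAct E G o (q.1, y))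
    d2.hasMFDerivAt d1.hasMFDerivAt
  have e2 := HasMFDerivAt.comp q.2 (mdifferentiableAt_const_smul E
    ((extChartAt 𝓘(ℝ, E) (1 : G)).symm q.1) ((extChartAt 𝓘(ℝ, F) o).symm q.2)).hasMFDerivAt
    d3.hasMFDerivAt
  have t3 : Tendsto (fun y : F ↦ (q.1, y)) (𝓝 q.2) (𝓝 q) :=
    (hasFDerivAt_pair_right q.1 q.2).continuousAt
  have e3 := e1.congr_of_eventuallyEq (t3.eventually (h2.mono fun _ ↦ Eq.symm))
  exact DFunLike.congr_fun (hasMFDerivAt_unique e3 e2) u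

lemma eventually_inChart_invariant {T : Tensor2 F M} (hT : IsInvSym G T) (o : M) :
    ∀ᶠ q : E × F in 𝓝 (extChartAt 𝓘(ℝ, E) (1 : G) 1, extChartAt 𝓘(ℝ, F) o o), ∀ u v : F,
      inChart T o (chartAct E G o q) (fderiv ℝ (chartAct E G o) q (0, u))
        (fderiv ℝ (chartAct E G o) q (0, v)) = inChart T o q.2 u v := by
  filter_upwards [eventually_symm_chartAct (F := F) E G o,
    eventually_mfderiv_symm_chartAct (F := F) E G o] with q h1 h2 u v
  rw [inChart_apply, inChart_apply]
  refine (tensor2_congr T h1 (h2 u) (h2 v)).trans ?_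
  exact hT.invariant _ _ _ _

lemma contDiffAt_inChart {T : Tensor2 F M} (hT : IsInvSym G T) (o : M) :
    ContDiffAt ℝ ∞ (inChart T o) (extChartAt 𝓘(ℝ, F) o o) :=
  (contMDiffAt_tensor2_iff T o).1 (hT.smooth o)

lemma isInvertible_of_pos [FiniteDimensional ℝ F] {B : F →L[ℝ] F →L[ℝ] ℝ}
    (h : ∀ u, u ≠ 0 → 0 < B u u) : B.IsInvertible := by
  have hinj : Function.Injective (B : F →ₗ[ℝ] F →L[ℝ] ℝ) := by
    rw [injective_iff_map_eq_zero]
    intro u hu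
    by_contra h0
    have := h u h0
    have h2 : B u = 0 := hu
    simp [h2] at this
  have hfin : Module.finrank ℝ F = Module.finrank ℝ (F →L[ℝ] ℝ) := by
    rw [← (LinearMap.toContinuousLinearMap (𝕜 := ℝ) (E := F) (F' := ℝ)).finrank_eq]
    exact (Subspace.dual_finrank_eq).symm
  exact ⟨(LinearEquiv.ofInjectiveOfFinrankEq (B : F →ₗ[ℝ] F →L[ℝ] ℝ) hinj
    hfin).toContinuousLinearEquiv, by ext; rfl⟩

theorem isKillingFamily_chartAct [FiniteDimensional ℝ F] {h : Tensor2 F M} (hh : IsInvMetric G h)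
    (o : M) :
    IsKillingFamily (inChart h o) (fundField (chartAct (F := F) E G o)
      (extChartAt 𝓘(ℝ, E) (1 : G) 1))
      (localBracket (chartMul E G) (extChartAt 𝓘(ℝ, E) (1 : G) 1)) (extChartAt 𝓘(ℝ, F) o o) :=
  (isLocalAction_chartAct E G o).isKillingFamily
    ((contDiffAt_inChart G hh.toIsInvSym o).of_le ENat.LEInfty.out)
    (.of_forall fun y u v ↦ by rw [inChart_apply, inChart_apply, hh.symm])
    (isInvertible_of_pos fun u hu ↦ by rw [inChart_self]; exact hh.pos o u hu)
    (eventually_inChart_invariant E G hh.toIsInvSym o)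

end ChartAction

/-! ### Derivatives of the adjoint action and of homomorphisms. -/

section LocalAdjoint

variable {E : Type*} [NormedAddCommGroup E] [NormedSpace ℝ E] [CompleteSpace E]

lemma isInvertible_eventually {R : ℝ → E →L[ℝ] E} (hR : ContinuousAt R 0)
    (h0 : R 0 = ContinuousLinearMap.id ℝ E) :
    ∀ᶠ t in 𝓝 0, ∀ v, (R t).inverse (R t v) = v := by
  have h1 := (ContinuousLinearEquiv.refl ℝ E).nhds
  have h2 : Set.range ((↑) : (E ≃L[ℝ] E) → E →L[ℝ] E) ∈ 𝓝 (R 0) := by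
    rw [h0]; exact h1
  filter_upwards [hR h2] with t ht v
  obtain ⟨e, he⟩ := ht
  rw [← he]
  simp

/-- The derivative of the adjoint action is the bracket. -/
lemma IsLocalAction.hasDerivAt_adjoint {k : E × E → E} {e : E} (h : IsLocalAction k k e e)
    {c : ℝ → E} {Z X : E} (hc : HasDerivAt c Z 0) (hc0 : c 0 = e) {A : ℝ → E}
    (hA : ∀ᶠ t in 𝓝 0, fderiv ℝ k (c t, e) (0, X) = fderiv ℝ k (e, c t) (A t, 0)) :
    HasDerivAt A (localBracket k e Z X) 0 := by
  have hD : HasFDerivAt (fderiv ℝ k) (fderiv ℝ (fderiv ℝ k) (e, e)) (e, c 0) := by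
    rw [hc0]; exact h.differentiableAt_fderiv_mul.hasFDerivAt
  have hD' : HasFDerivAt (fderiv ℝ k) (fderiv ℝ (fderiv ℝ k) (e, e)) (c 0, e) := by
    rw [hc0]; exact h.differentiableAt_fderiv_mul.hasFDerivAt
  have hR1 : HasDerivAt (fun t ↦ fderiv ℝ k (e, c t))
      (fderiv ℝ (fderiv ℝ k) (e, e) (0, Z)) 0 :=
    hD.comp_hasDerivAt (f := fun t ↦ (e, c t)) 0 ((hasDerivAt_const 0 e).prodMk hc)
  have hL1 : HasDerivAt (fun t ↦ fderiv ℝ k (c t, e))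
      (fderiv ℝ (fderiv ℝ k) (e, e) (Z, 0)) 0 :=
    hD'.comp_hasDerivAt (f := fun t ↦ (c t, e)) 0 (hc.prodMk (hasDerivAt_const 0 e))
  have hL : HasDerivAt (fun t ↦ fderiv ℝ k (c t, e) (0, X))
      (fderiv ℝ (fderiv ℝ k) (e, e) (Z, 0) (0, X)) 0 := by
    simpa using hL1.clm_apply (hasDerivAt_const 0 ((0 : E), X))
  let Λ := (ContinuousLinearMap.compL ℝ E (E × E) E).flip (ContinuousLinearMap.inl ℝ E E)
  have hR : HasDerivAt (fun t ↦ Λ (fderiv ℝ k (e, c t)))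
      (Λ (fderiv ℝ (fderiv ℝ k) (e, e) (0, Z))) 0 := Λ.hasFDerivAt.comp_hasDerivAt 0 hR1
  have hR0 : Λ (fderiv ℝ k (e, c 0)) = ContinuousLinearMap.id ℝ E := by
    ext v
    rw [hc0]
    exact h.fderiv_mul_left v
  have hinv : DifferentiableAt ℝ (ContinuousLinearMap.inverse : (E →L[ℝ] E) → E →L[ℝ] E)
      (Λ (fderiv ℝ k (e, c 0))) := by
    rw [hR0]
    exact (contDiffAt_map_inverse (n := 1) (ContinuousLinearEquiv.refl ℝ E)).differentiableAt
      (by simp)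
  -- Right translation is invertible near `e`, so `A` is given by differentiable data; its
  -- differentiability is not a hypothesis.
  have hAeq : A =ᶠ[𝓝 0] fun t ↦ (Λ (fderiv ℝ k (e, c t))).inverse (fderiv ℝ k (c t, e) (0, X)) := by
    filter_upwards [hA, isInvertible_eventually hR.continuousAt hR0] with t h1 h2
    rw [h1]
    exact (h2 (A t)).symm
  have hAd : DifferentiableAt ℝ A 0 := by
    have h3 : DifferentiableAt ℝ (fun t ↦ (Λ (fderiv ℝ k (e, c t))).inverse) 0 :=
      DifferentiableAt.comp (f := fun t ↦ Λ (fderiv ℝ k (e, c t))) 0 hinv hR.differentiableAt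
    exact (h3.clm_apply hL.differentiableAt).congr_of_eventuallyEq hAeq
  have hprod := hR.clm_apply hAd.hasDerivAt
  have hL2 := hL.congr_of_eventuallyEq (f₁ := fun t ↦ Λ (fderiv ℝ k (e, c t)) (A t))
    (hA.mono fun t ht ↦ ht.symm)
  -- The right translate of `A t` equals the left translate of `X`. Their derivatives at `0` give
  -- `A' + k''(X, Z) = k''(Z, X)`, with `k''` the mixed second derivative.
  have hder := hprod.unique hL2
  have hA0 : A 0 = X := by
    have h4 := hA.self_of_nhds
    rw [hc0, h.fderiv_mul_left, h.fderiv_mul_right] at h4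
    exact h4.symm
  rw [hR0, hA0] at hder
  have hs : fderiv ℝ (fderiv ℝ k) (e, e) (0, Z) (X, 0)
    = fderiv ℝ (fderiv ℝ k) (e, e) (X, 0) (0, Z) := h.fderiv_act_symm _ _
  have hfin : deriv A 0 = localBracket k e Z X := by
    rw [localBracket_apply, ← hder, ← hs]
    simp [Λ]
  rw [← hfin]
  exact hAd.hasDerivAt

end LocalAdjoint

section LocalHom

variable {E : Type*} [NormedAddCommGroup E] [NormedSpace ℝ E]

/-- A local homomorphism is compatible with the brackets. -/
lemma IsLocalAction.localBracket_map {k : E × E → E} {e : E} (h : IsLocalAction k k e e)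
    {f : E → E} (hf : ContDiffAt ℝ 3 f e) (hfe : f e = e)
    (hhom : ∀ᶠ q : E × E in 𝓝 (e, e), f (k q) = k (f q.1, f q.2)) (X Y : E) :
    fderiv ℝ f e (localBracket k e X Y) = localBracket k e (fderiv ℝ f e X) (fderiv ℝ f e Y) := by
  have hfd : DifferentiableAt ℝ f e := hf.differentiableAt (by simp)
  have hfd2 : HasFDerivAt (fderiv ℝ f) (fderiv ℝ (fderiv ℝ f) e) e :=
    ((hf.fderiv_right (m := 1) (by norm_num)).differentiableAt (by simp)).hasFDerivAt
  -- Differentiate `f (a b) = f a f b` in `b` and then in `a`. The second derivative of `f` is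
  -- symmetric, so it disappears from the bracket.
  have key : ∀ X Y : E, fderiv ℝ (fderiv ℝ f) e X Y + fderiv ℝ f e (mixedDeriv k e X Y)
      = mixedDeriv k e (fderiv ℝ f e X) (fderiv ℝ f e Y) := by
    intro X Y
    have h1 : ∀ᶠ a in 𝓝 e, fderiv ℝ f a (fderiv ℝ k (a, e) (0, Y))
        = fderiv ℝ k (f a, e) (0, fderiv ℝ f e Y) := by
      have hfc : Tendsto f (𝓝 e) (𝓝 e) := by
        simpa only [hfe] using hfd.continuousAt.tendsto
      filter_upwards [h.tendsto_left.eventually hhom.eventually_nhds, h.mul_one,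
        h.tendsto_left.eventually (h.contDiffAt_mul.eventually (by simp)),
        (h.tendsto_left.comp hfc).eventually (h.contDiffAt_mul.eventually (by simp)),
        hf.eventually (by simp)] with a h2 h3 h4 h5 h6
      have t3 : Tendsto (fun b : E ↦ (a, b)) (𝓝 e) (𝓝 (a, e)) :=
        (hasFDerivAt_pair_right a e).continuousAt
      have d1 : HasFDerivAt (fun b ↦ f (k (a, b))) ((fderiv ℝ f a).comp
          ((fderiv ℝ k (a, e)).comp (ContinuousLinearMap.inr ℝ E E))) e := by
        refine HasFDerivAt.comp (f := fun b ↦ k (a, b)) e ?_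
          ((h4.differentiableAt (by simp)).hasFDerivAt.comp e (hasFDerivAt_pair_right a e))
        rw [h3]
        exact (h6.differentiableAt (by simp)).hasFDerivAt
      have d2 : HasFDerivAt (fun b ↦ k (f a, f b)) ((fderiv ℝ k (f a, e)).comp
          ((0 : E →L[ℝ] E).prod (fderiv ℝ f e))) e := by
        refine HasFDerivAt.comp (f := fun b ↦ (f a, f b)) e ?_
          ((hasFDerivAt_const (f a) e).prodMk hfd.hasFDerivAt)
        rw [hfe]
        exact (h5.differentiableAt (by simp)).hasFDerivAt
      have e1 := (d1.congr_of_eventuallyEq ((t3.eventually h2).mono fun _ ↦ Eq.symm)).unique d2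
      exact DFunLike.congr_fun e1 Y
    have hK := HasFDerivAt.comp (f := fun a : E ↦ (a, e)) e
      h.differentiableAt_fderiv_mul.hasFDerivAt (hasFDerivAt_pair_left e e)
    have hK' := HasFDerivAt.comp (f := fun a : E ↦ (f a, e)) e
      (by rw [hfe]; exact h.differentiableAt_fderiv_mul.hasFDerivAt)
      (hfd.hasFDerivAt.prodMk (hasFDerivAt_const e e))
    have e1 := hfd2.clm_apply (hK.clm_apply (hasFDerivAt_const ((0 : E), Y) e))
    have e2 := hK'.clm_apply (hasFDerivAt_const ((0 : E), fderiv ℝ f e Y) e)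
    have e3 := DFunLike.congr_fun
      ((e1.congr_of_eventuallyEq (h1.mono fun _ ↦ Eq.symm)).unique e2) X
    have hY := h.fderiv_mul_right Y
    simp [hY] at e3
    rw [add_comm]
    exact e3
  have hs : fderiv ℝ (fderiv ℝ f) e X Y = fderiv ℝ (fderiv ℝ f) e Y X :=
    ((hf.of_le (n := 3) (m := 2) (by norm_num)).isSymmSndFDerivAt (by simp)).eq _ _
  have h1 := key X Y
  have h2 := key Y X
  simp only [localBracket, _root_.sub_apply, ContinuousLinearMap.flip_apply, map_sub]
  rw [← h1, ← h2, hs]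
  abel

end LocalHom

section Derivatives

variable {E : Type*} [NormedAddCommGroup E] [NormedSpace ℝ E]
  {F : Type*} [NormedAddCommGroup F] [NormedSpace ℝ F]
  {N : Type*} [TopologicalSpace N] [ChartedSpace E N]
  {M : Type*} [TopologicalSpace M] [ChartedSpace F M]

lemma hasFDerivAt_chart {f : N → M} {x : N} {y : M}
    (hf : MDifferentiableAt 𝓘(ℝ, E) 𝓘(ℝ, F) f x) (hy : f x = y) (L : E →L[ℝ] F)
    (hL : mfderiv 𝓘(ℝ, E) 𝓘(ℝ, F) f x = L) :
    HasFDerivAt (fun a ↦ extChartAt 𝓘(ℝ, F) y (f ((extChartAt 𝓘(ℝ, E) x).symm a)))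
      L (extChartAt 𝓘(ℝ, E) x x) := by
  subst hy
  refine hasFDerivWithinAt_univ.1 ?_
  have h := hf.hasMFDerivAt.2
  rw [modelWithCornersSelf_coe, Set.range_id, hL] at h
  exact h

end Derivatives

lemma lieBracketWithin_univ_eq {E : Type*} [NormedAddCommGroup E] [NormedSpace ℝ E]
    {V W V' W' : E → E} {x : E} {A B : E →L[ℝ] E} (hV : ∀ᶠ y in 𝓝 x, V y = V' y)
    (hW : ∀ᶠ y in 𝓝 x, W y = W' y) (dV : HasFDerivAt V' A x) (dW : HasFDerivAt W' B x) :
    VectorField.lieBracketWithin ℝ V W Set.univ x = B (V' x) - A (W' x) := by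
  rw [VectorField.lieBracketWithin_univ]
  change fderiv ℝ W x (V x) - fderiv ℝ V x (W x) = _
  rw [(dV.congr_of_eventuallyEq hV).fderiv, (dW.congr_of_eventuallyEq hW).fderiv,
    hV.self_of_nhds, hW.self_of_nhds]

/-! ### The Lie algebra of `G` and `Ad`, in the chart at `1`. -/

section Group

variable {E : Type*} [NormedAddCommGroup E] [NormedSpace ℝ E]
  {F : Type*} [NormedAddCommGroup F] [NormedSpace ℝ F]
  {G : Type*} [TopologicalSpace G] [ChartedSpace E G] [Group G] [LieGroup 𝓘(ℝ, E) ∞ G]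
  {M : Type*} [TopologicalSpace M] [ChartedSpace F M] [MulAction G M]
  [IsManifold 𝓘(ℝ, F) ∞ M] [ContMDiffSMul 𝓘(ℝ, E) 𝓘(ℝ, F) ∞ G M]

lemma mdifferentiableAt_orbit (o : M) (a : G) :
    MDifferentiableAt 𝓘(ℝ, E) 𝓘(ℝ, F) (fun a : G ↦ a • o) a := by
  have h : ContMDiffAt 𝓘(ℝ, E) 𝓘(ℝ, F) ∞ (fun a : G ↦ a • o) a :=
    contMDiffAt_id.smul (contMDiffAt_const (I' := 𝓘(ℝ, F)) (c := o))
  exact h.mdifferentiableAt (by simp)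

lemma hasFDerivAt_orbit_chart (o : M) (L : E →L[ℝ] F) (hL : orbitDeriv (F := F) E G o = L) :
    HasFDerivAt (fun a : E ↦ chartAct E G o (a, extChartAt 𝓘(ℝ, F) o o))
      L (extChartAt 𝓘(ℝ, E) (1 : G) 1) := by
  have h := hasFDerivAt_chart (mdifferentiableAt_orbit (E := E) (F := F) o (1 : G)) (one_smul G o)
    L hL
  simp only [chartAct, extChartAt_to_inv]
  exact h

lemma fundField_eq_orbitDeriv (o : M) (X : E) :
    fundField (chartAct (F := F) E G o) (extChartAt 𝓘(ℝ, E) (1 : G) 1) (extChartAt 𝓘(ℝ, F) o o) X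
      = orbitDeriv E G o X := by
  have h1 := (isLocalAction_chartAct (F := F) E G o).differentiableAt_act.hasFDerivAt.comp
    (f := fun a : E ↦ (a, extChartAt 𝓘(ℝ, F) o o))
    (extChartAt 𝓘(ℝ, E) (1 : G) 1) (hasFDerivAt_pair_left _ _)
  exact DFunLike.congr_fun (h1.unique (hasFDerivAt_orbit_chart o _ rfl)) X

lemma chartMul_one_eventually : ∀ᶠ y in 𝓝 (extChartAt 𝓘(ℝ, E) (1 : G) 1),
    chartMul E G (y, extChartAt 𝓘(ℝ, E) (1 : G) 1) = y :=
  (isLocalAction_chartAct (F := E) (M := G) E G 1).mul_one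

lemma isLocalAction_chartMul : IsLocalAction (chartMul E G) (chartMul E G)
    (extChartAt 𝓘(ℝ, E) (1 : G) 1) (extChartAt 𝓘(ℝ, E) (1 : G) 1) :=
  isLocalAction_chartAct (F := E) (M := G) E G 1

lemma tendsto_pair_left (e : E) (y : F) : Tendsto (fun a : E ↦ (a, y)) (𝓝 e) (𝓝 (e, y)) :=
  (hasFDerivAt_pair_left e y).continuousAt

/-- Left-invariant vector fields in a chart. -/
lemma mpullback_mulInvariantVectorField_chart (X : E) :
    ∀ᶠ y in 𝓝 (extChartAt 𝓘(ℝ, E) (1 : G) 1),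
      (VectorField.mpullbackWithin 𝓘(ℝ, E) 𝓘(ℝ, E) (extChartAt 𝓘(ℝ, E) (1 : G)).symm
        (mulInvariantVectorField (I := 𝓘(ℝ, E)) (G := G) X) Set.univ y : E)
      = fderiv ℝ (chartMul E G) (y, extChartAt 𝓘(ℝ, E) (1 : G) 1) (0, X) := by
  filter_upwards [chartMul_one_eventually (E := E) (G := G),
    extChartAt_target_mem_nhds (I := 𝓘(ℝ, E)) (1 : G),
    (tendsto_pair_left _ _).eventually
      (eventually_mfderiv_symm_chartAct (F := E) (M := G) E G 1)] with y h1 h2 h3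
  have h4 := h3 X
  rw [show chartAct (F := E) (M := G) E G 1 (y, extChartAt 𝓘(ℝ, E) (1 : G) 1) = y from h1] at h4
  rw [VectorField.mpullbackWithin_apply, mfderivWithin_univ]
  have hinv : (mfderiv 𝓘(ℝ, E) 𝓘(ℝ, E) (extChartAt 𝓘(ℝ, E) (1 : G)).symm y).IsInvertible := by
    have := isInvertible_mfderivWithin_extChartAt_symm (I := 𝓘(ℝ, E)) h2
    rwa [modelWithCornersSelf_coe, Set.range_id, mfderivWithin_univ] at this
  refine hinv.inverse_apply_eq.2 (Eq.trans ?_ h4.symm)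
  have h5 := mfderiv_extChartAt_symm_self (1 : G) X
  have h6 : ∀ (z : G) (X' : E), z = 1 → X' = X →
      (mfderiv 𝓘(ℝ, E) 𝓘(ℝ, E) (fun g : G ↦ (extChartAt 𝓘(ℝ, E) (1 : G)).symm y • g) z X' : E)
      = mulInvariantVectorField (I := 𝓘(ℝ, E)) (G := G) X ((extChartAt 𝓘(ℝ, E) (1 : G)).symm y) := by
    intro z X' hz hX
    subst hz hX
    rfl
  exact (h6 _ _ (extChartAt_to_inv (I := 𝓘(ℝ, E)) (1 : G)) h5).symm

lemma inverse_mfderiv_extChartAt_self (x : M) (w : F) :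
    ((mfderiv 𝓘(ℝ, F) 𝓘(ℝ, F) (extChartAt 𝓘(ℝ, F) x) x).inverse w : F) = w := by
  rw [mfderiv_extChartAt_self]
  exact congrArg (fun l : F →L[ℝ] F ↦ l w) ContinuousLinearMap.inverse_id

lemma lieBracketWithin_left_invariant {X Y : E} {V W : E → E}
    (hV : ∀ᶠ y in 𝓝 (extChartAt 𝓘(ℝ, E) (1 : G) 1),
      V y = fderiv ℝ (chartMul E G) (y, extChartAt 𝓘(ℝ, E) (1 : G) 1) (0, X))
    (hW : ∀ᶠ y in 𝓝 (extChartAt 𝓘(ℝ, E) (1 : G) 1),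
      W y = fderiv ℝ (chartMul E G) (y, extChartAt 𝓘(ℝ, E) (1 : G) 1) (0, Y)) :
    VectorField.lieBracketWithin ℝ V W Set.univ (extChartAt 𝓘(ℝ, E) (1 : G) 1)
      = localBracket (chartMul E G) (extChartAt 𝓘(ℝ, E) (1 : G) 1) X Y := by
  have h := isLocalAction_chartMul (E := E) (G := G)
  have hd : ∀ X : E, HasFDerivAt
      (fun y ↦ fderiv ℝ (chartMul E G) (y, extChartAt 𝓘(ℝ, E) (1 : G) 1) (0, X)) _ _ :=
    fun X ↦ (HasFDerivAt.comp (f := fun a : E ↦ (a, extChartAt 𝓘(ℝ, E) (1 : G) 1))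
      (extChartAt 𝓘(ℝ, E) (1 : G) 1)
      h.differentiableAt_fderiv_mul.hasFDerivAt (hasFDerivAt_pair_left _ _)).clm_apply
      (hasFDerivAt_const ((0 : E), X) _)
  refine (lieBracketWithin_univ_eq hV hW (hd X) (hd Y)).trans ?_
  rw [h.fderiv_mul_right, h.fderiv_mul_right]
  simp [localBracket_apply]

/-- In the chart the left-invariant field of `X` is the derivative of `k (y, ·)` at `e` applied to
`X`. The Lie bracket of two such fields at `e` is the antisymmetrized mixed second derivative of
`k`. -/
lemma bracket_eq_localBracket (X Y : GroupLieAlgebra 𝓘(ℝ, E) G) :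
    (⁅X, Y⁆ : GroupLieAlgebra 𝓘(ℝ, E) G)
      = localBracket (chartMul E G) (extChartAt 𝓘(ℝ, E) (1 : G) 1) X Y := by
  rw [GroupLieAlgebra.bracket_def, ← VectorField.mlieBracketWithin_univ,
    VectorField.mlieBracketWithin_apply]
  refine (inverse_mfderiv_extChartAt_self (1 : G) _).trans ?_
  rw [modelWithCornersSelf_coe, Set.range_id, Set.preimage_univ, Set.univ_inter]
  exact lieBracketWithin_left_invariant (E := E) (G := G) (mpullback_mulInvariantVectorField_chart (E := E) (G := G) X)
    (mpullback_mulInvariantVectorField_chart (E := E) (G := G) Y)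

lemma contMDiff_conj (z : G) : ContMDiff 𝓘(ℝ, E) 𝓘(ℝ, E) ∞ (fun a : G ↦ z * a * z⁻¹) :=
  (contMDiff_const.mul contMDiff_id).mul contMDiff_const

/-- A smooth map of the group fixing `1`, in the preferred chart. -/
lemma contDiffAt_chart_of_one {f : G → G} (hf : ContMDiffAt 𝓘(ℝ, E) 𝓘(ℝ, E) ∞ f 1) (h1 : f 1 = 1) :
    ContDiffAt ℝ ∞ (fun y ↦ extChartAt 𝓘(ℝ, E) (1 : G) (f ((extChartAt 𝓘(ℝ, E) (1 : G)).symm y)))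
      (extChartAt 𝓘(ℝ, E) (1 : G) 1) := by
  rw [← contMDiffAt_iff_contDiffAt]
  have h2 := contMDiffAt_extChartAt_symm (1 : G) (mem_extChartAt_target (I := 𝓘(ℝ, E)) (1 : G))
  have h3 : ContMDiffAt 𝓘(ℝ, E) 𝓘(ℝ, E) ∞ (fun y ↦ f ((extChartAt 𝓘(ℝ, E) (1 : G)).symm y))
      (extChartAt 𝓘(ℝ, E) (1 : G) 1) :=
    ContMDiffAt.comp_of_eq hf h2 (extChartAt_to_inv (I := 𝓘(ℝ, E)) (1 : G))
  refine ContMDiffAt.comp_of_eq (contMDiffAt_extChartAt (I := 𝓘(ℝ, E)) (n := ∞) (x := (1 : G))) h3 ?_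
  rw [extChartAt_to_inv, h1]

lemma eventually_symm_chart_of_one {f : G → G} (hf : ContMDiffAt 𝓘(ℝ, E) 𝓘(ℝ, E) ∞ f 1)
    (h1 : f 1 = 1) : ∀ᶠ y in 𝓝 (extChartAt 𝓘(ℝ, E) (1 : G) 1),
      (extChartAt 𝓘(ℝ, E) (1 : G)).symm
        (extChartAt 𝓘(ℝ, E) (1 : G) (f ((extChartAt 𝓘(ℝ, E) (1 : G)).symm y)))
      = f ((extChartAt 𝓘(ℝ, E) (1 : G)).symm y) := by
  have h2 := contMDiffAt_extChartAt_symm (1 : G) (mem_extChartAt_target (I := 𝓘(ℝ, E)) (1 : G))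
  have h3 : ContinuousAt (fun y ↦ f ((extChartAt 𝓘(ℝ, E) (1 : G)).symm y))
      (extChartAt 𝓘(ℝ, E) (1 : G) 1) :=
    ContinuousAt.comp_of_eq hf.continuousAt h2.continuousAt
      (extChartAt_to_inv (I := 𝓘(ℝ, E)) (1 : G))
  have h4 : (extChartAt 𝓘(ℝ, E) (1 : G)).source
      ∈ 𝓝 (f ((extChartAt 𝓘(ℝ, E) (1 : G)).symm (extChartAt 𝓘(ℝ, E) (1 : G) 1))) := by
    rw [extChartAt_to_inv, h1]
    exact extChartAt_source_mem_nhds 1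
  filter_upwards [h3 h4] with y hy
  exact (extChartAt 𝓘(ℝ, E) (1 : G)).left_inv hy

/-- The identity `a b = (a b a⁻¹) a` differentiated at `b = 1`; this is the hypothesis under which
`IsLocalAction.hasDerivAt_adjoint` applies. -/
lemma eventually_Ad_chart : ∀ᶠ a in 𝓝 (extChartAt 𝓘(ℝ, E) (1 : G) 1), ∀ X : E,
    fderiv ℝ (chartMul E G) (a, extChartAt 𝓘(ℝ, E) (1 : G) 1) (0, X)
      = fderiv ℝ (chartMul E G) (extChartAt 𝓘(ℝ, E) (1 : G) 1, a)
        ((Ad E ((extChartAt 𝓘(ℝ, E) (1 : G)).symm a) X : E), 0) := by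
  have h := isLocalAction_chartMul (E := E) (G := G)
  have t2 : Tendsto (fun a : E ↦ (extChartAt 𝓘(ℝ, E) (1 : G) 1, a))
      (𝓝 (extChartAt 𝓘(ℝ, E) (1 : G) 1))
      (𝓝 (extChartAt 𝓘(ℝ, E) (1 : G) 1, extChartAt 𝓘(ℝ, E) (1 : G) 1)) :=
    (hasFDerivAt_pair_right _ _).continuousAt
  filter_upwards [h.tendsto_left.eventually (h.contDiffAt_mul.eventually (by simp)),
    t2.eventually (h.contDiffAt_mul.eventually (by simp))] with a h1 h2 X
  have hone : (extChartAt 𝓘(ℝ, E) (1 : G)).symm a * 1 * ((extChartAt 𝓘(ℝ, E) (1 : G)).symm a)⁻¹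
    = 1 := by simp
  have hC := hasFDerivAt_chart (((contMDiff_conj (E := E)
    ((extChartAt 𝓘(ℝ, E) (1 : G)).symm a)).contMDiffAt (x := 1)).mdifferentiableAt (by simp)) hone _ rfl
  have d1 := (h1.differentiableAt (by simp)).hasFDerivAt.comp
    (extChartAt 𝓘(ℝ, E) (1 : G) 1) (hasFDerivAt_pair_right _ _)
  have d2 := HasFDerivAt.comp (g := chartMul E G)
    (g' := fderiv ℝ (chartMul E G) (extChartAt 𝓘(ℝ, E) (1 : G) 1, a))
    (extChartAt 𝓘(ℝ, E) (1 : G) 1) (by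
      rw [extChartAt_to_inv, hone]
      exact (h2.differentiableAt (by simp)).hasFDerivAt)
    (hC.prodMk (hasFDerivAt_const a _))
  have e : ∀ᶠ y in 𝓝 (extChartAt 𝓘(ℝ, E) (1 : G) 1), chartMul E G (a, y)
      = chartMul E G (extChartAt 𝓘(ℝ, E) (1 : G) ((extChartAt 𝓘(ℝ, E) (1 : G)).symm a *
        (extChartAt 𝓘(ℝ, E) (1 : G)).symm y * ((extChartAt 𝓘(ℝ, E) (1 : G)).symm a)⁻¹), a) := by
    filter_upwards [eventually_symm_chart_of_one (contMDiff_conj (E := E)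
      ((extChartAt 𝓘(ℝ, E) (1 : G)).symm a)).contMDiffAt hone] with y hy
    simp only [chartMul, chartAct, hy, smul_eq_mul, inv_mul_cancel_right]
  exact DFunLike.congr_fun ((d1.congr_of_eventuallyEq (e.mono fun _ ↦ Eq.symm)).unique d2) X

/-- The derivative at `1` of a smooth endomorphism is compatible with the bracket. -/
lemma mfderiv_hom_localBracket {f : G → G} (hf : ContMDiffAt 𝓘(ℝ, E) 𝓘(ℝ, E) ∞ f 1)
    (hmul : ∀ a b, f (a * b) = f a * f b) (h1 : f 1 = 1) (L : E →L[ℝ] E)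
    (hL : mfderiv 𝓘(ℝ, E) 𝓘(ℝ, E) f 1 = L) (X Y : E) :
    L (localBracket (chartMul E G) (extChartAt 𝓘(ℝ, E) (1 : G) 1) X Y)
      = localBracket (chartMul E G) (extChartAt 𝓘(ℝ, E) (1 : G) 1) (L X) (L Y) := by
  have h := isLocalAction_chartMul (E := E) (G := G)
  have hd := (hasFDerivAt_chart (hf.mdifferentiableAt (by simp)) h1 L hL).fderiv
  have h3 := h.localBracket_map ((contDiffAt_chart_of_one hf h1).of_le ENat.LEInfty.out)
    (by rw [extChartAt_to_inv, h1]) (by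
      have t1 := (continuous_fst (X := E) (Y := E)).tendsto
        (extChartAt 𝓘(ℝ, E) (1 : G) 1, extChartAt 𝓘(ℝ, E) (1 : G) 1)
      have t2 := (continuous_snd (X := E) (Y := E)).tendsto
        (extChartAt 𝓘(ℝ, E) (1 : G) 1, extChartAt 𝓘(ℝ, E) (1 : G) 1)
      filter_upwards [eventually_symm_chartAct (F := E) (M := G) E G 1,
        t1.eventually (eventually_symm_chart_of_one hf h1),
        t2.eventually (eventually_symm_chart_of_one hf h1)] with q e1 e2 e3
      have e1' : (extChartAt 𝓘(ℝ, E) (1 : G)).symm (chartMul E G q) = _ := e1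
      rw [e1', smul_eq_mul, hmul]
      simp only [chartMul, chartAct, e2, e3, smul_eq_mul]) X Y
  rwa [hd] at h3

end Group

/-! ### From `Ad(K) 𝔭 ⊆ 𝔭` to `[𝔨, 𝔭] ⊆ 𝔭`. -/

section Reductive

/-- A curve in a level set of a submersion with prescribed velocity. -/
lemma exists_curve_of_surjective {E : Type*} [NormedAddCommGroup E] [NormedSpace ℝ E]
    [FiniteDimensional ℝ E] {F : Type*} [NormedAddCommGroup F] [NormedSpace ℝ F]
    [FiniteDimensional ℝ F] {f : E → F} {f' : E →L[ℝ] F} {a : E} (hf : HasStrictFDerivAt f f' a)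
    (hs : Function.Surjective f') {Z : E} (hZ : f' Z = 0) :
    ∃ c : ℝ → E, c 0 = a ∧ HasDerivAt c Z 0 ∧ ∀ᶠ t in 𝓝 0, f (c t) = f a := by
  have := FiniteDimensional.complete ℝ E
  have := FiniteDimensional.complete ℝ F
  have hr : f'.range = ⊤ := LinearMap.range_eq_top.2 hs
  let φ := hf.implicitFunction f f' hr (f a)
  have h1 : HasStrictFDerivAt φ f'.ker.subtypeL 0 := hf.to_implicitFunction hr
  have h2 : ∀ᶠ p : F × f'.ker in 𝓝 (f a, 0), f (hf.implicitFunction f f' hr p.1 p.2) = p.1 :=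
    hf.map_implicitFunction_eq hr
  let z : f'.ker := ⟨Z, hZ⟩
  have hd : HasDerivAt (fun t : ℝ ↦ t • z) z 0 := by
    simpa using (hasDerivAt_id (0 : ℝ)).smul_const z
  refine ⟨fun t ↦ φ (t • z), ?_, ?_, ?_⟩
  · simp [φ]
  · have h3 : HasFDerivAt φ f'.ker.subtypeL ((0 : ℝ) • z) := by
      rw [zero_smul]; exact h1.hasFDerivAt
    exact h3.comp_hasDerivAt 0 hd
  · have t1 : Tendsto (fun t : ℝ ↦ (f a, t • z)) (𝓝 0) (𝓝 (f a, 0)) := by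
      have := (continuousAt_const (y := f a)).prodMk hd.continuousAt
      simpa [ContinuousAt] using this
    exact t1.eventually h2

variable {E : Type*} [NormedAddCommGroup E] [NormedSpace ℝ E] [FiniteDimensional ℝ E]
  {F : Type*} [NormedAddCommGroup F] [NormedSpace ℝ F] [FiniteDimensional ℝ F]
  {G : Type*} [TopologicalSpace G] [ChartedSpace E G] [Group G] [LieGroup 𝓘(ℝ, E) ∞ G]
  {M : Type*} [TopologicalSpace M] [ChartedSpace F M] [MulAction G M]
  [IsManifold 𝓘(ℝ, F) ∞ M] [ContMDiffSMul 𝓘(ℝ, E) 𝓘(ℝ, F) ∞ G M]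

lemma hasStrictFDerivAt_orbit_chart (o : M) (L : E →L[ℝ] F) (hL : orbitDeriv (F := F) E G o = L) :
    HasStrictFDerivAt (fun a : E ↦ chartAct E G o (a, extChartAt 𝓘(ℝ, F) o o))
      L (extChartAt 𝓘(ℝ, E) (1 : G) 1) := by
  have h1 : ContDiffAt ℝ ∞ (fun a : E ↦ chartAct E G o (a, extChartAt 𝓘(ℝ, F) o o))
      (extChartAt 𝓘(ℝ, E) (1 : G) 1) :=
    ContDiffAt.comp (g := chartAct (F := F) E G o) (f := fun a : E ↦ (a, extChartAt 𝓘(ℝ, F) o o))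
      (extChartAt 𝓘(ℝ, E) (1 : G) 1) (contDiffAt_chartAct (F := F) E G o) (contDiffAt_id.prodMk contDiffAt_const)
  exact h1.hasStrictFDerivAt' (hasFDerivAt_orbit_chart o L hL) (by simp)

lemma eventually_mem_stabilizer (o : M) : ∀ᶠ a in 𝓝 (extChartAt 𝓘(ℝ, E) (1 : G) 1),
    chartAct E G o (a, extChartAt 𝓘(ℝ, F) o o) = extChartAt 𝓘(ℝ, F) o o →
      (extChartAt 𝓘(ℝ, E) (1 : G)).symm a ∈ MulAction.stabilizer G o := by
  filter_upwards [(tendsto_pair_left _ _).eventually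
    (eventually_symm_chartAct (F := F) E G o)] with a ha h
  rw [h] at ha
  simp only [extChartAt_to_inv] at ha
  exact ha.symm

lemma mem_of_hasDerivAt_of_eventually_mem (p : Submodule ℝ E) {A : ℝ → E} {A' : E}
    (hA : HasDerivAt A A' 0) (h : ∀ᶠ t in 𝓝 0, A t ∈ p) : A' ∈ p := by
  obtain ⟨q, hq⟩ := p.exists_isCompl
  let P : E →L[ℝ] E := LinearMap.toContinuousLinearMap (q.subtype ∘ₗ q.projectionOnto p hq.symm)
  have hP : ∀ x, P x = 0 ↔ x ∈ p := fun x ↦ by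
    rw [← Submodule.projectionOnto_apply_eq_zero_iff hq.symm]
    simp [P]
  rw [← hP]
  have h1 : HasDerivAt (fun t ↦ P (A t)) (P A') 0 := P.hasFDerivAt.comp_hasDerivAt 0 hA
  exact h1.unique ((hasDerivAt_const (0 : ℝ) (0 : E)).congr_of_eventuallyEq
    (h.mono fun t ht ↦ (hP _).2 ht))

/-- `[𝔨, 𝔭] ⊆ 𝔭` for a reductive decomposition. -/
lemma IsReductive.localBracket_mem {o : M} {p : Submodule ℝ (GroupLieAlgebra 𝓘(ℝ, E) G)}
    (hp : IsReductive (F := F) o p) (hsub : Function.Surjective (orbitDeriv (F := F) E G o))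
    {Z X : E} (hZ : orbitDeriv (F := F) E G o Z = 0)
    (hX : X ∈ (show Submodule ℝ E from p)) :
    localBracket (chartMul E G) (extChartAt 𝓘(ℝ, E) (1 : G) 1) Z X
      ∈ (show Submodule ℝ E from p) := by
  have hcomp := FiniteDimensional.complete ℝ E
  let L : E →L[ℝ] F := orbitDeriv (F := F) E G o
  have hL : Function.Surjective L := hsub
  have hLZ : L Z = 0 := hZ
  -- The orbit map is a submersion, so the implicit function theorem gives a curve in `K` with
  -- velocity `Z`. Along it `Ad (c t) X` stays in `𝔭`, and so does its derivative `[Z, X]`.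
  obtain ⟨c, hc0, hc, hcK⟩ := exists_curve_of_surjective
    (hasStrictFDerivAt_orbit_chart (G := G) o L rfl) hL hLZ
  have hct : Tendsto c (𝓝 0) (𝓝 (extChartAt 𝓘(ℝ, E) (1 : G) 1)) := by
    have := hc.continuousAt.tendsto
    rwa [hc0] at this
  have hA := (isLocalAction_chartMul (E := E) (G := G)).hasDerivAt_adjoint hc hc0
    (A := fun t ↦ Ad E ((extChartAt 𝓘(ℝ, E) (1 : G)).symm (c t)) X)
    ((hct.eventually eventually_Ad_chart).mono fun t ht ↦ ht X)
  refine mem_of_hasDerivAt_of_eventually_mem (show Submodule ℝ E from p) hA ?_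
  filter_upwards [hct.eventually (eventually_mem_stabilizer (F := F) o), hcK] with t h1 h2
  rw [chartAct_self] at h2
  exact hp.ad_mem _ (h1 h2) X hX

end Reductive

/-! ### Frames of `T_oM` induced by bases of `𝔭`. -/

section Frames

variable {E : Type*} [NormedAddCommGroup E] [NormedSpace ℝ E]
  {F : Type*} [NormedAddCommGroup F] [NormedSpace ℝ F]
  {n : ℕ} {ξ : E →L[ℝ] F} {br : E →L[ℝ] E →L[ℝ] E}

/-- The linear isomorphism of a complement of the kernel with the image. -/
def complEquiv (hs : Function.Surjective ξ) {p : Submodule ℝ E}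
    (hp : IsCompl p (LinearMap.ker (ξ : E →ₗ[ℝ] F))) : p ≃ₗ[ℝ] F :=
  LinearEquiv.ofBijective ((ξ : E →ₗ[ℝ] F) ∘ₗ p.subtype) (by
    constructor
    · rw [injective_iff_map_eq_zero]
      intro x hx
      have h1 : (x : E) ∈ p ⊓ LinearMap.ker (ξ : E →ₗ[ℝ] F) := ⟨x.2, hx⟩
      rw [hp.inf_eq_bot] at h1
      exact Subtype.ext h1
    · intro y
      obtain ⟨A, rfl⟩ := hs y
      refine ⟨p.projectionOnto _ hp A, ?_⟩
      have h1 := Submodule.projection_add_projection_eq_self hp A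
      have h2 : ξ (Submodule.projection _ p hp.symm A) = 0 := by
        have := (Submodule.projectionOnto _ p hp.symm A).2
        exact this
      conv_rhs => rw [← h1, map_add, h2, add_zero]
      rfl)

/-- The basis of `F` induced by a basis of a complement of the kernel of `ξ`. -/
def complBasis (hs : Function.Surjective ξ) {p : Submodule ℝ E}
    (hp : IsCompl p (LinearMap.ker (ξ : E →ₗ[ℝ] F))) (b : Module.Basis (Fin n) ℝ p) :
    Module.Basis (Fin n) ℝ F := b.map (complEquiv hs hp)

lemma complBasis_apply (hs : Function.Surjective ξ) {p : Submodule ℝ E}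
    (hp : IsCompl p (LinearMap.ker (ξ : E →ₗ[ℝ] F))) (b : Module.Basis (Fin n) ℝ p) (i : Fin n) :
    complBasis hs hp b i = ξ (b i) := by
  rw [complBasis, Module.Basis.map_apply]
  rfl

lemma apply_projectionOnto {p : Submodule ℝ E}
    (hp : IsCompl p (LinearMap.ker (ξ : E →ₗ[ℝ] F))) (A : E) :
    ξ (p.projectionOnto _ hp A) = ξ A := by
  have h1 := Submodule.projection_add_projection_eq_self hp A
  have h2 : ξ (Submodule.projection _ p hp.symm A) = 0 :=
    (Submodule.projectionOnto _ p hp.symm A).2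
  conv_rhs => rw [← h1, map_add, h2, add_zero]
  rfl

lemma complBasis_repr (hs : Function.Surjective ξ) {p : Submodule ℝ E}
    (hp : IsCompl p (LinearMap.ker (ξ : E →ₗ[ℝ] F))) (b : Module.Basis (Fin n) ℝ p) (A : E)
    (k : Fin n) :
    (complBasis hs hp b).repr (ξ A) k = b.repr (p.projectionOnto _ hp A) k := by
  have h : (complEquiv hs hp).symm (ξ A) = p.projectionOnto _ hp A := by
    rw [LinearEquiv.symm_apply_eq]
    exact (apply_projectionOnto hp A).symm
  simp [complBasis, h]

/-- The `k`-block of `f` is zero, so only the `p`-block contributes. With `f = ad x_j` this turns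
unimodularity of `G` into the vanishing of the traces of `μ_𝔭`. -/
lemma trace_eq_of_isCompl [FiniteDimensional ℝ E] {p k : Submodule ℝ E} (hp : IsCompl p k)
    (b : Module.Basis (Fin n) ℝ p) (f : E →ₗ[ℝ] E) (hf : ∀ x ∈ k, f x ∈ p) :
    LinearMap.trace ℝ E f = ∑ i, b.repr (p.projectionOnto _ hp (f (b i))) i := by
  have h1 : f = f ∘ₗ (p.subtype ∘ₗ p.projectionOnto k hp)
      + f ∘ₗ (k.subtype ∘ₗ k.projectionOnto p hp.symm) := by
    ext x
    have := Submodule.projection_add_projection_eq_self hp x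
    conv_lhs => rw [← this]
    simp
  have h2 : LinearMap.trace ℝ E (f ∘ₗ (k.subtype ∘ₗ k.projectionOnto p hp.symm)) = 0 := by
    rw [← LinearMap.comp_assoc, LinearMap.trace_comp_comm']
    have : (k.projectionOnto p hp.symm) ∘ₗ (f ∘ₗ k.subtype) = 0 := by
      ext x
      simp [Submodule.projectionOnto_apply_of_mem_right hp.symm (hf x x.2)]
    rw [this, map_zero]
  rw [h1, map_add, h2, add_zero, ← LinearMap.comp_assoc, LinearMap.trace_comp_comm',
    LinearMap.trace_eq_matrix_trace ℝ b, Matrix.trace]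
  simp [LinearMap.toMatrix_apply]

/-- Structure constants of a reductive unimodular decomposition are trace-free. -/
lemma sum_structConst_eq_zero [FiniteDimensional ℝ E] (hs : Function.Surjective ξ)
    {p : Submodule ℝ E} (hp : IsCompl p (LinearMap.ker (ξ : E →ₗ[ℝ] F)))
    (b : Module.Basis (Fin n) ℝ p) (hanti : ∀ A B, br A B = - br B A)
    (hred : ∀ Z X, ξ Z = 0 → X ∈ p → br Z X ∈ p)
    (htr : ∀ X, LinearMap.trace ℝ E (br X : E →ₗ[ℝ] E) = 0) (j : Fin n) :
    ∑ i, structConst ξ br (fun i ↦ (b i : E)) (complBasis hs hp b) j i i = 0 := by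
  have h := trace_eq_of_isCompl hp b (br (b j) : E →ₗ[ℝ] E) fun Z hZ ↦ by
    have := hred Z (b j) hZ (b j).2
    rw [hanti] at this
    simpa using this
  rw [htr] at h
  simp only [structConst, complBasis_repr]
  exact h.symm

section Naturality

variable {x : Fin n → E} {ε ε' : Module.Basis (Fin n) ℝ F} {f : E →L[ℝ] E}

/-- A map preserving the kernel of `ξ` descends to `F` and carries `ε` to `ε'`. Hence structure
constants and Killing matrices are the same in both frames when `f` respects brackets. -/
lemma repr_apply_hom (hε : ∀ i, ξ (x i) = ε i) (hε' : ∀ i, ξ (f (x i)) = ε' i)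
    (hker : ∀ Z, ξ Z = 0 → ξ (f Z) = 0) (A : E) : ε'.repr (ξ (f A)) = ε.repr (ξ A) := by
  have h1 : ξ (A - ∑ l, ε.repr (ξ A) l • x l) = 0 := by
    simp [hε, ε.sum_repr]
  have h2 := hker _ h1
  rw [map_sub, map_sub, sub_eq_zero] at h2
  rw [h2]
  simp only [map_sum, map_smul, hε']
  ext k
  simp

lemma structConst_hom (hε : ∀ i, ξ (x i) = ε i) (hε' : ∀ i, ξ (f (x i)) = ε' i)
    (hker : ∀ Z, ξ Z = 0 → ξ (f Z) = 0) (hf : ∀ X Y, f (br X Y) = br (f X) (f Y)) :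
    structConst ξ br (fun i ↦ f (x i)) ε' = structConst ξ br x ε := by
  funext i j k
  simp only [structConst, ← hf, repr_apply_hom hε hε' hker]

lemma killingMat_hom (hε : ∀ i, ξ (x i) = ε i) (hε' : ∀ i, ξ (f (x i)) = ε' i)
    (hker : ∀ Z, ξ Z = 0 → ξ (f Z) = 0) (hf : ∀ X Y, f (br X Y) = br (f X) (f Y)) :
    killingMat ξ br (fun i ↦ f (x i)) ε' = killingMat ξ br x ε := by
  have h1 : ∀ A, kerPart ξ (fun i ↦ f (x i)) ε' (f A) = f (kerPart ξ x ε A) := by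
    intro A
    simp [kerPart, repr_apply_hom hε hε' hker]
  ext a b
  simp only [killingMat, Matrix.of_apply, ← hf, h1, repr_apply_hom hε hε' hker]

end Naturality

end Frames

/-! ### The Ricci formula on the homogeneous space. -/

section Context

variable (E : Type*) [NormedAddCommGroup E] [NormedSpace ℝ E]
  {F : Type*} [NormedAddCommGroup F] [NormedSpace ℝ F]
  (G : Type*) [TopologicalSpace G] [ChartedSpace E G] [Group G]
  {M : Type*} [TopologicalSpace M] [ChartedSpace F M] [MulAction G M]

/-- The derivative of the orbit map, as a map between the model spaces. -/
def orbitCLM (o : M) : E →L[ℝ] F := orbitDeriv E G o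

/-- The Lie bracket of `G`, on the model space. -/
def lieBr : E →L[ℝ] E →L[ℝ] E :=
  localBracket (chartMul E G) (extChartAt 𝓘(ℝ, E) (1 : G) 1)

variable {E G}

lemma IsReductive.isCompl_orbitCLM {o : M} {p : Submodule ℝ (GroupLieAlgebra 𝓘(ℝ, E) G)}
    (hp : IsReductive (F := F) o p) :
    IsCompl (p : Submodule ℝ E) (LinearMap.ker (orbitCLM (F := F) E G o : E →ₗ[ℝ] F)) :=
  hp.isCompl

/-- The vectors of a basis of `𝔭`, in the model space. -/
def pVec {p : Submodule ℝ (GroupLieAlgebra 𝓘(ℝ, E) G)} {n : ℕ} (b : Module.Basis (Fin n) ℝ p)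
    (i : Fin n) : E := (b i : GroupLieAlgebra 𝓘(ℝ, E) G)

/-- The value at a point of a tensor field, as a form on the model space. -/
def formAt (T : Tensor2 F M) (x : M) : F →L[ℝ] F →L[ℝ] ℝ := T x

/-- The basis of `T_oM` induced by a basis of `𝔭`. -/
def frame {o : M} {p : Submodule ℝ (GroupLieAlgebra 𝓘(ℝ, E) G)} {n : ℕ}
    (hs : Function.Surjective (orbitCLM (F := F) E G o)) (hp : IsReductive (F := F) o p)
    (b : Module.Basis (Fin n) ℝ p) : Module.Basis (Fin n) ℝ F :=
  complBasis hs hp.isCompl_orbitCLM b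

/-- The Killing form of `𝔤` restricted to `𝔭`, in a basis. -/
def killingP {o : M} {p : Submodule ℝ (GroupLieAlgebra 𝓘(ℝ, E) G)} {n : ℕ}
    (hs : Function.Surjective (orbitCLM (F := F) E G o)) (hp : IsReductive (F := F) o p)
    (b : Module.Basis (Fin n) ℝ p) : Matrix (Fin n) (Fin n) ℝ :=
  killingMat (orbitCLM (F := F) E G o) (lieBr E G) (pVec b) (frame hs hp b)

variable {o : M} {p : Submodule ℝ (GroupLieAlgebra 𝓘(ℝ, E) G)} {n : ℕ}
  (hs : Function.Surjective (orbitCLM (F := F) E G o)) (hp : IsReductive (F := F) o p)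
  (b : Module.Basis (Fin n) ℝ p)

lemma orbitCLM_apply_basis (i : Fin n) : orbitCLM (F := F) E G o (pVec b i) = frame hs hp b i :=
  (complBasis_apply hs hp.isCompl_orbitCLM b i).symm

lemma mat_eq_gramMat (hs : Function.Surjective (orbitCLM (F := F) E G o))
    (hp : IsReductive (F := F) o p) (b : Module.Basis (Fin n) ℝ p) (T : Tensor2 F M) : mat o b T = gramMat (formAt T o) (frame hs hp b) := by
  ext i j
  exact congrArg₂ (fun u v ↦ T o u v) (orbitCLM_apply_basis hs hp b i)
    (orbitCLM_apply_basis hs hp b j)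

variable [LieGroup 𝓘(ℝ, E) ∞ G] [IsManifold 𝓘(ℝ, F) ∞ M] [ContMDiffSMul 𝓘(ℝ, E) 𝓘(ℝ, F) ∞ G M]

lemma lieBr_antisymm (A B : E) : lieBr E G A B = - lieBr E G B A := localBracket_antisymm _ _ _ _

lemma muP_eq_structConst : muP hp b
    = structConst (orbitCLM (F := F) E G o) (lieBr E G) (pVec b) (frame hs hp b) := by
  funext i j k
  refine Eq.trans ?_ (complBasis_repr hs hp.isCompl_orbitCLM b _ k).symm
  have h := bracket_eq_localBracket (b i : GroupLieAlgebra 𝓘(ℝ, E) G) (b j)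
  exact congrArg (fun A : E ↦ b.repr (p.projectionOnto _ hp.isCompl A) k) h

lemma muP_antisymm (hs : Function.Surjective (orbitCLM (F := F) E G o))
    (hp : IsReductive (F := F) o p) (b : Module.Basis (Fin n) ℝ p) (i j k : Fin n) :
    muP hp b i j k = - muP hp b j i k := by
  rw [muP_eq_structConst hs hp b, structConst, structConst, lieBr_antisymm, map_neg, map_neg,
    Finsupp.neg_apply]

variable [FiniteDimensional ℝ E] [FiniteDimensional ℝ F]

lemma IsUnimodular.trace_lieBr (huni : IsUnimodular E G) (X : E) :
    LinearMap.trace ℝ E (lieBr E G X : E →ₗ[ℝ] E) = 0 := by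
  have h := huni X
  refine Eq.trans ?_ h
  congr 1
  ext Y
  exact (bracket_eq_localBracket (G := G) X Y).symm

lemma muP_trace (hs : Function.Surjective (orbitCLM (F := F) E G o)) (hp : IsReductive (F := F) o p)
    (b : Module.Basis (Fin n) ℝ p) (huni : IsUnimodular E G) (j : Fin n) : ∑ i, muP hp b j i i = 0 := by
  rw [muP_eq_structConst hs hp b]
  exact sum_structConst_eq_zero hs hp.isCompl_orbitCLM b lieBr_antisymm
    (fun Z X hZ hX ↦ hp.localBracket_mem hs hZ hX) huni.trace_lieBr j

/-- The Ricci curvature of an invariant metric, in a frame obtained from that of `𝔭` by an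
automorphism. -/
theorem ricci_hom_frame (huni : IsUnimodular E G) {h : Tensor2 F M} (hh : IsInvMetric G h)
    {f : E →L[ℝ] E} (hf : ∀ X Y, f (lieBr E G X Y) = lieBr E G (f X) (f Y))
    (hker : ∀ Z, orbitCLM (F := F) E G o Z = 0 → orbitCLM (F := F) E G o (f Z) = 0)
    (ε' : Module.Basis (Fin n) ℝ F) (hε' : ∀ i, orbitCLM (F := F) E G o (f (pVec b i)) = ε' i)
    (i j : Fin n) :
    ricci h o (ε' i) (ε' j)
      = ricMat (muP hp b) (killingP hs hp b) (gramMat (formAt h o) ε') i j := by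
  have hK := isKillingFamily_chartAct E G hh o
  have hξ : fundField (chartAct (F := F) E G o) (extChartAt 𝓘(ℝ, E) (1 : G) 1)
      (extChartAt 𝓘(ℝ, F) o o) = orbitCLM E G o := by
    ext X
    exact fundField_eq_orbitDeriv o X
  have hε := orbitCLM_apply_basis hs hp b
  -- Since `c` and `β` agree in the two frames, only the Gram matrix remembers `f`.
  have hc := structConst_hom (br := lieBr E G) hε hε' hker hf
  have hβ := killingMat_hom (br := lieBr E G) hε hε' hker hf
  have hr := hK.ricciCoord_eq (localBracket_antisymm _ _) (fun i ↦ f (pVec b i)) ε'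
    (by rw [hξ]; exact hε') (by
      intro j
      rw [hξ]
      have := muP_trace hs hp b huni j
      rw [muP_eq_structConst hs hp b, ← hc] at this
      exact this) i j
  rw [hξ] at hr
  have hg : gramMat (inChart h o (extChartAt 𝓘(ℝ, F) o o)) ε' = gramMat (formAt h o) ε' := by
    ext i j
    exact inChart_self h o (ε' i) (ε' j)
  refine (ricci_eq h o _ _).trans (hr.trans ?_)
  rw [hg, muP_eq_structConst hs hp b, killingP, ← hc, ← hβ]
  rfl

theorem gram_ricci (hs : Function.Surjective (orbitCLM (F := F) E G o))
    (hp : IsReductive (F := F) o p) (b : Module.Basis (Fin n) ℝ p) (huni : IsUnimodular E G) {h : Tensor2 F M} (hh : IsInvMetric G h) :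
    gram o b (ricci h o) = ricMat (muP hp b) (killingP hs hp b) (mat o b h) := by
  rw [mat_eq_gramMat hs hp b]
  ext i j
  rw [← ricci_hom_frame hs hp b huni hh (f := ContinuousLinearMap.id ℝ E) (fun _ _ ↦ rfl)
    (fun _ h ↦ h) (frame hs hp b) (orbitCLM_apply_basis hs hp b) i j]
  exact congrArg₂ (fun u v ↦ ricci h o u v) (orbitCLM_apply_basis hs hp b i)
    (orbitCLM_apply_basis hs hp b j)

end Context

/-! ### Local sections, transport of tensors and their extension from `o`. -/

section LinearSection

/-- A smooth local section of a submersion. -/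
lemma exists_section_of_surjective {E : Type*} [NormedAddCommGroup E] [NormedSpace ℝ E]
    [FiniteDimensional ℝ E] {F : Type*} [NormedAddCommGroup F] [NormedSpace ℝ F]
    [FiniteDimensional ℝ F] {f : E → F} {f' : E →L[ℝ] F} {a : E} (hf : ContDiffAt ℝ ∞ f a)
    (hf' : HasFDerivAt f f' a) (hs : Function.Surjective f') :
    ∃ s : F → E, s (f a) = a ∧ ContDiffAt ℝ ∞ s (f a) ∧ ∀ᶠ y in 𝓝 (f a), f (s y) = y := by
  have := FiniteDimensional.complete ℝ E
  have := FiniteDimensional.complete ℝ F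
  obtain ⟨r, hr⟩ := (f' : E →ₗ[ℝ] F).exists_rightInverse_of_surjective (LinearMap.range_eq_top.2 hs)
  let r' : F →L[ℝ] E := LinearMap.toContinuousLinearMap r
  have hr' : ∀ z, f' (r' z) = z := fun z ↦ DFunLike.congr_fun hr z
  -- Composition with an affine right inverse of the derivative reduces the claim to the inverse
  -- function theorem.
  let φ : F → E := fun z ↦ a + r' z
  have hφ0 : φ 0 = a := by simp [φ]
  have hφ : ContDiff ℝ ∞ φ := contDiff_const.add r'.contDiff
  have hφ' : HasFDerivAt φ r' 0 := r'.hasFDerivAt.const_add a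
  have hg : ContDiffAt ℝ ∞ (f ∘ φ) 0 :=
    ContDiffAt.comp 0 (by rw [hφ0]; exact hf) hφ.contDiffAt
  have hg' : HasFDerivAt (f ∘ φ) ((ContinuousLinearEquiv.refl ℝ F : F ≃L[ℝ] F) : F →L[ℝ] F) 0 := by
    have h1 := HasFDerivAt.comp (g := f) (g' := f') 0 (by rw [hφ0]; exact hf') hφ'
    convert! h1 using 1
    ext z
    exact (hr' z).symm
  have hfa : (f ∘ φ) 0 = f a := by simp [hφ0]
  have h2 := hg.to_localInverse hg' (by simp)
  have h3 := hg.localInverse_apply_image hg' (by simp)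
  have h4 : ∀ᶠ y in 𝓝 ((f ∘ φ) 0), (f ∘ φ) (hg.localInverse hg' (by simp) y) = y :=
    (hg.toOpenPartialHomeomorph _ hg' (by simp)).eventually_right_inverse
      (hg.image_mem_toOpenPartialHomeomorph_target hg' (by simp))
  rw [hfa] at h2 h3 h4
  refine ⟨fun y ↦ φ (hg.localInverse hg' (by simp) y), ?_, ?_, h4⟩
  · simp only [h3, hφ0]
  · exact hφ.contDiffAt.comp _ h2

end LinearSection

section ActionDerivative

variable (E : Type*) [NormedAddCommGroup E] [NormedSpace ℝ E]
  {F : Type*} [NormedAddCommGroup F] [NormedSpace ℝ F]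
  {G : Type*} [TopologicalSpace G] [ChartedSpace E G] [Group G]
  {M : Type*} [TopologicalSpace M] [ChartedSpace F M] [MulAction G M]
  [ContMDiffSMul 𝓘(ℝ, E) 𝓘(ℝ, F) ∞ G M]

/-- The derivative of the action of an element, as a map between the model spaces. -/
def actDeriv (a : G) (x : M) : F →L[ℝ] F := mfderiv 𝓘(ℝ, F) 𝓘(ℝ, F) (fun y : M ↦ a • y) x

lemma actDeriv_one (x : M) (u : F) : actDeriv (1 : G) x u = u := by
  have h : (fun y : M ↦ (1 : G) • y) = id := by ext; simp
  have h2 : mfderiv 𝓘(ℝ, F) 𝓘(ℝ, F) (fun y : M ↦ (1 : G) • y) x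
      = mfderiv 𝓘(ℝ, F) 𝓘(ℝ, F) (id : M → M) x := by rw [h]
  have h3 : (mfderiv 𝓘(ℝ, F) 𝓘(ℝ, F) (id : M → M) x : F →L[ℝ] F) u = u := by
    rw [mfderiv_id]
    rfl
  exact (congrArg (fun l : F →L[ℝ] F ↦ l u) h2).trans h3

variable [IsManifold 𝓘(ℝ, F) ∞ M]

lemma IsInvSym.apply_actDeriv {T : Tensor2 F M} (hT : IsInvSym G T) (a : G) (x : M) (u v : F) :
    formAt T (a • x) (actDeriv a x u) (actDeriv a x v) = formAt T x u v := hT.invariant a x u v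

include E

lemma actDeriv_mul (a b : G) (x : M) (u : F) :
    actDeriv (a * b) x u = actDeriv a (b • x) (actDeriv b x u) := by
  have h1 := HasMFDerivAt.comp x (mdifferentiableAt_const_smul (F := F) E a (b • x)).hasMFDerivAt
    (mdifferentiableAt_const_smul (F := F) E b x).hasMFDerivAt
  have h2 : ((fun y : M ↦ a • y) ∘ fun y : M ↦ b • y) = fun y : M ↦ (a * b) • y := by
    ext y; simp [mul_smul]
  rw [h2] at h1
  exact congrArg (fun l : F →L[ℝ] F ↦ l u) h1.mfderiv

lemma actDeriv_inv_actDeriv (a : G) (x : M) (u : F) : actDeriv a⁻¹ (a • x) (actDeriv a x u) = u := by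
  rw [← actDeriv_mul E, inv_mul_cancel, actDeriv_one]

lemma actDeriv_actDeriv_inv (a : G) (x : M) (u : F) :
    actDeriv a (a⁻¹ • x) (actDeriv a⁻¹ x u) = u := by
  rw [← actDeriv_mul E, mul_inv_cancel, actDeriv_one]

lemma actDeriv_surjective (a : G) (x : M) : Function.Surjective (actDeriv (F := F) a x) :=
  fun u ↦ by
    refine ⟨actDeriv a⁻¹ (a • x) u, ?_⟩
    have := actDeriv_actDeriv_inv E (F := F) a (a • x) u
    rwa [inv_smul_smul] at this

/-- By transitivity the value at any point is the transport of the value at `o`. -/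
lemma IsInvSym.ext_at [MulAction.IsPretransitive G M] {T S : Tensor2 F M} (hT : IsInvSym G T)
    (hS : IsInvSym G S) (o : M) (h : ∀ u v : F, formAt T o u v = formAt S o u v) : T = S := by
  funext x
  obtain ⟨a, rfl⟩ := MulAction.exists_smul_eq G o x
  have key : formAt T (a • o) = formAt S (a • o) := by
    ext u v
    obtain ⟨u, rfl⟩ := actDeriv_surjective E a o u
    obtain ⟨v, rfl⟩ := actDeriv_surjective E a o v
    rw [hT.apply_actDeriv, hS.apply_actDeriv, h]
  exact key

lemma IsInvSym.isInvMetric [MulAction.IsPretransitive G M] {T : Tensor2 F M} (hT : IsInvSym G T)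
    (o : M) (hpos : ∀ u : F, u ≠ 0 → 0 < formAt T o u u) : IsInvMetric G T where
  toIsInvSym := hT
  pos x u hu := by
    obtain ⟨a, rfl⟩ := MulAction.exists_smul_eq G o x
    obtain ⟨v, hv⟩ := actDeriv_surjective E (F := F) a o u
    have hv0 : v ≠ 0 := by
      rintro rfl
      rw [map_zero] at hv
      exact hu hv.symm
    have h1 := hpos v hv0
    rw [← hT.apply_actDeriv a o v v, hv] at h1
    exact h1

end ActionDerivative

section TensorSpace

variable {F : Type*} [NormedAddCommGroup F] [NormedSpace ℝ F]
  {G : Type*} [Group G]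
  {M : Type*} [TopologicalSpace M] [ChartedSpace F M] [MulAction G M] [IsManifold 𝓘(ℝ, F) ∞ M]

lemma inChart_add (T S : Tensor2 F M) (x : M) : inChart (T + S) x = inChart T x + inChart S x := by
  funext y; ext u v; rfl

lemma inChart_smul (c : ℝ) (T : Tensor2 F M) (x : M) : inChart (c • T) x = c • inChart T x := by
  funext y; ext u v; rfl

lemma IsInvSym.add {T S : Tensor2 F M} (hT : IsInvSym G T) (hS : IsInvSym G S) :
    IsInvSym G (T + S) where
  smooth x := by
    rw [contMDiffAt_tensor2_iff, inChart_add]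
    exact ((contMDiffAt_tensor2_iff T x).1 (hT.smooth x)).add
      ((contMDiffAt_tensor2_iff S x).1 (hS.smooth x))
  symm x u v := congrArg₂ (· + ·) (hT.symm x u v) (hS.symm x u v)
  invariant a x u v := congrArg₂ (· + ·) (hT.invariant a x u v) (hS.invariant a x u v)

lemma IsInvSym.smul (c : ℝ) {T : Tensor2 F M} (hT : IsInvSym G T) : IsInvSym G (c • T) where
  smooth x := by
    rw [contMDiffAt_tensor2_iff, inChart_smul]
    exact ((contMDiffAt_tensor2_iff T x).1 (hT.smooth x)).const_smul c
  symm x u v := congrArg (c * ·) (hT.symm x u v)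
  invariant a x u v := congrArg (c * ·) (hT.invariant a x u v)

end TensorSpace

section ExtendTensor

variable {E : Type*} [NormedAddCommGroup E] [NormedSpace ℝ E] [FiniteDimensional ℝ E]
  {F : Type*} [NormedAddCommGroup F] [NormedSpace ℝ F] [FiniteDimensional ℝ F]
  {G : Type*} [TopologicalSpace G] [ChartedSpace E G] [Group G] [LieGroup 𝓘(ℝ, E) ∞ G]
  {M : Type*} [TopologicalSpace M] [ChartedSpace F M] [MulAction G M]
  [IsManifold 𝓘(ℝ, F) ∞ M] [ContMDiffSMul 𝓘(ℝ, E) 𝓘(ℝ, F) ∞ G M]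

/-- Smooth local sections of the orbit map. -/
lemma exists_section_orbit {o : M} (hs : Function.Surjective (orbitCLM (F := F) E G o)) :
    ∃ s : M → G, s o = 1 ∧ ContMDiffAt 𝓘(ℝ, F) 𝓘(ℝ, E) ∞ s o ∧ ∀ᶠ x in 𝓝 o, s x • o = x := by
  have h1 : ContDiffAt ℝ ∞ (fun a : E ↦ chartAct E G o (a, extChartAt 𝓘(ℝ, F) o o))
      (extChartAt 𝓘(ℝ, E) (1 : G) 1) :=
    ContDiffAt.comp (g := chartAct (F := F) E G o) (f := fun a : E ↦ (a, extChartAt 𝓘(ℝ, F) o o))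
      (extChartAt 𝓘(ℝ, E) (1 : G) 1) (contDiffAt_chartAct (F := F) E G o)
      (contDiffAt_id.prodMk contDiffAt_const)
  obtain ⟨s, hs1, hs2, hs3⟩ := exists_section_of_surjective h1
    (hasFDerivAt_orbit_chart o (orbitCLM E G o) rfl) hs
  rw [chartAct_self] at hs1 hs2 hs3
  have hκ := (contMDiffAt_extChartAt (I := 𝓘(ℝ, F)) (n := ∞) (x := o)).continuousAt
  refine ⟨fun x ↦ (extChartAt 𝓘(ℝ, E) (1 : G)).symm (s (extChartAt 𝓘(ℝ, F) o x)), ?_, ?_, ?_⟩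
  · simp only [hs1, extChartAt_to_inv]
  · have h2 := contMDiffAt_extChartAt_symm (1 : G) (mem_extChartAt_target (I := 𝓘(ℝ, E)) (1 : G))
    have h3 : ContMDiffAt 𝓘(ℝ, F) 𝓘(ℝ, E) ∞ (fun x ↦ s (extChartAt 𝓘(ℝ, F) o x)) o :=
      ContMDiffAt.comp o (contMDiffAt_iff_contDiffAt.2 hs2)
        (contMDiffAt_extChartAt (I := 𝓘(ℝ, F)) (n := ∞) (x := o))
    exact ContMDiffAt.comp_of_eq h2 h3 hs1
  · have h4 : ∀ᶠ a in 𝓝 (extChartAt 𝓘(ℝ, E) (1 : G) 1),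
        (extChartAt 𝓘(ℝ, F) o).symm (chartAct E G o (a, extChartAt 𝓘(ℝ, F) o o))
          = (extChartAt 𝓘(ℝ, E) (1 : G)).symm a • o := by
      filter_upwards [(tendsto_pair_left _ _).eventually
        (eventually_symm_chartAct (F := F) E G o)] with a ha
      simpa only [extChartAt_to_inv] using ha
    have t : Tendsto s (𝓝 (extChartAt 𝓘(ℝ, F) o o)) (𝓝 (extChartAt 𝓘(ℝ, E) (1 : G) 1)) := by
      have := hs2.continuousAt.tendsto
      rwa [hs1] at this
    filter_upwards [hκ.tendsto.eventually hs3, hκ.tendsto.eventually (t.eventually h4),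
      extChartAt_source_mem_nhds (I := 𝓘(ℝ, F)) o] with x h5 h6 h7
    rw [← h6, h5, (extChartAt 𝓘(ℝ, F) o).left_inv h7]

lemma exists_section_orbit_at {o : M} (hs : Function.Surjective (orbitCLM (F := F) E G o))
    (a : G) : ∃ s : M → G, ContMDiffAt 𝓘(ℝ, F) 𝓘(ℝ, E) ∞ s (a • o) ∧
      s (a • o) = a ∧ ∀ᶠ x in 𝓝 (a • o), s x • o = x := by
  obtain ⟨s, h1, h2, h3⟩ := exists_section_orbit hs
  have hc : ContMDiffAt 𝓘(ℝ, F) 𝓘(ℝ, F) ∞ (fun y : M ↦ a⁻¹ • y) (a • o) :=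
    (contMDiffAt_const (I' := 𝓘(ℝ, E)) (c := a⁻¹)).smul contMDiffAt_id
  have ht : Tendsto (fun y : M ↦ a⁻¹ • y) (𝓝 (a • o)) (𝓝 o) := by
    simpa using hc.continuousAt.tendsto
  refine ⟨fun x ↦ a * s (a⁻¹ • x), ?_, by simp [h1], ?_⟩
  · exact contMDiffAt_const.mul (ContMDiffAt.comp_of_eq h2 hc (inv_smul_smul a o))
  · filter_upwards [ht.eventually h3] with x hx
    rw [mul_smul, hx, smul_inv_smul]

end ExtendTensor

section ExtendForm

variable {E : Type*} [NormedAddCommGroup E] [NormedSpace ℝ E] [FiniteDimensional ℝ E]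
  {F : Type*} [NormedAddCommGroup F] [NormedSpace ℝ F] [FiniteDimensional ℝ F]
  {G : Type*} [TopologicalSpace G] [ChartedSpace E G] [Group G] [LieGroup 𝓘(ℝ, E) ∞ G]
  {M : Type*} [TopologicalSpace M] [ChartedSpace F M] [MulAction G M]
  [IsManifold 𝓘(ℝ, F) ∞ M] [ContMDiffSMul 𝓘(ℝ, E) 𝓘(ℝ, F) ∞ G M]

lemma hasFDerivAt_extChartAt_comp {f : F → M} {y : F} {x : M}
    (hf : MDifferentiableAt 𝓘(ℝ, F) 𝓘(ℝ, F) f y) (hx : f y = x) (L : F →L[ℝ] F)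
    (hL : mfderiv 𝓘(ℝ, F) 𝓘(ℝ, F) f y = L) :
    HasFDerivAt (fun z ↦ extChartAt 𝓘(ℝ, F) x (f z)) L y := by
  exact hasFDerivAt_chart hf hx L hL

/-- The tensor field obtained by translating a form at `o`. -/
def translateForm (β : F →L[ℝ] F →L[ℝ] ℝ) (a : M → G) : Tensor2 F M := fun x ↦
  let B : F →L[ℝ] F →L[ℝ] ℝ := β.bilinearComp (actDeriv (a x)⁻¹ x) (actDeriv (a x)⁻¹ x)
  B

lemma formAt_translateForm (β : F →L[ℝ] F →L[ℝ] ℝ) (a : M → G) (x : M) (u v : F) :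
    formAt (translateForm β a) x u v
      = β (actDeriv (a x)⁻¹ x u) (actDeriv (a x)⁻¹ x v) := rfl

/-- The derivative of the inverse of a chart, as a map of the model space. -/
def chartSymmDeriv (x : M) (y : F) : F →L[ℝ] F :=
  mfderiv 𝓘(ℝ, F) 𝓘(ℝ, F) (extChartAt 𝓘(ℝ, F) x).symm y

lemma inChart_eq_formAt (T : Tensor2 F M) (x : M) (y u v : F) :
    inChart T x y u v = formAt T ((extChartAt 𝓘(ℝ, F) x).symm y)
      (chartSymmDeriv x y u) (chartSymmDeriv x y v) := rfl

/-- An isotropy invariant symmetric form extends to an invariant tensor field. -/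
theorem exists_isInvSym_formAt [MulAction.IsPretransitive G M] {o : M}
    (hs : Function.Surjective (orbitCLM (F := F) E G o)) (β : F →L[ℝ] F →L[ℝ] ℝ)
    (hsymm : ∀ u v, β u v = β v u)
    (hinv : ∀ z ∈ MulAction.stabilizer G o, ∀ u v,
      β (actDeriv z o u) (actDeriv z o v) = β u v) :
    ∃ T : Tensor2 F M, IsInvSym G T ∧ ∀ u v, formAt T o u v = β u v := by
  choose a ha using MulAction.exists_smul_eq G o
  -- Two elements carrying `o` to `x` differ by an isotropy element, which preserves `β`. So the
  -- arbitrary choice `a` may be replaced by any other, in particular by a smooth local section.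
  have key : ∀ (c : G) (x : M), c • o = x → ∀ u v, formAt (translateForm β a) x u v
      = β (actDeriv c⁻¹ x u) (actDeriv c⁻¹ x v) := by
    intro c x hc u v
    rw [formAt_translateForm]
    have hz : (a x)⁻¹ * c ∈ MulAction.stabilizer G o := by
      rw [MulAction.mem_stabilizer_iff, mul_smul, hc, inv_smul_eq_iff, ha]
    have h1 : ∀ w : F, actDeriv (a x)⁻¹ x w = actDeriv ((a x)⁻¹ * c) o (actDeriv c⁻¹ x w) := by
      intro w
      have h2 := actDeriv_mul E ((a x)⁻¹ * c) c⁻¹ x w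
      rw [mul_inv_cancel_right, ← hc, inv_smul_smul] at h2
      rw [← hc]
      exact h2
    rw [h1, h1, hinv _ hz]
  refine ⟨translateForm β a, ⟨?_, ?_, ?_⟩, ?_⟩
  · intro x₀
    rw [contMDiffAt_tensor2_iff]
    obtain ⟨c₀, rfl⟩ := MulAction.exists_smul_eq G o x₀
    obtain ⟨σ, hσ1, hσ2, hσ3⟩ := exists_section_orbit_at hs c₀
    set x₀ := c₀ • o with hx₀
    set y₀ := extChartAt 𝓘(ℝ, F) x₀ x₀ with hy₀
    have hκ : ContMDiffAt 𝓘(ℝ, F) 𝓘(ℝ, F) ∞ (extChartAt 𝓘(ℝ, F) x₀).symm y₀ :=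
      contMDiffAt_extChartAt_symm x₀ (mem_extChartAt_target x₀)
    have hκ0 : (extChartAt 𝓘(ℝ, F) x₀).symm y₀ = x₀ := extChartAt_to_inv x₀
    -- The point at which the section is taken and the point acted upon are kept apart, so that `D`
    -- below is a partial derivative of a smooth function of two variables.
    let Ψ : F × F → M := fun q ↦
      (σ ((extChartAt 𝓘(ℝ, F) x₀).symm q.1))⁻¹ • (extChartAt 𝓘(ℝ, F) x₀).symm q.2
    have hΨ0 : Ψ (y₀, y₀) = o := by
      simp only [Ψ, hκ0, hσ2]
      rw [hx₀, inv_smul_smul]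
    have hΨ : ContMDiffAt 𝓘(ℝ, F × F) 𝓘(ℝ, F) ∞ Ψ (y₀, y₀) := by
      have h1 : ContMDiffAt 𝓘(ℝ, F × F) 𝓘(ℝ, F) ∞
          (fun q : F × F ↦ (extChartAt 𝓘(ℝ, F) x₀).symm q.1) (y₀, y₀) :=
        ContMDiffAt.comp (I' := 𝓘(ℝ, F)) _ hκ contDiff_fst.contMDiff.contMDiffAt
      have h2 : ContMDiffAt 𝓘(ℝ, F × F) 𝓘(ℝ, F) ∞
          (fun q : F × F ↦ (extChartAt 𝓘(ℝ, F) x₀).symm q.2) (y₀, y₀) :=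
        ContMDiffAt.comp (I' := 𝓘(ℝ, F)) _ hκ contDiff_snd.contMDiff.contMDiffAt
      have h3 : ContMDiffAt 𝓘(ℝ, F × F) 𝓘(ℝ, E) ∞
          (fun q : F × F ↦ σ ((extChartAt 𝓘(ℝ, F) x₀).symm q.1)) (y₀, y₀) :=
        ContMDiffAt.comp_of_eq hσ1 h1 hκ0
      exact h3.inv.smul h2
    let Φ : F × F → F := fun q ↦ extChartAt 𝓘(ℝ, F) o (Ψ q)
    have hΦ : ContDiffAt ℝ ∞ Φ (y₀, y₀) := by
      rw [← contMDiffAt_iff_contDiffAt]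
      exact ContMDiffAt.comp_of_eq (contMDiffAt_extChartAt (I := 𝓘(ℝ, F)) (n := ∞) (x := o)) hΨ hΨ0
    let D : F → F →L[ℝ] F := fun y ↦ (fderiv ℝ Φ (y, y)).comp (ContinuousLinearMap.inr ℝ F F)
    have hD : ContDiffAt ℝ ∞ D y₀ := by
      have h1 : ContDiffAt ℝ ∞ (fun y : F ↦ fderiv ℝ Φ (y, y)) y₀ :=
        ContDiffAt.comp (f := fun y : F ↦ (y, y)) y₀ (hΦ.fderiv_right (m := ∞) (by simp))
          (contDiffAt_id.prodMk contDiffAt_id)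
      exact h1.clm_comp contDiffAt_const
    have hdiag : Tendsto (fun y : F ↦ (y, y)) (𝓝 y₀) (𝓝 (y₀, y₀)) := by
      have : ContinuousAt (fun y : F ↦ (y, y)) y₀ := by fun_prop
      exact this
    have hev : ∀ᶠ y in 𝓝 y₀, ∀ u v,
        inChart (translateForm β a) x₀ y u v = β (D y u) (D y v) := by
      have e1 : ∀ᶠ y in 𝓝 y₀, σ ((extChartAt 𝓘(ℝ, F) x₀).symm y) • o
          = (extChartAt 𝓘(ℝ, F) x₀).symm y := by
        have t : Tendsto (extChartAt 𝓘(ℝ, F) x₀).symm (𝓝 y₀) (𝓝 x₀) := by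
          have := hκ.continuousAt.tendsto
          rwa [hκ0] at this
        exact t.eventually hσ3
      filter_upwards [e1, extChartAt_target_mem_nhds (I := 𝓘(ℝ, F)) x₀,
        hdiag.eventually ((hΦ.of_le (n := ∞) (m := 1) (by simp)).eventually (by simp))]
        with y h1 h2 h3 u v
      have h4 : ∀ w : F, actDeriv (σ ((extChartAt 𝓘(ℝ, F) x₀).symm y))⁻¹
          ((extChartAt 𝓘(ℝ, F) x₀).symm y)
          (chartSymmDeriv x₀ y w) = D y w := by
        intro w
        have d1 : HasFDerivAt (fun z ↦ Φ (y, z)) (D y) y :=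
          HasFDerivAt.comp (f := fun z : F ↦ (y, z)) y (h3.differentiableAt (by simp)).hasFDerivAt
            (hasFDerivAt_pair_right y y)
        have d2 := HasMFDerivAt.comp y (mdifferentiableAt_const_smul (F := F) E
          (σ ((extChartAt 𝓘(ℝ, F) x₀).symm y))⁻¹ ((extChartAt 𝓘(ℝ, F) x₀).symm y)).hasMFDerivAt
          ((contMDiffAt_extChartAt_symm x₀ h2).mdifferentiableAt (by simp)).hasMFDerivAt
        have d3 := hasFDerivAt_extChartAt_comp (x := o) d2.mdifferentiableAt (by
          simp only [Function.comp_apply]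
          rw [inv_smul_eq_iff, h1]) _ rfl
        have d4 := d1.unique d3
        rw [d4]
        exact (congrArg (fun l : F →L[ℝ] F ↦ l w) d2.mfderiv).symm
      rw [inChart_eq_formAt, key _ _ h1, h4, h4]
    have hB : ContDiffAt ℝ ∞ (fun y ↦ β.bilinearComp (D y) (D y)) y₀ := by
      let Λ := (ContinuousLinearMap.flipₗᵢ ℝ F F ℝ).toContinuousLinearEquiv.toContinuousLinearMap
      have h1 : ContDiffAt ℝ ∞ (fun y ↦ β.comp (D y)) y₀ := contDiffAt_const.clm_comp hD
      have h2 : ContDiffAt ℝ ∞ (fun y ↦ Λ (β.comp (D y))) y₀ := Λ.contDiff.contDiffAt.comp y₀ h1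
      have h3 : ContDiffAt ℝ ∞ (fun y ↦ (Λ (β.comp (D y))).comp (D y)) y₀ := h2.clm_comp hD
      exact Λ.contDiff.contDiffAt.comp y₀ h3
    refine hB.congr_of_eventuallyEq ?_
    filter_upwards [hev] with y hy
    ext u v
    exact hy u v
  · intro x u v
    exact hsymm _ _
  · intro c x (u : F) (v : F)
    obtain ⟨d, rfl⟩ := MulAction.exists_smul_eq G o x
    have h1 := key (c * d) (c • d • o) (mul_smul _ _ _) (actDeriv c (d • o) u)
      (actDeriv c (d • o) v)
    have h2 := key d (d • o) rfl u v
    have h3 : ∀ w : F, actDeriv (c * d)⁻¹ (c • d • o) (actDeriv c (d • o) w)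
        = actDeriv d⁻¹ (d • o) w := by
      intro w
      rw [mul_inv_rev, actDeriv_mul E, actDeriv_inv_actDeriv E, inv_smul_smul]
    rw [h3, h3, ← h2] at h1
    exact h1
  · intro u v
    rw [key 1 o (one_smul G o), inv_one, actDeriv_one, actDeriv_one]

end ExtendForm

/-! ### Bilinear forms, their matrices and positivity near the identity. -/

section RicciForm

variable {F : Type*} [NormedAddCommGroup F] [NormedSpace ℝ F]

lemma curvatureEndo_add_left (γ : F → F →L[ℝ] F →L[ℝ] ℝ) (y v v' w : F) :
    curvatureEndo γ y (v + v') w = curvatureEndo γ y v w + curvatureEndo γ y v' w := by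
  ext u
  simp only [curvatureEndo_apply, map_add, _root_.add_apply]
  abel

lemma curvatureEndo_smul_left (γ : F → F →L[ℝ] F →L[ℝ] ℝ) (c : ℝ) (y v w : F) :
    curvatureEndo γ y (c • v) w = c • curvatureEndo γ y v w := by
  ext u
  simp only [curvatureEndo_apply, map_smul, _root_.smul_apply, smul_add, smul_sub]

lemma curvatureEndo_add_right (γ : F → F →L[ℝ] F →L[ℝ] ℝ) (y v w w' : F) :
    curvatureEndo γ y v (w + w') = curvatureEndo γ y v w + curvatureEndo γ y v w' := by
  ext u
  simp only [curvatureEndo_apply, map_add, _root_.add_apply]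
  abel

lemma curvatureEndo_smul_right (γ : F → F →L[ℝ] F →L[ℝ] ℝ) (c : ℝ) (y v w : F) :
    curvatureEndo γ y v (c • w) = c • curvatureEndo γ y v w := by
  ext u
  simp only [curvatureEndo_apply, map_smul, _root_.smul_apply, smul_add, smul_sub]

/-- The Ricci tensor in coordinates as a bilinear map. -/
def ricciBilin (γ : F → F →L[ℝ] F →L[ℝ] ℝ) (y : F) : F →ₗ[ℝ] F →ₗ[ℝ] ℝ :=
  LinearMap.mk₂ ℝ (ricciCoord γ y)
    (fun v v' w ↦ by
      rw [ricciCoord, curvatureEndo_add_left, ContinuousLinearMap.toLinearMap_add, map_add]; rfl)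
    (fun c v w ↦ by
      rw [ricciCoord, curvatureEndo_smul_left, ContinuousLinearMap.toLinearMap_smul, map_smul]; rfl)
    (fun v w w' ↦ by
      rw [ricciCoord, curvatureEndo_add_right, ContinuousLinearMap.toLinearMap_add, map_add]; rfl)
    (fun c v w ↦ by
      rw [ricciCoord, curvatureEndo_smul_right, ContinuousLinearMap.toLinearMap_smul, map_smul]; rfl)

lemma bilin_eq_sum {n : ℕ} (ε : Module.Basis (Fin n) ℝ F) (R : F →ₗ[ℝ] F →ₗ[ℝ] ℝ) (u v : F) :
    R u v = ∑ i, ∑ j, ε.repr u i * ε.repr v j * R (ε i) (ε j) := by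
  conv_lhs => rw [← ε.sum_repr u, ← ε.sum_repr v]
  simp only [map_sum, map_smul, LinearMap.sum_apply, LinearMap.smul_apply, smul_eq_mul,
    Finset.mul_sum]
  rw [Finset.sum_comm]
  exact Finset.sum_congr rfl fun _ _ ↦ Finset.sum_congr rfl fun _ _ ↦ by ring

variable [FiniteDimensional ℝ F]

/-- The bilinear form with a given matrix. -/
def formOfMat {n : ℕ} (ε : Module.Basis (Fin n) ℝ F) (S : Matrix (Fin n) (Fin n) ℝ) :
    F →L[ℝ] F →L[ℝ] ℝ :=
  ∑ i, ∑ j, S i j • (LinearMap.toContinuousLinearMap (ε.coord i)).smulRight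
    (LinearMap.toContinuousLinearMap (ε.coord j))

lemma formOfMat_apply {n : ℕ} (ε : Module.Basis (Fin n) ℝ F) (S : Matrix (Fin n) (Fin n) ℝ)
    (u v : F) : formOfMat ε S u v = ∑ i, ∑ j, ε.repr u i * ε.repr v j * S i j := by
  simp only [formOfMat, _root_.sum_apply, _root_.smul_apply, ContinuousLinearMap.smulRight_apply,
    LinearMap.coe_toContinuousLinearMap', Module.Basis.coord_apply, smul_eq_mul]
  exact Finset.sum_congr rfl fun _ _ ↦ Finset.sum_congr rfl fun _ _ ↦ by ring

lemma formOfMat_basis {n : ℕ} (ε : Module.Basis (Fin n) ℝ F) (S : Matrix (Fin n) (Fin n) ℝ)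
    (a b : Fin n) : formOfMat ε S (ε a) (ε b) = S a b := by
  rw [formOfMat_apply]
  simp [Finsupp.single_apply]

/-- As `|w_p w_q| ≤ ∑ w_k²`, the perturbation `X` changes the quadratic form by at most `∑ |X_ij|`
times `∑ w_k²`, which is less than the unperturbed value. -/
lemma pos_of_gramMat {n : ℕ} (ε : Module.Basis (Fin n) ℝ F) (B : F →L[ℝ] F →L[ℝ] ℝ)
    (X : Matrix (Fin n) (Fin n) ℝ) (hB : gramMat B ε = 1 + X) (hX : ∑ i, ∑ j, |X i j| < 1) (u : F)
    (hu : u ≠ 0) : 0 < B u u := by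
  rw [bilin_apply_basis B ε, hB]
  set w : Fin n → ℝ := fun i ↦ ε.repr u i with hw
  have hN : 0 < ∑ k, w k ^ 2 := by
    refine lt_of_le_of_ne (Finset.sum_nonneg fun _ _ ↦ sq_nonneg _) fun h ↦ hu ?_
    have h1 := (Finset.sum_eq_zero_iff_of_nonneg fun k _ ↦ sq_nonneg (w k)).1 h.symm
    rw [← ε.sum_repr u]
    refine Finset.sum_eq_zero fun i hi ↦ ?_
    have h2 : w i = 0 := by simpa using h1 i hi
    rw [show ε.repr u i = 0 from h2, zero_smul]
  have h1 : ∑ p, ∑ q, w p * w q * (1 + X) p q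
      = ∑ k, w k ^ 2 + ∑ p, ∑ q, w p * w q * X p q := by
    simp only [Matrix.add_apply, mul_add, Finset.sum_add_distrib, Matrix.one_apply]
    congr 1
    refine Finset.sum_congr rfl fun p _ ↦ ?_
    simp [pow_two]
  have h2 : -(∑ p, ∑ q, |X p q|) * ∑ k, w k ^ 2 ≤ ∑ p, ∑ q, w p * w q * X p q := by
    rw [neg_mul, Finset.sum_mul, ← Finset.sum_neg_distrib]
    refine Finset.sum_le_sum fun p _ ↦ ?_
    rw [Finset.sum_mul, ← Finset.sum_neg_distrib]
    refine Finset.sum_le_sum fun q _ ↦ ?_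
    have h3 : |w p * w q| ≤ ∑ k, w k ^ 2 := by
      have hp : w p ^ 2 ≤ ∑ k, w k ^ 2 :=
        Finset.single_le_sum (f := fun k ↦ w k ^ 2) (fun _ _ ↦ sq_nonneg _) (Finset.mem_univ p)
      have hq : w q ^ 2 ≤ ∑ k, w k ^ 2 :=
        Finset.single_le_sum (f := fun k ↦ w k ^ 2) (fun _ _ ↦ sq_nonneg _) (Finset.mem_univ q)
      rw [abs_le]
      constructor <;> nlinarith [sq_nonneg (w p + w q), sq_nonneg (w p - w q)]
    have h4 : |w p * w q * X p q| ≤ |X p q| * ∑ k, w k ^ 2 := by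
      rw [abs_mul, mul_comm]
      exact mul_le_mul_of_nonneg_left h3 (abs_nonneg _)
    exact (abs_le.1 h4).1
  change 0 < ∑ p, ∑ q, w p * w q * (1 + X) p q
  rw [h1]
  nlinarith

end RicciForm

/-! ### Automorphisms, and isotropy invariance of the Ricci tensor. -/

section Automorphisms

variable {E : Type*} [NormedAddCommGroup E] [NormedSpace ℝ E]
  {F : Type*} [NormedAddCommGroup F] [NormedSpace ℝ F]
  {G : Type*} [TopologicalSpace G] [ChartedSpace E G] [Group G] [LieGroup 𝓘(ℝ, E) ∞ G]
  {M : Type*} [TopologicalSpace M] [ChartedSpace F M] [MulAction G M]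
  [IsManifold 𝓘(ℝ, F) ∞ M] [ContMDiffSMul 𝓘(ℝ, E) 𝓘(ℝ, F) ∞ G M] {o : M}

/-- The derivatives of an automorphism of `G` and of the induced map of `M` are intertwined by the
derivative of the orbit map. -/
lemma orbitCLM_hom {φ : G → G} {ψ : M → M} (hφ : ContMDiffAt 𝓘(ℝ, E) 𝓘(ℝ, E) ∞ φ 1)
    (hφ1 : φ 1 = 1) (hψ : MDifferentiableAt 𝓘(ℝ, F) 𝓘(ℝ, F) ψ o) (hψo : ψ o = o)
    (hφψ : ∀ a : G, ψ (a • o) = φ a • o) (L : E →L[ℝ] E)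
    (hL : mfderiv 𝓘(ℝ, E) 𝓘(ℝ, E) φ 1 = L) (D : F →L[ℝ] F)
    (hD : mfderiv 𝓘(ℝ, F) 𝓘(ℝ, F) ψ o = D) (X : E) :
    orbitCLM (F := F) E G o (L X) = D (orbitCLM E G o X) := by
  have hB := hasFDerivAt_orbit_chart (G := G) o (orbitCLM (F := F) E G o) rfl
  have hA := hasFDerivAt_chart (hφ.mdifferentiableAt (by simp)) hφ1 L hL
  have hC := hasFDerivAt_chart hψ hψo D hD
  have h1 := HasFDerivAt.comp (g := fun a : E ↦ chartAct E G o (a, extChartAt 𝓘(ℝ, F) o o))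
    (g' := orbitCLM (F := F) E G o) (extChartAt 𝓘(ℝ, E) (1 : G) 1)
    (by rw [extChartAt_to_inv, hφ1]; exact hB) hA
  have h2 := HasFDerivAt.comp (f := fun a : E ↦ chartAct E G o (a, extChartAt 𝓘(ℝ, F) o o))
    (g := fun y ↦ extChartAt 𝓘(ℝ, F) o (ψ ((extChartAt 𝓘(ℝ, F) o).symm y)))
    (g' := D) (extChartAt 𝓘(ℝ, E) (1 : G) 1) (by rw [chartAct_self]; exact hC) hB
  refine DFunLike.congr_fun ((h1.congr_of_eventuallyEq ?_).unique h2) X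
  filter_upwards [eventually_symm_chart_of_one hφ hφ1, (tendsto_pair_left _ _).eventually
    (eventually_symm_chartAct (F := F) E G o)] with a h3 h4
  simp only [Function.comp_apply, h4]
  simp only [chartAct, h3, extChartAt_to_inv, hφψ]

lemma lieBr_hom {φ : G → G} (hφ : ContMDiffAt 𝓘(ℝ, E) 𝓘(ℝ, E) ∞ φ 1)
    (hmul : ∀ a b, φ (a * b) = φ a * φ b) (h1 : φ 1 = 1) (L : E →L[ℝ] E)
    (hL : mfderiv 𝓘(ℝ, E) 𝓘(ℝ, E) φ 1 = L) (X Y : E) :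
    L (lieBr E G X Y) = lieBr E G (L X) (L Y) :=
  mfderiv_hom_localBracket hφ hmul h1 L hL X Y

lemma formAt_actDeriv_stabilizer {T : Tensor2 F M} (hT : IsInvSym G T) {z : G}
    (hz : z ∈ MulAction.stabilizer G o) (u v : F) :
    formAt T o (actDeriv z o u) (actDeriv z o v) = formAt T o u v := by
  have h := hT.apply_actDeriv z o u v
  rwa [MulAction.mem_stabilizer_iff.1 hz] at h

lemma actDeriv_injective (E : Type*) [NormedAddCommGroup E] [NormedSpace ℝ E]
    [ChartedSpace E G] [ContMDiffSMul 𝓘(ℝ, E) 𝓘(ℝ, F) ∞ G M] (a : G) (x : M) :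
    Function.Injective (actDeriv (F := F) a x) := fun u v h ↦ by
  rw [← actDeriv_inv_actDeriv E a x u, h, actDeriv_inv_actDeriv E]

end Automorphisms

section Main

variable {E : Type*} [NormedAddCommGroup E] [NormedSpace ℝ E] [FiniteDimensional ℝ E]
  {F : Type*} [NormedAddCommGroup F] [NormedSpace ℝ F] [FiniteDimensional ℝ F]
  {G : Type*} [TopologicalSpace G] [ChartedSpace E G] [Group G] [LieGroup 𝓘(ℝ, E) ∞ G]
  {M : Type*} [TopologicalSpace M] [ChartedSpace F M] [MulAction G M]
  [IsManifold 𝓘(ℝ, F) ∞ M] [ContMDiffSMul 𝓘(ℝ, E) 𝓘(ℝ, F) ∞ G M] {o : M}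
  {p : Submodule ℝ (GroupLieAlgebra 𝓘(ℝ, E) G)} {n : ℕ}
  (hs : Function.Surjective (orbitCLM (F := F) E G o)) (hp : IsReductive (F := F) o p)
  (b : Module.Basis (Fin n) ℝ p)

/-- The Ricci tensor at `o`, as a bilinear form on the model space. -/
def ricciAt (h : Tensor2 F M) (o : M) : F →ₗ[ℝ] F →ₗ[ℝ] ℝ :=
  ricciBilin (inChart h o) (extChartAt 𝓘(ℝ, F) o o)

lemma ricciAt_apply (h : Tensor2 F M) (o : M) (u v : F) : ricciAt h o u v = ricci h o u v :=
  (ricci_eq h o u v).symm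

/-- The isotropy representation preserves the Ricci tensor of an invariant metric. -/
lemma ricciAt_actDeriv (hs : Function.Surjective (orbitCLM (F := F) E G o))
    (hp : IsReductive (F := F) o p) (b : Module.Basis (Fin n) ℝ p)
    (huni : IsUnimodular E G) {h : Tensor2 F M} (hh : IsInvMetric G h) {z : G}
    (hz : z ∈ MulAction.stabilizer G o) (u v : F) :
    ricciAt h o (actDeriv z o u) (actDeriv z o v) = ricciAt h o u v := by
  let Q : F →ₗ[ℝ] F := (actDeriv (F := F) z o : F →L[ℝ] F)
  let e : F ≃ₗ[ℝ] F := LinearEquiv.ofBijective Q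
    ⟨actDeriv_injective E z o, actDeriv_surjective E z o⟩
  let f : E →L[ℝ] E := Ad E z
  have hz1 : z * 1 * z⁻¹ = 1 := by simp
  have hfo : ∀ X, orbitCLM (F := F) E G o (f X) = actDeriv z o (orbitCLM E G o X) :=
    orbitCLM_hom (φ := fun a ↦ z * a * z⁻¹) (ψ := fun y ↦ z • y) (contMDiff_conj z).contMDiffAt hz1
      (mdifferentiableAt_const_smul E z o) hz (fun a ↦ by
        have : z⁻¹ • o = o := by rw [inv_smul_eq_iff]; exact hz.symm
        rw [mul_smul, mul_smul, this]) f rfl (actDeriv z o) rfl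
  have hf : ∀ X Y, f (lieBr E G X Y) = lieBr E G (f X) (f Y) :=
    lieBr_hom (φ := fun a ↦ z * a * z⁻¹) (contMDiff_conj z).contMDiffAt (fun a b ↦ by group) hz1 f rfl
  have h1 : ∀ i j, ricciAt h o (Q (frame hs hp b i)) (Q (frame hs hp b j))
      = ricciAt h o (frame hs hp b i) (frame hs hp b j) := by
    intro i j
    have h2 := ricci_hom_frame hs hp b huni hh hf
      (fun Z hZ ↦ by rw [hfo, hZ, map_zero]) ((frame hs hp b).map e)
      (fun i ↦ by rw [hfo, orbitCLM_apply_basis hs hp b]; rw [Module.Basis.map_apply]; rfl) i j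
    have h3 := ricci_hom_frame hs hp b huni hh (f := ContinuousLinearMap.id ℝ E) (fun _ _ ↦ rfl)
      (fun _ h ↦ h) (frame hs hp b) (orbitCLM_apply_basis hs hp b) i j
    -- `Ad z` induces the isotropy action on `T_oM`, and invariance of `h` keeps the Gram matrix;
    -- the Ricci formula therefore gives the same values in both frames.
    have h4 : gramMat (formAt h o) ((frame hs hp b).map e)
        = gramMat (formAt h o) (frame hs hp b) := by
      ext i j
      exact formAt_actDeriv_stabilizer hh.toIsInvSym hz _ _
    rw [h4, ← h3] at h2
    rw [ricciAt_apply, ricciAt_apply]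
    exact h2
  have h5 : (ricciAt h o).compl₁₂ Q Q = ricciAt h o :=
    LinearMap.ext_basis (frame hs hp b) (frame hs hp b) h1
  exact LinearMap.congr_fun₂ h5 u v

end Main

section Matrices

variable {E : Type*} [NormedAddCommGroup E] [NormedSpace ℝ E]
  {F : Type*} [NormedAddCommGroup F] [NormedSpace ℝ F]
  {G : Type*} [TopologicalSpace G] [ChartedSpace E G] [Group G]
  {M : Type*} [TopologicalSpace M] [ChartedSpace F M] [MulAction G M] {o : M}
  {p : Submodule ℝ (GroupLieAlgebra 𝓘(ℝ, E) G)} {n : ℕ} (b : Module.Basis (Fin n) ℝ p)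

lemma mat_add (T S : Tensor2 F M) : mat o b (T + S) = mat o b T + mat o b S := rfl

lemma mat_smul (c : ℝ) (T : Tensor2 F M) : mat o b (c • T) = c • mat o b T := rfl

lemma mat_zero : mat o b (0 : Tensor2 F M) = 0 := rfl

lemma mat_isSymm [IsManifold 𝓘(ℝ, F) ∞ M] {T : Tensor2 F M} (hT : IsInvSym G T) :
    (mat o b T).IsSymm := by
  ext i j
  exact hT.symm o _ _

end Matrices

/-- Matrices near the identity in a two-parameter family. -/
lemma eventually_near_one {n : ℕ} (A B : Matrix (Fin n) (Fin n) ℝ) :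
    ∀ᶠ s in 𝓝 (0 : ℝ), 0 < (1 + s • B).det ∧ ∀ᶠ t in 𝓝 (0 : ℝ),
      (∑ i, ∑ j, |(t • A + s • B) i j| < 1 ∧ 0 < (1 + s • B + t • A).det) := by
  have hc1 : Continuous fun q : ℝ × ℝ ↦ ∑ i, ∑ j, |(q.2 • A + q.1 • B) i j| :=
    continuous_finsetSum _ fun i _ ↦ continuous_finsetSum _ fun j _ ↦ by
      simp only [Matrix.add_apply, Matrix.smul_apply, smul_eq_mul]
      fun_prop
  have hc2 : Continuous fun q : ℝ × ℝ ↦ (1 + q.1 • B + q.2 • A).det :=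
    Continuous.matrix_det (by fun_prop)
  have h1 : ∀ᶠ q in 𝓝 ((0 : ℝ), (0 : ℝ)), ∑ i, ∑ j, |(q.2 • A + q.1 • B) i j| < 1 :=
    hc1.continuousAt.eventually_lt continuousAt_const (by simp)
  have h2 : ∀ᶠ q in 𝓝 ((0 : ℝ), (0 : ℝ)), 0 < (1 + q.1 • B + q.2 • A).det :=
    continuousAt_const.eventually_lt hc2.continuousAt (by simp)
  have h3 := h1.and h2
  rw [nhds_prod_eq] at h3
  -- The nested form matches the iterated derivative in `scalHess`: the inner one must be known for
  -- each small `s`.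
  filter_upwards [h3.curry] with s hs
  refine ⟨?_, hs⟩
  have := hs.self_of_nhds.2
  simpa using this

/-! ### Variations of scalar curvature, Ricci tensor and Einstein operator. -/

section Variations

variable {E : Type*} [NormedAddCommGroup E] [NormedSpace ℝ E] [FiniteDimensional ℝ E]
  {F : Type*} [NormedAddCommGroup F] [NormedSpace ℝ F] [FiniteDimensional ℝ F]
  {G : Type*} [TopologicalSpace G] [ChartedSpace E G] [Group G] [LieGroup 𝓘(ℝ, E) ∞ G]
  {M : Type*} [TopologicalSpace M] [ChartedSpace F M] [MulAction G M]
  [IsManifold 𝓘(ℝ, F) ∞ M] [ContMDiffSMul 𝓘(ℝ, E) 𝓘(ℝ, F) ∞ G M] {o : M}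
  {p : Submodule ℝ (GroupLieAlgebra 𝓘(ℝ, E) G)} {n : ℕ}
  (hs : Function.Surjective (orbitCLM (F := F) E G o)) (hp : IsReductive (F := F) o p)
  (b : Module.Basis (Fin n) ℝ p)

include hs hp in
lemma IsInvSym.ext_mat [MulAction.IsPretransitive G M] {T S : Tensor2 F M} (hT : IsInvSym G T)
    (hS : IsInvSym G S) (h : mat o b T = mat o b S) : T = S := by
  refine IsInvSym.ext_at E hT hS o fun u v ↦ ?_
  rw [mat_eq_gramMat hs hp b, mat_eq_gramMat hs hp b] at h
  rw [bilin_apply_basis _ (frame hs hp b), bilin_apply_basis _ (frame hs hp b), h]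

include hs hp in
lemma IsInvSym.isInvMetric_of_mat [MulAction.IsPretransitive G M] {T : Tensor2 F M}
    (hT : IsInvSym G T) (X : Matrix (Fin n) (Fin n) ℝ) (h : mat o b T = 1 + X)
    (hX : ∑ i, ∑ j, |X i j| < 1) : IsInvMetric G T :=
  IsInvSym.isInvMetric E hT o
    (pos_of_gramMat (frame hs hp b) (formAt T o) X (by rw [← mat_eq_gramMat hs hp b, h]) hX)

lemma IsInvMetric.smul {h : Tensor2 F M} (hh : IsInvMetric G h) {c : ℝ} (hc : 0 < c) :
    IsInvMetric G (c • h) where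
  toIsInvSym := hh.toIsInvSym.smul c
  pos x u hu := mul_pos hc (hh.pos x u hu)

lemma ricciAt_frame (huni : IsUnimodular E G) {h : Tensor2 F M} (hh : IsInvMetric G h)
    (i j : Fin n) : ricciAt h o (frame hs hp b i) (frame hs hp b j)
      = ricMat (muP hp b) (killingP hs hp b) (mat o b h) i j := by
  rw [ricciAt_apply, mat_eq_gramMat hs hp b]
  exact ricci_hom_frame hs hp b huni hh (f := ContinuousLinearMap.id ℝ E) (fun _ _ ↦ rfl)
    (fun _ h ↦ h) (frame hs hp b) (orbitCLM_apply_basis hs hp b) i j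

lemma ricMat_one (huni : IsUnimodular E G) {g : Tensor2 F M} (hg : IsInvMetric G g) {ρ : ℝ}
    (hρ : IsEinstein g ρ) (hb : IsOrthonormal o b g) :
    ricMat (muP hp b) (killingP hs hp b) 1 = ρ • 1 := by
  have h1 := gram_ricci hs hp b huni hg
  rw [show mat o b g = 1 from hb] at h1
  rw [← h1, ← show mat o b g = 1 from hb]
  ext i j
  exact hρ o _ _

lemma scal_unitVol (huni : IsUnimodular E G) {h : Tensor2 F M} (hh : IsInvMetric G h)
    (hd : 0 < (mat o b h).det) :
    scal o b (unitVol o b h) = normScal (muP hp b) (killingP hs hp b) (mat o b h) := by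
  have h1 : IsInvMetric G (unitVol o b h) := hh.smul (Real.rpow_pos_of_pos hd _)
  rw [scal, gram_ricci hs hp b huni h1, unitVol, mat_smul,
    trace_smul_inv_mul_ricMat _ hd (mat_isSymm b hh.toIsInvSym)]

variable [MulAction.IsPretransitive G M]

/-- The Hessian of the scalar curvature in terms of the operator `L_𝔭`. -/
theorem scalHess_eq (huni : IsUnimodular E G) {g : Tensor2 F M} (hg : IsInvMetric G g) {ρ : ℝ}
    (hρ : IsEinstein g ρ) (hb : IsOrthonormal o b g) {T S : Tensor2 F M} (hT : IsInvSym G T)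
    (hS : IsInvSym G S) (htr : (mat o b T).trace = 0)
    (hs : Function.Surjective (orbitCLM (F := F) E G o)) (hp : IsReductive (F := F) o p) :
    scalHess o b g T S
      = (1 / 2) * frob (mat o b T) ((2 * ρ) • mat o b S - Lp hp b (mat o b S)) := by
  have hc := muP_antisymm hs hp b
  refine HasDerivAt.deriv (HasDerivAt.congr_of_eventuallyEq (hasDerivAt_normScalDeriv hc
    (killingP hs hp b) (mat_isSymm b hS) htr (ricMat_one hs hp b huni hg hρ hb)) ?_)
  filter_upwards [eventually_near_one (mat o b T) (mat o b S)] with s ⟨h1, h2⟩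
  refine HasDerivAt.deriv (HasDerivAt.congr_of_eventuallyEq
    (hasDerivAt_normScal hc (killingP hs hp b) (mat o b T) h1) ?_)
  filter_upwards [h2] with t ⟨h3, h4⟩
  have h5 : mat o b (g + t • T + s • S) = 1 + (t • mat o b T + s • mat o b S) := by
    rw [mat_add, mat_add, mat_smul, mat_smul, show mat o b g = 1 from hb, add_assoc]
  have h6 : mat o b (g + t • T + s • S) = 1 + s • mat o b S + t • mat o b T := by
    rw [h5, add_assoc, add_comm (t • _)]
  have h7 : IsInvMetric G (g + t • T + s • S) := IsInvSym.isInvMetric_of_mat hs hp b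
    ((hg.toIsInvSym.add (hT.smul t)).add (hS.smul s)) _ h5 h3
  rw [scal_unitVol hs hp b huni h7 (by rw [h6]; exact h4), h6]

include hs hp in
lemma eventually_isInvMetric {g : Tensor2 F M} (hg : IsInvMetric G g)
    (hb : IsOrthonormal o b g) {T : Tensor2 F M} (hT : IsInvSym G T) :
    ∀ᶠ t in 𝓝 (0 : ℝ), IsInvMetric G (g + t • T) ∧ 0 < (mat o b (g + t • T)).det := by
  filter_upwards [(eventually_near_one (mat o b T) 0).self_of_nhds.2] with t ⟨h1, h2⟩
  have h3 : mat o b (g + t • T) = 1 + t • mat o b T := by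
    rw [mat_add, mat_smul, show mat o b g = 1 from hb]
  refine ⟨IsInvSym.isInvMetric_of_mat hs hp b (hg.toIsInvSym.add (hT.smul t)) _ h3
    (by simpa using h1), ?_⟩
  rw [h3]
  simpa using h2

/-- The first variation of the Ricci tensor. -/
lemma hasDerivAt_ricciAt (huni : IsUnimodular E G) {g : Tensor2 F M} (hg : IsInvMetric G g)
    (hb : IsOrthonormal o b g) {T : Tensor2 F M} (hT : IsInvSym G T) (u v : F) :
    HasDerivAt (fun t : ℝ ↦ ricciAt (g + t • T) o u v)
      (formOfMat (frame hs hp b) ((1 / 2 : ℝ) • Lp hp b (mat o b T)) u v) 0 := by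
  have h1 := (MatHasDerivAt.line 1 (mat o b T) 0).ricMat (muP_antisymm hs hp b)
    (killingP hs hp b) (mat_isSymm b hT) (by simp)
  rw [formOfMat_apply]
  refine HasDerivAt.congr_of_eventuallyEq (HasDerivAt.fun_sum fun i _ ↦ HasDerivAt.fun_sum fun j _ ↦
    (h1 i j).const_mul ((frame hs hp b).repr u i * (frame hs hp b).repr v j)) ?_
  filter_upwards [eventually_isInvMetric hs hp b hg hb hT] with t ht
  rw [bilin_eq_sum (frame hs hp b)]
  refine Finset.sum_congr rfl fun i _ ↦ Finset.sum_congr rfl fun j _ ↦ ?_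
  rw [ricciAt_frame hs hp b huni ht.1, mat_add, mat_smul, show mat o b g = 1 from hb]

/-- The operator `L_𝔭` preserves the space of invariant symmetric tensors. -/
theorem exists_mat_eq_Lp (hs : Function.Surjective (orbitCLM (F := F) E G o))
    (huni : IsUnimodular E G) {g : Tensor2 F M} (hg : IsInvMetric G g)
    (hb : IsOrthonormal o b g) {T : Tensor2 F M} (hT : IsInvSym G T) :
    ∃ T' : Tensor2 F M, IsInvSym G T' ∧ mat o b T' = Lp hp b (mat o b T) := by
  set β := formOfMat (frame hs hp b) ((1 / 2 : ℝ) • Lp hp b (mat o b T)) with hβ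
  have hL : (Lp hp b (mat o b T)).IsSymm := lichOp_isSymm (muP_antisymm hs hp b) (mat_isSymm b hT)
  obtain ⟨T', hT', h1⟩ := exists_isInvSym_formAt hs β (fun u v ↦ by
    rw [hβ, formOfMat_apply, formOfMat_apply, Finset.sum_comm]
    refine Finset.sum_congr rfl fun i _ ↦ Finset.sum_congr rfl fun j _ ↦ ?_
    rw [(hL.smul (1 / 2 : ℝ)).apply, mul_comm ((frame hs hp b).repr u j)]) (fun z hz u v ↦ by
    -- The form is the derivative of the Ricci tensors of `g + t • T`, and each of these is isotropy
    -- invariant for small `t`.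
    refine (hasDerivAt_ricciAt hs hp b huni hg hb hT _ _).unique
      (HasDerivAt.congr_of_eventuallyEq (hasDerivAt_ricciAt hs hp b huni hg hb hT u v) ?_)
    filter_upwards [eventually_isInvMetric hs hp b hg hb hT] with t ht
    exact ricciAt_actDeriv hs hp b huni ht.1 hz u v)
  -- The derivative of Ricci is only half of `L_𝔭`.
  refine ⟨(2 : ℝ) • T', hT'.smul 2, ?_⟩
  rw [mat_smul, mat_eq_gramMat hs hp b]
  ext i j
  have h2 := h1 (frame hs hp b i) (frame hs hp b j)
  rw [hβ, formOfMat_basis] at h2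
  change (2 : ℝ) * formAt T' o (frame hs hp b i) (frame hs hp b j) = _
  rw [h2, Matrix.smul_apply, smul_eq_mul]
  ring

/-- The kernel of the derivative of the Einstein operator on the traceless tensors. -/
theorem inKerEinstein_iff (hs : Function.Surjective (orbitCLM (F := F) E G o))
    (huni : IsUnimodular E G) {g : Tensor2 F M} (hg : IsInvMetric G g) {ρ : ℝ}
    (hρ : IsEinstein g ρ) (hb : IsOrthonormal o b g) {T : Tensor2 F M} (hT : IsInvSym G T)
    (htr : (mat o b T).trace = 0) :
    InKerEinstein o b g T ↔ Lp hp b (mat o b T) = (2 * ρ) • mat o b T := by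
  have hc := muP_antisymm hs hp b
  have h1 := ricMat_one hs hp b huni hg hρ hb
  have hg1 : mat o b g = 1 := hb
  -- The first variation of the scalar curvature at `g` is `-ρ tr T`.
  have hsc : HasDerivAt (fun t : ℝ ↦ scal o b (g + t • T)) 0 0 := by
    have h2 := (MatHasDerivAt.line 1 (mat o b T) 0).scalMat hc (killingP hs hp b) (by simp)
    have h3 : frob (mat o b T) (ρ • (1 : Matrix (Fin n) (Fin n) ℝ)) = 0 := by
      rw [frob_eq_trace_mul _ (Matrix.isSymm_one.smul ρ), Matrix.mul_smul, mul_one,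
        Matrix.trace_smul, htr, smul_zero]
    simp only [zero_smul, add_zero, inv_one, one_mul, mul_one, h1, h3, neg_zero] at h2
    refine h2.congr_of_eventuallyEq ?_
    filter_upwards [eventually_isInvMetric hs hp b hg hb hT] with t ht
    rw [scal, gram_ricci hs hp b huni ht.1, trace_inv_mul_ricMat _ (isUnit_det_of_ne ht.2.ne')
      (mat_isSymm b ht.1.toIsInvSym), mat_add, mat_smul, hg1]
  have hsc0 : scal o b g = n * ρ := by
    rw [scal, gram_ricci hs hp b huni hg, hg1, h1, inv_one, one_mul, Matrix.trace_smul,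
      Matrix.trace_one, Fintype.card_fin, smul_eq_mul, mul_comm]
  have hd : ∀ u v : F, deriv (fun t : ℝ ↦ einsteinOp o b (g + t • T) u v) 0
      = formOfMat (frame hs hp b) ((1 / 2 : ℝ) • Lp hp b (mat o b T)) u v
        - n * ρ / n * formAt T o u v := by
    intro u v
    have h2 : HasDerivAt (fun t : ℝ ↦ formAt g o u v + t * formAt T o u v) (formAt T o u v) 0 := by
      simpa using ((hasDerivAt_id (0 : ℝ)).mul_const (formAt T o u v)).const_add (formAt g o u v)
    have h3 := (hasDerivAt_ricciAt hs hp b huni hg hb hT u v).sub ((hsc.div_const (n : ℝ)).mul h2)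
    refine HasDerivAt.deriv ((h3.congr_of_eventuallyEq ?_).congr_deriv ?_)
    · refine Eventually.of_forall fun t ↦ ?_
      exact congrArg (· - _) (ricciAt_apply (g + t • T) o u v).symm
    · simp [hsc0]
  have hT' : ∀ i j, formAt T o (frame hs hp b i) (frame hs hp b j) = mat o b T i j := fun i j ↦ by
    rw [mat_eq_gramMat hs hp b]; rfl
  -- The coefficient `n * ρ / n` is `ρ` only for `n > 0`; for `n = 0` both sides hold trivially.
  rcases Nat.eq_zero_or_pos n with rfl | hn
  · refine iff_of_true (fun (u : F) (v : F) ↦ ?_) (Subsingleton.elim _ _)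
    refine (hd u v).trans ?_
    rw [formOfMat_apply]
    simp
  have hn' : (n : ℝ) * ρ / n = ρ := by field_simp
  rw [hn'] at hd
  constructor
  · intro h
    ext i j
    have h2 := (hd (frame hs hp b i) (frame hs hp b j)).symm.trans (h _ _)
    rw [formOfMat_basis, hT', Matrix.smul_apply, smul_eq_mul] at h2
    rw [Matrix.smul_apply, smul_eq_mul]
    linarith
  · intro h (u : F) (v : F)
    refine (hd u v).trans ?_
    rw [formOfMat_apply, bilin_apply_basis (formAt T o) (frame hs hp b), ← mat_eq_gramMat hs hp b,
      Finset.mul_sum, ← Finset.sum_sub_distrib]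
    refine Finset.sum_eq_zero fun i _ ↦ ?_
    rw [Finset.mul_sum, ← Finset.sum_sub_distrib]
    refine Finset.sum_eq_zero fun j _ ↦ ?_
    rw [h, Matrix.smul_apply, Matrix.smul_apply, smul_eq_mul, smul_eq_mul]
    ring

end Variations

/-! ### Trivial variations are eigenvectors. -/

section TrivialVariations

variable {E : Type*} [NormedAddCommGroup E] [NormedSpace ℝ E] [FiniteDimensional ℝ E]
  {F : Type*} [NormedAddCommGroup F] [NormedSpace ℝ F] [FiniteDimensional ℝ F]
  {G : Type*} [TopologicalSpace G] [ChartedSpace E G] [Group G] [LieGroup 𝓘(ℝ, E) ∞ G]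
  {M : Type*} [TopologicalSpace M] [ChartedSpace F M] [MulAction G M]
  [IsManifold 𝓘(ℝ, F) ∞ M] [ContMDiffSMul 𝓘(ℝ, E) 𝓘(ℝ, F) ∞ G M] {o : M}
  {p : Submodule ℝ (GroupLieAlgebra 𝓘(ℝ, E) G)} {n : ℕ}

/-- A map of `M` induced by a smooth map of `G` is differentiable. -/
lemma mdifferentiableAt_of_lift (hs : Function.Surjective (orbitCLM (F := F) E G o)) {φ : G → G}
    {ψ : M → M} (hφ : ContMDiffAt 𝓘(ℝ, E) 𝓘(ℝ, E) ∞ φ 1) (hφψ : ∀ a : G, ψ (a • o) = φ a • o) :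
    MDifferentiableAt 𝓘(ℝ, F) 𝓘(ℝ, F) ψ o := by
  obtain ⟨s, h1, h2, h3⟩ := exists_section_orbit hs
  have h4 : MDifferentiableAt 𝓘(ℝ, F) 𝓘(ℝ, E) (fun x ↦ φ (s x)) o :=
    (ContMDiffAt.comp_of_eq hφ h2 h1).mdifferentiableAt (by simp)
  have h5 : MDifferentiableAt 𝓘(ℝ, F) 𝓘(ℝ, F) (fun x ↦ φ (s x) • o) o :=
    MDifferentiableAt.comp (g := fun a : G ↦ a • o) (f := fun x ↦ φ (s x)) o
      (mdifferentiableAt_orbit (E := E) (F := F) o (φ (s o))) h4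
  refine h5.congr_of_eventuallyEq ?_
  filter_upwards [h3] with x hx
  rw [← hφψ, hx]

/-- The coordinates of a vector in the kernel of `D` form a null vector of the Gram matrix of the `D
(ε i)`. -/
lemma injective_of_det_gramMat (ε : Module.Basis (Fin n) ℝ F) (B : F →L[ℝ] F →L[ℝ] ℝ)
    (D : F →L[ℝ] F) (h : (gramMat B fun i ↦ D (ε i)).det ≠ 0) : Function.Injective D := by
  rw [injective_iff_map_eq_zero]
  intro u hu
  have h1 : (fun i ↦ ε.repr u i) = 0 := by
    refine Matrix.eq_zero_of_vecMul_eq_zero h ?_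
    ext j
    have h2 := bilin_apply_basis_right (B.bilinearComp D D) ε u j
    rw [ContinuousLinearMap.bilinearComp_apply, hu, map_zero, _root_.zero_apply] at h2
    exact h2.symm
  rw [← ε.sum_repr u]
  exact Finset.sum_eq_zero fun i _ ↦ by rw [show ε.repr u i = 0 from congrFun h1 i, zero_smul]

/-- The trivial variations are eigenvectors of `L_𝔭` with eigenvalue `2ρ`. -/
theorem Lp_mat_of_isTrivialVariation [MulAction.IsPretransitive G M]
    (hs : Function.Surjective (orbitCLM (F := F) E G o)) (hp : IsReductive (F := F) o p)
    (b : Module.Basis (Fin n) ℝ p) (huni : IsUnimodular E G) {g : Tensor2 F M}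
    (hg : IsInvMetric G g) {ρ : ℝ} (hρ : IsEinstein g ρ) (hb : IsOrthonormal o b g)
    {S : Tensor2 F M} (hS : IsInvSym G S) (hgS : IsTrivialVariation E G o g S) :
    Lp hp b (mat o b S) = (2 * ρ) • mat o b S := by
  obtain ⟨φ, ψ, hφ, -, hφ0, hψ, hder⟩ := hgS
  have hφt : ∀ t, ContMDiffAt 𝓘(ℝ, E) 𝓘(ℝ, E) ∞ (φ t) 1 := fun t ↦
    (hφ.comp (contMDiff_const.prodMk contMDiff_id)).contMDiffAt
  have hψo : ∀ t, ψ t o = o := fun t ↦ by simpa using hψ t 1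
  have hψd : ∀ t, MDifferentiableAt 𝓘(ℝ, F) 𝓘(ℝ, F) (ψ t) o := fun t ↦
    mdifferentiableAt_of_lift hs (hφt t) (hψ t)
  let f : ℝ → E →L[ℝ] E := fun t ↦ mfderiv 𝓘(ℝ, E) 𝓘(ℝ, E) (φ t) 1
  let D : ℝ → F →L[ℝ] F := fun t ↦ mfderiv 𝓘(ℝ, F) 𝓘(ℝ, F) (ψ t) o
  have hfD : ∀ t X, orbitCLM (F := F) E G o (f t X) = D t (orbitCLM E G o X) := fun t X ↦
    orbitCLM_hom (hφt t) (map_one (φ t)) (hψd t) (hψo t) (hψ t) (f t) rfl (D t) rfl X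
  have hf : ∀ t X Y, f t (lieBr E G X Y) = lieBr E G (f t X) (f t Y) := fun t X Y ↦
    lieBr_hom (hφt t) (map_mul (φ t)) (map_one (φ t)) (f t) rfl X Y
  set ε := frame hs hp b with hε
  -- The matrix of `ψ_t^* g` at `o`, viewed as the Gram matrix of the fixed metric `g` in a moving
  -- frame.
  let H : ℝ → Matrix (Fin n) (Fin n) ℝ := fun t ↦ gramMat (formAt g o) fun i ↦ D t (ε i)
  have hψ0 : ψ 0 = id := by
    funext x
    obtain ⟨a, rfl⟩ := MulAction.exists_smul_eq G o x
    rw [hψ, hφ0, id]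
  have hD0 : ∀ u, D 0 u = u := by
    intro u
    have h1 : D 0 = (mfderiv 𝓘(ℝ, F) 𝓘(ℝ, F) (id : M → M) o : F →L[ℝ] F) := by
      simp only [D]
      rw [hψ0]
    rw [h1, mfderiv_id]
    rfl
  have hH0 : H 0 = 1 := by
    have : mat o b g = 1 := hb
    rw [← this, mat_eq_gramMat hs hp b]
    simp only [H, hD0, hε]
  have hH : MatHasDerivAt H (mat o b S) 0 := by
    intro i j
    have h1 := hder o (ε i) (ε j)
    have h2 : ∀ t, formAt g (ψ t o) (D t (ε i)) (D t (ε j)) = H t i j := fun t ↦ by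
      rw [hψo]; rfl
    rw [mat_eq_gramMat hs hp b]
    exact h1.congr_of_eventuallyEq (Eventually.of_forall fun t ↦ (h2 t).symm)
  have hdet : ∀ᶠ t in 𝓝 (0 : ℝ), (H t).det ≠ 0 :=
    hH.differentiableAt_det.continuousAt.eventually_ne (by rw [hH0, Matrix.det_one]; exact one_ne_zero)
  -- `ricMat` at `H t` is the Ricci tensor of `g` itself in the frame `D t ε`, a frame as long as
  -- `det (H t) ≠ 0`. So the Einstein equation holds along `H`, and its derivative at `0` is `½ L S
  -- = ρ S`.
  have hR : ∀ᶠ t in 𝓝 (0 : ℝ), ∀ i j, ricMat (muP hp b) (killingP hs hp b) (H t) i j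
      = ρ * H t i j := by
    filter_upwards [hdet] with t ht i j
    let e : F ≃ₗ[ℝ] F := LinearEquiv.ofInjectiveEndo (D t : F →ₗ[ℝ] F)
      (injective_of_det_gramMat ε (formAt g o) (D t) ht)
    have h1 := ricci_hom_frame hs hp b huni hg (hf t)
      (fun Z hZ ↦ by rw [hfD, hZ, map_zero]) (ε.map e)
      (fun i ↦ by rw [hfD, orbitCLM_apply_basis hs hp b, Module.Basis.map_apply]; rfl) i j
    exact h1.symm.trans (hρ o _ _)
  have hd := hH.ricMat (muP_antisymm hs hp b) (killingP hs hp b) (mat_isSymm b hS) hH0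
  ext i j
  have h1 := (hd i j).unique (((hH i j).const_mul ρ).congr_of_eventuallyEq
    (hR.mono fun t ht ↦ ht i j))
  rw [Matrix.smul_apply, smul_eq_mul] at h1 ⊢
  rw [Lp]
  linarith

end TrivialVariations

/-! ### The operator on the space `W`. -/

section Complement

variable {E : Type*} [NormedAddCommGroup E] [NormedSpace ℝ E] [FiniteDimensional ℝ E]
  {F : Type*} [NormedAddCommGroup F] [NormedSpace ℝ F] [FiniteDimensional ℝ F]
  {G : Type*} [TopologicalSpace G] [ChartedSpace E G] [Group G] [LieGroup 𝓘(ℝ, E) ∞ G]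
  {M : Type*} [TopologicalSpace M] [ChartedSpace F M] [MulAction G M]
  [IsManifold 𝓘(ℝ, F) ∞ M] [ContMDiffSMul 𝓘(ℝ, E) 𝓘(ℝ, F) ∞ G M] {o : M}
  {p : Submodule ℝ (GroupLieAlgebra 𝓘(ℝ, E) G)} {n : ℕ} (b : Module.Basis (Fin n) ℝ p)

lemma InW.add {g T S : Tensor2 F M} (hT : InW o b g T) (hS : InW o b g S) :
    InW o b g (T + S) where
  invSym := hT.invSym.add hS.invSym
  orth_metric := by
    rw [mat_add, add_mul, Matrix.trace_add, hT.orth_metric, hS.orth_metric, add_zero]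
  orth_trivial R h1 h2 := by
    rw [mat_add, add_mul, Matrix.trace_add, hT.orth_trivial R h1 h2, hS.orth_trivial R h1 h2,
      add_zero]

lemma InW.smul (c : ℝ) {g T : Tensor2 F M} (hT : InW o b g T) : InW o b g (c • T) where
  invSym := hT.invSym.smul c
  orth_metric := by
    rw [mat_smul, Matrix.smul_mul, Matrix.trace_smul, hT.orth_metric, smul_zero]
  orth_trivial R h1 h2 := by
    rw [mat_smul, Matrix.smul_mul, Matrix.trace_smul, hT.orth_trivial R h1 h2, smul_zero]

lemma IsInvSym.zero {g : Tensor2 F M} (hg : IsInvSym G g) : IsInvSym G (0 : Tensor2 F M) := by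
  have := hg.smul 0
  rwa [zero_smul] at this

/-- The space `W`, as a space of matrices. -/
def matW (o : M) (b : Module.Basis (Fin n) ℝ p) {g : Tensor2 F M} (hg : IsInvSym G g) :
    Submodule ℝ (Matrix (Fin n) (Fin n) ℝ) where
  carrier := {A | ∃ T, InW o b g T ∧ mat o b T = A}
  add_mem' := by
    rintro _ _ ⟨T, hT, rfl⟩ ⟨S, hS, rfl⟩
    exact ⟨T + S, hT.add b hS, mat_add b T S⟩
  zero_mem' := ⟨0, ⟨hg.zero, by rw [mat_zero, zero_mul, Matrix.trace_zero],
    fun S _ _ ↦ by rw [mat_zero, zero_mul, Matrix.trace_zero]⟩, mat_zero b⟩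
  smul_mem' := by
    rintro c _ ⟨T, hT, rfl⟩
    exact ⟨c • T, hT.smul b c, mat_smul b c T⟩

lemma isSymm_of_mem_matW {g : Tensor2 F M} (hg : IsInvSym G g) {A : Matrix (Fin n) (Fin n) ℝ}
    (hA : A ∈ matW o b hg) : A.IsSymm := by
  obtain ⟨T, hT, rfl⟩ := hA
  exact mat_isSymm b hT.invSym

lemma InW.trace_mat {g T : Tensor2 F M} (hT : InW o b g T) (hb : IsOrthonormal o b g) :
    (mat o b T).trace = 0 := by
  have := hT.orth_metric
  rwa [show mat o b g = 1 from hb, mul_one] at this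

variable [MulAction.IsPretransitive G M]

/-- The operator `L_𝔭` preserves `W`. -/
theorem InW.exists_mat_eq_Lp (hs : Function.Surjective (orbitCLM (F := F) E G o))
    (hp : IsReductive (F := F) o p)
    (huni : IsUnimodular E G) {g : Tensor2 F M} (hg : IsInvMetric G g) {ρ : ℝ}
    (hρ : IsEinstein g ρ) (hb : IsOrthonormal o b g) {T : Tensor2 F M} (hT : InW o b g T) :
    ∃ T' : Tensor2 F M, InW o b g T' ∧ mat o b T' = Lp hp b (mat o b T) := by
  have hc := muP_antisymm hs hp b
  have hA := mat_isSymm (o := o) b hT.invSym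
  obtain ⟨T', hT', h1⟩ := HomEinstein.exists_mat_eq_Lp hp b hs huni hg hb hT.invSym
  refine ⟨T', ⟨hT', ?_, fun S hS hgS ↦ ?_⟩, h1⟩
  -- `⟨L A, 1⟩ = ⟨A, L 1⟩ = 0`.
  · rw [h1, show mat o b g = 1 from hb, ← frob_eq_trace_mul _ Matrix.isSymm_one, frob_comm, Lp,
      frob_lichOp_comm hc hA Matrix.isSymm_one, lichOp_one hc, frob_eq_trace_mul _ (by simp)]
    simp
  · have hB := mat_isSymm (o := o) b hS
    -- `⟨L A, B⟩ = ⟨A, L B⟩ = 2ρ ⟨A, B⟩ = 0` for a trivial variation `B`.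
    rw [h1, ← frob_eq_trace_mul _ hB, frob_comm, Lp, frob_lichOp_comm hc hA hB]
    have h2 := Lp_mat_of_isTrivialVariation hs hp b huni hg hρ hb hS hgS
    rw [Lp] at h2
    rw [h2, frob_smul_right, frob_eq_trace_mul _ hB, hT.orth_trivial S hS hgS, mul_zero]

/-- The restriction of `L_𝔭` to `W`. -/
def LpW (hs : Function.Surjective (orbitCLM (F := F) E G o)) (hp : IsReductive (F := F) o p)
    (huni : IsUnimodular E G) {g : Tensor2 F M} (hg : IsInvMetric G g) {ρ : ℝ}
    (hρ : IsEinstein g ρ) (hb : IsOrthonormal o b g) :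
    matW o b hg.toIsInvSym →ₗ[ℝ] matW o b hg.toIsInvSym where
  toFun A := ⟨Lp hp b A, by
    obtain ⟨_, T, hT, rfl⟩ := A
    exact hT.exists_mat_eq_Lp b hs hp huni hg hρ hb⟩
  map_add' A B := Subtype.ext (lichOp_add (muP_antisymm hs hp b)
    (isSymm_of_mem_matW b _ A.2) (isSymm_of_mem_matW b _ B.2))
  map_smul' c A := Subtype.ext (lichOp_smul (muP_antisymm hs hp b) c (isSymm_of_mem_matW b _ A.2))

end Complement

end HomEinstein

end

theorem proposition4p5
    {E : Type*} [NormedAddCommGroup E] [NormedSpace ℝ E] [FiniteDimensional ℝ E]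
    {F : Type*} [NormedAddCommGroup F] [NormedSpace ℝ F] [FiniteDimensional ℝ F]
    -- a Lie group `G`, acting smoothly and transitively on the connected manifold `M`
    {G : Type*} [TopologicalSpace G] [ChartedSpace E G] [Group G] [LieGroup 𝓘(ℝ, E) ∞ G]
    {M : Type*} [TopologicalSpace M] [ConnectedSpace M] [ChartedSpace F M]
    [IsManifold 𝓘(ℝ, F) ∞ M]
    [MulAction G M] [MulAction.IsPretransitive G M]
    [ContMDiffSMul 𝓘(ℝ, E) 𝓘(ℝ, F) ∞ G M]
    -- `M = G / K` as a manifold, `K` the stabilizer of `o`: the orbit map is a submersion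
    (o : M) (hsub : Function.Surjective (HomEinstein.orbitDeriv (F := F) E G o))
    -- `G` is unimodular
    (huni : HomEinstein.IsUnimodular E G)
    -- a reductive decomposition
    (p : Submodule ℝ (GroupLieAlgebra 𝓘(ℝ, E) G)) (hp : HomEinstein.IsReductive (F := F) o p)
    -- a `G`-invariant Einstein metric `g` and any orthonormal basis of `(𝔭, g_o)`
    (g : HomEinstein.Tensor2 F M) (hg : HomEinstein.IsInvMetric G g)
    (ρ : ℝ) (hρ : HomEinstein.IsEinstein g ρ)
    {n : ℕ} (b : Module.Basis (Fin n) ℝ p) (hb : HomEinstein.IsOrthonormal o b g) :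
    -- `L_𝔭` preserves `W`, and its restriction has a least and a greatest eigenvalue if `W ≠ 0`
    (∀ T, HomEinstein.InW o b g T → ∃ T', HomEinstein.InW o b g T' ∧
      HomEinstein.mat o b T' = HomEinstein.Lp hp b (HomEinstein.mat o b T)) ∧
    ((∃ T, HomEinstein.InW o b g T ∧ T ≠ 0) →
      (∃ c, IsLeast (HomEinstein.specW hp b g) c) ∧
      (∃ c, IsGreatest (HomEinstein.specW hp b g) c)) ∧
    -- stability
    (HomEinstein.GStable o b g ↔ ((2 * ρ : ℝ) : EReal) < HomEinstein.lamMin hp b g) ∧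
    -- instability
    (HomEinstein.GUnstable o b g ↔ HomEinstein.lamMin hp b g < ((2 * ρ : ℝ) : EReal)) ∧
    -- non-degeneracy and infinitesimal non-deformability
    (HomEinstein.GNonDegenerate o b g ↔ HomEinstein.GInfNonDeformable o b g) ∧
    (HomEinstein.GInfNonDeformable o b g ↔ 2 * ρ ∉ HomEinstein.specW hp b g) ∧
    -- neutral stability
    (HomEinstein.GNeutrallyStable o b g ↔
      HomEinstein.lamMin hp b g = ((2 * ρ : ℝ) : EReal)) ∧
    -- strong instability
    (HomEinstein.GStronglyUnstable o b g ↔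
      HomEinstein.lamMax hp b g < ((2 * ρ : ℝ) : EReal)) := by
  have hs : Function.Surjective (HomEinstein.orbitCLM (F := F) E G o) := hsub
  have hc := HomEinstein.muP_antisymm hs hp b
  let V := HomEinstein.matW o b hg.toIsInvSym
  let L : V →ₗ[ℝ] V := HomEinstein.LpW b hs hp huni hg hρ hb
  let q : V → V → ℝ := fun A B ↦ (1 / 2) *
    HomEinstein.frob A (((2 * ρ) • B - L B : V) : Matrix (Fin n) (Fin n) ℝ)
  let m : ∀ T, HomEinstein.InW o b g T → V := fun T hT ↦ ⟨HomEinstein.mat o b T, T, hT, rfl⟩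
  -- Every matrix in `V` comes from a tensor in `W`, so quantifiers over `V` and over `W` can be
  -- exchanged.
  have hall : ∀ P : V → Prop, (∀ A, P A) ↔ ∀ T hT, P (m T hT) := fun P ↦
    ⟨fun h T hT ↦ h _, fun h A ↦ by obtain ⟨_, T, hT, rfl⟩ := A; exact h T hT⟩
  have hex : ∀ P : V → Prop, (∃ A, P A) ↔ ∃ T hT, P (m T hT) := fun P ↦
    ⟨fun ⟨A, h⟩ ↦ by obtain ⟨_, T, hT, rfl⟩ := A; exact ⟨T, hT, h⟩, fun ⟨T, hT, h⟩ ↦ ⟨_, h⟩⟩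
  -- An invariant tensor is determined by its matrix at `o`, so nonzero tensors give nonzero
  -- matrices.
  have hm0 : ∀ T hT, m T hT = 0 ↔ T = 0 := fun T hT ↦
    ⟨fun h ↦ HomEinstein.IsInvSym.ext_mat hs hp b hT.invSym hg.toIsInvSym.zero
      (congrArg Subtype.val h), fun h ↦ Subtype.ext (by subst h; rfl)⟩
  have hqm : ∀ T hT S hS, q (m T hT) (m S hS) = HomEinstein.scalHess o b g T S :=
    fun T hT S hS ↦ (HomEinstein.scalHess_eq b huni hg hρ hb hT.invSym hS.invSym
      (hT.trace_mat b hb) hs hp).symm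
  have hLm : ∀ T hT (k : ℝ), L (m T hT) = k • m T hT ↔
      HomEinstein.Lp hp b (HomEinstein.mat o b T) = k • HomEinstein.mat o b T :=
    fun T hT k ↦ Subtype.ext_iff
  have hspec : HomEinstein.specW hp b g = {c | ∃ A : V, A ≠ 0 ∧ L A = c • A} := by
    ext c
    exact Iff.trans (exists_congr fun T ↦
      ⟨fun ⟨hT, h, h'⟩ ↦ ⟨hT, mt (hm0 T hT).1 h, (hLm T hT c).2 h'⟩,
        fun ⟨hT, h, h'⟩ ↦ ⟨hT, mt (hm0 T hT).2 h, (hLm T hT c).1 h'⟩⟩) (hex _).symm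
  have hker : ∀ T (hT : HomEinstein.InW o b g T), HomEinstein.InKerEinstein o b g T ↔
      L (m T hT) = (2 * ρ) • m T hT := fun T hT ↦
    (HomEinstein.inKerEinstein_iff hp b hs huni hg hρ hb hT.invSym (hT.trace_mat b hb)).trans
      (hLm T hT _).symm
  obtain ⟨h1, h2, h3, h4, h5, h6, h7⟩ := HomEinstein.stability_of_spectrum V L
    (fun A B ↦ (HomEinstein.frob_comm _ _).trans (HomEinstein.frob_lichOp_comm hc
      (HomEinstein.isSymm_of_mem_matW b _ A.2) (HomEinstein.isSymm_of_mem_matW b _ B.2)))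
    (2 * ρ) _ hspec q (fun _ _ ↦ rfl)
  simp only [hall, hex, ne_eq, hm0, hqm] at h1 h2 h3 h4 h5 h6 h7
  have e1 : (∀ T (hT : HomEinstein.InW o b g T), L (m T hT) = (2 * ρ) • m T hT → T = 0) ↔
      HomEinstein.GInfNonDeformable o b g :=
    forall_congr' fun T ↦ forall_congr' fun hT ↦ imp_congr_left (hker T hT).symm
  rw [e1] at h4 h5
  refine ⟨fun T hT ↦ hT.exists_mat_eq_Lp b hs hp huni hg hρ hb,
    fun ⟨T, hT, h⟩ ↦ h1 ⟨T, hT, h⟩, h2, ?_, h4, h5, h6, h7⟩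
  exact Iff.trans (exists_congr fun T ↦ exists_prop.symm) h3
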